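/- **Setting.** Let $f$ be holomorphic near $0$, odd, real on the real axis, with $f'(0)=0$ and $f'''(0)>0$. Put $$h(\tau)=\Big(\tfrac{4}{\sqrt{f'''(0)}\cosh\tau},-\tfrac{4\tanh\tau}{\sqrt{f'''(0)}\cosh\tau}\Big),\qquad K=\sup_\tau|h(\tau)|_{\mathbb R^2}+1 .$$ Let $X=\mathbb R^2$, let $Y$ be the space of pairs of $L^2(-\pi,\pi)$ sine series in $\sin kx$, $k\ge2$, let $L=(-1-\partial_{xx})^{1/2}$, $J(u,v)=(Lv,-Lu)$, $A(a,b)=(b,a)$, and let $Y_1=D(J)$ with the graph norm $(|W|_{L^2}^2+|JW|_{L^2}^2)^{1/2}$. Complexify $X$ and $Y_1$, keeping the names, with $|a+ib|=|a|+|b|$, and give $X\times Y_1$ the norm $|Z^h|_X+|Z^c|_{Y_1}$; $B_r$ is its open ball of radius $r$ about $0$. For $0<\epsilon<1$, the rescaled Klein–Gordon system for $W^h=(w^h,w_1^h)\in X$, $W^c=(w^c,w_1^c)\in Y_1$ is $$W^h_\tau=AW^h+F(W),\qquad W^c_\tau=\tfrac J\epsilon W^c+\epsilon G(W),$$ $$F(W)=\Big(\tfrac1{\sqrt{1-\epsilon^2}}-1\Big)AW^h-\tfrac{1}{\sqrt{1-\epsilon^2}\,\epsilon^3}\big(0,P_hf(\epsilon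 w^h\sin x+\epsilon w^c)\big),$$ $$G(W)=\tfrac{1}{1-\epsilon^2}\Big(0,\;L^{-1}\big(w^c-\tfrac1{\epsilon^3}P_cf(\epsilon w^h\sin x+\epsilon w^c)\big)\Big),$$ where $P_hg=\frac1\pi\int_{-\pi}^{\pi}g\sin x\,dx$ and $P_cg=g-(P_hg)\sin x$. Given $K_1>0$, let $\Omega_m=B_{2K-(m-1)K_1\epsilon}$. **Partial normal form step.** Start with $F_1=F$, $G_1=0$, $\tilde G_1=G$ on $\Omega_1$. Let $$\partial_\tau Z^h=AZ^h+F_k(Z),\qquad \partial_\tau Z^c=\tfrac J\epsilon Z^c+\epsilon G_k(Z)Z^c+\epsilon^k\tilde G_k(Z)$$ be the system on $\Omega_k$, where $Z^h=(z^h,z_1^h)$, $Z^c=(z^c,z_1^c)$, $F_k(Z)\in X$, $G_k(Z)\in L(Y_1,Y_1)$, $\tilde G_k(Z)=(\tilde G_k^c,\tilde G^c_{1,k})(Z)\in Y_1$. The transformation $I+\Gamma_{k+1}:Z\mapsto Z'$ is given implicitly by $$\begin{aligned} z'^h&=z^h-\epsilon^{k+2}\big(\langle L^{-1}D_2\tilde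 G^c_{1,k},z_1'^c\rangle+\langle L^{-1}D_2\tilde G^c_{k},z^c\rangle\big),\\ z_1'^h&=z_1^h+\epsilon^{k+2}\big(\langle L^{-1}D_1\tilde G^c_{1,k},z_1'^c\rangle+\langle L^{-1}D_1\tilde G^c_{k},z^c\rangle\big),\\ z'^c&=z^c-\epsilon^{k+1}L^{-1}\tilde G^c_{1,k},\qquad z_1'^c=z_1^c+\epsilon^{k+1}L^{-1}\tilde G^c_{k}, \end{aligned}$$ where $\tilde G^c_k,\tilde G^c_{1,k}$ and their derivatives $D_1,D_2$ in the first and second variable are evaluated at $(z^h,z_1'^h,0)\in\Omega_k$, and $\langle u,v\rangle=\int_{-\pi}^{\pi}(uv+u_xv_x)\,dx$. The transformed system has again the above form with $k+1$ in place of $k$, where $$\epsilon G_{k+1}(Z')=\epsilon G_k(Z')+\epsilon^k\int_0^1D_{Z^c}\tilde G_k\big(z^h,\,z_1'^h+p(z_1^h-z_1'^h),\,pZ^c\big)\,dp .$$ **Lemma.** For every $K_1>0$ there are $\epsilon_0\in(0,1)$, $c>0$ and $C>0$ (depending on $f$ and $K_1$) such that for every $\epsilon\in(0,\epsilon_0)$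 we have $[\frac c\epsilon]\ge2$, and for every $2\le m\le[\frac c\epsilon]$: 1. $2K-(m-1)K_1\epsilon>K$. 2. The $m$-th transformation $I+\Gamma_m$ is well defined: the implicit relation, with $k=m-1$, has a unique solution $Z'$ for each $Z\in B_{2K-(m-2)K_1\epsilon-K_1\epsilon/2}$, and $Z\mapsto Z'$ is an analytic diffeomorphism of this ball onto an open set containing $\Omega_m$. It preserves the symplectic form $\epsilon^{-1}dz^h\wedge dz_1^h+\langle dz^c\wedge dz_1^c\rangle$. It carries the $(m-1)$-st system to the $m$-th one, and $F_m,G_m,\tilde G_m$ are analytic on $\Omega_m$ with values in $X$, $L(Y_1,Y_1)$, $Y_1$ (also $F_1$ and $\tilde G_1$ are analytic on $\Omega_1$). 3. $$|\epsilon G_m|_{C^0(\Omega_m,L(Y_1,Y_1))}\le1-\frac1{2^m},\qquad|\epsilon^m\tilde G_m|_{C^2(\Omega_m,Y_1)}\le\frac{\epsilon}{2^m}.$$ Consequently, after the transformations with $2\le m\le N=[\frac c\epsilon]$, the oscillatory equation is $\partial_\tau Z^c=\frac J\epsilon Z^c+\epsilon G_N(Z)Z^c+\epsilon^N\tilde G_N(Z)$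 with $$|\epsilon^N\tilde G_N|_{C^2(B_K,Y_1)}\le C\,\epsilon\,e^{-c\log\sqrt2/\epsilon},$$ that is, $\{Z^c=0\}$ is invariant up to an error $O(e^{-c\log\sqrt2/\epsilon})$. -/

import Mathlib

open Filter Topology

namespace KleinGordon

noncomputable section

/-- Hypothesis (H) on the nonlinearity: `f` is holomorphic (only near `0`, which is all that is
ever used), odd, real on the real axis, `f'(0) = 0` and `f'''(0) > 0`. -/
structure HypH (f : ℂ → ℂ) : Prop where
  holomorphic : AnalyticAt ℂ f 0
  odd : ∀ᶠ z in 𝓝 (0 : ℂ), f (-z) = -f z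
  real : ∀ᶠ x : ℝ in 𝓝 (0 : ℝ), (f (x : ℂ)).im = 0
  deriv_zero : deriv f 0 = 0
  third_pos : 0 < (iteratedDeriv 3 f 0).re

/-- The homoclinic orbit `h` of the limiting Duffing equation; `a` stands for `f'''(0)`. -/
def homoclinic (a : ℝ) (τ : ℝ) : EuclideanSpace ℝ (Fin 2) :=
  !₂[4 / (√a * Real.cosh τ), -(4 * Real.tanh τ) / (√a * Real.cosh τ)]

/-- `K = |h|_{C⁰} + 1`. -/
def bigK (f : ℂ → ℂ) : ℝ := (⨆ τ : ℝ, ‖homoclinic (iteratedDeriv 3 f 0).re τ‖) + 1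

/-! ### The phase space

`L = (-1 - ∂ₓₓ)^{1/2}` acts on `sin (j x)`, `j ≥ 2`, as multiplication by `√(j² - 1)`.
An element of the complexified space `Y₁ = D(J)` is a pair of sine series
`∑ aₙ sin ((n+2) x)`, `∑ bₙ sin ((n+2) x)` (`n = 0, 1, 2, …`).  The squared graph norm
`|W|²_{L²} + |J W|²_{L²}` over `[-π, π]` equals
`π ∑ (1 + ((n+2)² - 1)) (|aₙ|² + |bₙ|²) = π ∑ (n+2)² (|aₙ|² + |bₙ|²)`.
`Y₁` is modelled as `ℓ²` by using the coordinates `√π (n+2) aₙ` and `√π (n+2) bₙ`. -/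

/-- The complexified space `Y₁`, in orthonormal coordinates for the graph norm of `J`. -/
abbrev Y1 : Type := lp (fun _ : ℕ × Fin 2 => ℂ) 2

/-- The coefficient of `sin ((n+2) x)` in the first component of an element of `Y₁`. -/
def fstC (y : Y1) (n : ℕ) : ℂ := y (n, 0) / ((√Real.pi * ((n : ℝ) + 2) : ℝ) : ℂ)

/-- The coefficient of `sin ((n+2) x)` in the second component of an element of `Y₁`. -/
def sndC (y : Y1) (n : ℕ) : ℂ := y (n, 1) / ((√Real.pi * ((n : ℝ) + 2) : ℝ) : ℂ)

/-- The complexified phase space `X × Y₁`, with points `((zʰ, z₁ʰ), Zᶜ)`. The product norm of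
Mathlib is used only for its topology; all estimates use `hnorm`, `cnorm` and `znorm`. -/
abbrev E : Type := (ℂ × ℂ) × Y1

/-- The norm on the complexification of `X = ℝ²`: the sum of the Euclidean norms of the real and
imaginary parts. -/
def hnorm (v : ℂ × ℂ) : ℝ :=
  √(v.1.re ^ 2 + v.2.re ^ 2) + √(v.1.im ^ 2 + v.2.im ^ 2)

/-- The norm on the complexification of `Y₁`: the sum of the graph norms of the real and imaginary
parts. -/
def cnorm (y : Y1) : ℝ :=
  √(∑' n : ℕ, Real.pi * ((n : ℝ) + 2) ^ 2 * ((fstC y n).re ^ 2 + (sndC y n).re ^ 2)) +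
  √(∑' n : ℕ, Real.pi * ((n : ℝ) + 2) ^ 2 * ((fstC y n).im ^ 2 + (sndC y n).im ^ 2))

/-- The norm `|Zʰ|_X + |Zᶜ|_{Y₁}` on the complexified `X × Y₁`. -/
def znorm (Z : E) : ℝ := hnorm Z.1 + cnorm Z.2

/-- The open ball of radius `r` about the origin of `X × Y₁`. -/
def zball (r : ℝ) : Set E := {Z | znorm Z < r}

/-- The radius `2K - (m-1) K₁ ε`. -/
def radius (K K₁ ε : ℝ) (m : ℕ) : ℝ := 2 * K - ((m : ℝ) - 1) * K₁ * ε

/-- The shrinking balls `Ω_m`. -/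
def Omega (K K₁ ε : ℝ) (m : ℕ) : Set E := zball (radius K K₁ ε m)

/-- `L⁻¹` on sine coefficients. -/
def linv (p : ℕ → ℂ) (n : ℕ) : ℂ := p n / ((√(((n : ℝ) + 2) ^ 2 - 1) : ℝ) : ℂ)

/-- `y = J z`, where `J (u, v) = (L v, -L u)`. As both `z` and `y` lie in `Y₁`, this says that
`z` lies in the domain of `J²`, which is dense in `Y₁`. -/
def IsJ (z y : Y1) : Prop :=
  ∀ n : ℕ, fstC y n = ((√(((n : ℝ) + 2) ^ 2 - 1) : ℝ) : ℂ) * sndC z n ∧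
    sndC y n = -(((√(((n : ℝ) + 2) ^ 2 - 1) : ℝ) : ℂ) * fstC z n)

/-- The (complex bilinear) `H¹` inner product `∫_{-π}^{π} (u v + uₓ vₓ) dx` of two sine series. -/
def pairH1 (p q : ℕ → ℂ) : ℂ :=
  ∑' n : ℕ, ((Real.pi * (1 + ((n : ℝ) + 2) ^ 2) : ℝ) : ℂ) * (p n * q n)

/-! ### The rescaled Klein-Gordon system -/

/-- The function `x ↦ wʰ sin x + wᶜ(x)`. -/
def profile (W : E) (x : ℝ) : ℂ :=
  W.1.1 * (Real.sin x : ℂ) + ∑' n : ℕ, fstC W.2 n * (Real.sin (((n : ℝ) + 2) * x) : ℂ)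

/-- The coefficient of `sin (j x)` of the odd function `x ↦ f (ε wʰ sin x + ε wᶜ(x))`. For `j = 1`
this is `P_h f`, and for `j ≥ 2` it is the `j`-th sine coefficient of `P_c f`. -/
def sineCoeff (f : ℂ → ℂ) (ε : ℝ) (W : E) (j : ℕ) : ℂ :=
  (1 / (Real.pi : ℂ)) *
    ∫ x in (-Real.pi)..Real.pi, f ((ε : ℂ) * profile W x) * (Real.sin ((j : ℝ) * x) : ℂ)

/-- The data of a system at stage `k`,
`∂_τ Zʰ = A Zʰ + F(Z)`, `∂_τ Zᶜ = (J/ε) Zᶜ + ε G(Z) Zᶜ + ε^k G̃(Z)`, where `A (a, b) = (b, a)`. -/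
structure Sys where
  F : E → ℂ × ℂ
  G : E → (Y1 →L[ℂ] Y1)
  Gt : E → Y1

/-- The right-hand side of the stage-`k` system at `Z`, where `y = J Zᶜ`. -/
def Sys.field (S : Sys) (ε : ℝ) (k : ℕ) (Z : E) (y : Y1) : E :=
  ((Z.1.2, Z.1.1) + S.F Z,
    (ε : ℂ)⁻¹ • y + (ε : ℂ) • S.G Z Z.2 + (ε : ℂ) ^ k • S.Gt Z)

/-- On `Ω`, `S` is the rescaled Klein-Gordon system
`W_τʰ = A Wʰ + F(W, ε)`, `W_τᶜ = (J/ε) Wᶜ + ε G(W, ε)`, seen as a system at stage `1`: the linear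
coefficient `S.G` vanishes and `S.Gt` is the nonlinearity
`G = (0, (1-ε²)⁻¹ L⁻¹ (wᶜ - ε⁻³ P_c f(ε wʰ sin x + ε wᶜ)))`. -/
def IsKGSystem (f : ℂ → ℂ) (ε : ℝ) (Ω : Set E) (S : Sys) : Prop :=
  ∀ W ∈ Ω,
    S.F W =
      (((1 / √(1 - ε ^ 2) - 1 : ℝ) : ℂ) * W.1.2,
       ((1 / √(1 - ε ^ 2) - 1 : ℝ) : ℂ) * W.1.1 -
         ((1 / (√(1 - ε ^ 2) * ε ^ 3) : ℝ) : ℂ) * sineCoeff f ε W 1) ∧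
    S.G W = 0 ∧
    (∀ n, fstC (S.Gt W) n = 0) ∧
    (∀ n, sndC (S.Gt W) n =
      linv (fun i => ((1 / (1 - ε ^ 2) : ℝ) : ℂ) *
        (fstC W.2 i - ((1 / ε ^ 3 : ℝ) : ℂ) * sineCoeff f ε W (i + 2))) n)

/-! ### The partial normal form transformation -/

/-- The point `(zʰ, z₁'ʰ, 0)` at which the remainder is evaluated in the generating function. -/
def mixedPt (Z Z' : E) : E := ((Z.1.1, Z'.1.2), 0)

/-- The relation between old variables `Z` and new variables `Z'` obtained from the generating
function
`⟨zᶜ, z₁'ᶜ⟩ + ε⁻¹ zʰ z₁'ʰ - ε^{k+1} ⟨L⁻¹ g₁ᶜ(zʰ, z₁'ʰ, 0), z₁'ᶜ⟩ - ε^{k+1} ⟨L⁻¹ gᶜ(zʰ, z₁'ʰ, 0), zᶜ⟩`,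
where `g = (gᶜ, g₁ᶜ)` is the remainder `G̃_k` of the stage-`k` system. -/
def GenRel (ε : ℝ) (k : ℕ) (g : E → Y1) (Z Z' : E) : Prop :=
  let q : E := mixedPt Z Z'
  let D₁ : Y1 := fderiv ℂ g q ((1, 0), 0)
  let D₂ : Y1 := fderiv ℂ g q ((0, 1), 0)
  Z'.1.1 = Z.1.1 - (ε : ℂ) ^ (k + 2) *
      (pairH1 (linv (sndC D₂)) (sndC Z'.2) + pairH1 (linv (fstC D₂)) (fstC Z.2)) ∧
  Z'.1.2 = Z.1.2 + (ε : ℂ) ^ (k + 2) *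
      (pairH1 (linv (sndC D₁)) (sndC Z'.2) + pairH1 (linv (fstC D₁)) (fstC Z.2)) ∧
  (∀ n, fstC Z'.2 n = fstC Z.2 n - (ε : ℂ) ^ (k + 1) * linv (sndC (g q)) n) ∧
  (∀ n, sndC Z'.2 n = sndC Z.2 n + (ε : ℂ) ^ (k + 1) * linv (fstC (g q)) n)

/-- The symplectic form `ε⁻¹ dzʰ ∧ dz₁ʰ + ⟨dzᶜ ∧ dz₁ᶜ⟩_{H¹}` for which the above function is a
generating function. -/
def sympForm (ε : ℝ) (U V : E) : ℂ :=
  (ε : ℂ)⁻¹ * (U.1.1 * V.1.2 - U.1.2 * V.1.1) +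
    (pairH1 (fstC U.2) (sndC V.2) - pairH1 (sndC U.2) (fstC V.2))

/-- The point `(zʰ, z₁'ʰ + p (z₁ʰ - z₁'ʰ), p Zᶜ)` of the segment from `mixedPt Z Z'` to `Z`. -/
def segPt (Z Z' : E) (p : ℝ) : E :=
  ((Z.1.1, Z'.1.2 + (p : ℂ) * (Z.1.2 - Z'.1.2)), (p : ℂ) • Z.2)

/-- `∫₀¹ D_{Zᶜ} g (segPt Z Z' p) dp`. -/
def avgDc (g : E → Y1) (Z Z' : E) : Y1 →L[ℂ] Y1 :=
  ∫ p in (0 : ℝ)..1, (fderiv ℂ g (segPt Z Z' p)).comp (ContinuousLinearMap.inr ℂ (ℂ × ℂ) Y1)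

/-- `Θ = I + Γ_{k+1}` is the partial normal form transformation of the stage-`k` system `S`
on `Ω_k`, and `S'` is the transformed system on `Ω_{k+1}`. -/
structure IsNormalFormStep (K K₁ ε : ℝ) (k : ℕ) (S S' : Sys)
    (Θ : OpenPartialHomeomorph E E) : Prop where
  /-- `Θ` is an analytic diffeomorphism from the ball of radius `2K - (k-1)K₁ε - K₁ε/2` ... -/
  source_eq : Θ.source = zball (radius K K₁ ε k - K₁ * ε / 2)
  /-- ... onto a region that contains `Ω_{k+1}`. -/
  subset_target : Omega K K₁ ε (k + 1) ⊆ Θ.target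
  analytic : AnalyticOnNhd ℂ Θ Θ.source
  analytic_symm : AnalyticOnNhd ℂ Θ.symm Θ.target
  /-- `Θ Z` is the unique solution of the relation given by the generating function. -/
  generated : ∀ Z ∈ Θ.source, ∀ Z' : E,
    (mixedPt Z Z' ∈ Omega K K₁ ε k ∧ GenRel ε k S.Gt Z Z') ↔ Z' = Θ Z
  symplectic : ∀ Z ∈ Θ.source, ∀ U V : E,
    sympForm ε (fderiv ℂ Θ Z U) (fderiv ℂ Θ Z V) = sympForm ε U V
  /-- `ε G_{k+1}(Z') = ε G_k(Z') + ε^k ∫₀¹ D_{Zᶜ} G̃_k dp`. -/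
  linear_part : ∀ Z ∈ Θ.source, Θ Z ∈ Omega K K₁ ε (k + 1) →
    (ε : ℂ) • S'.G (Θ Z) = (ε : ℂ) • S.G (Θ Z) + (ε : ℂ) ^ k • avgDc S.Gt Z (Θ Z)
  /-- `Θ` carries the stage-`k` system to the stage-`(k+1)` system. (The identity is stated on the
  dense set of points with `J Zᶜ ∈ Y₁`. As all terms are continuous, it determines `F_{k+1}` and,
  together with `linear_part`, the remainder `G̃_{k+1}` on `Ω_{k+1}`.) -/
  conjugates : ∀ Z ∈ Θ.source, Θ Z ∈ Omega K K₁ ε (k + 1) →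
    ∀ y y' : Y1, IsJ Z.2 y → IsJ (Θ Z).2 y' →
      fderiv ℂ Θ Z (S.field ε k Z y) = S'.field ε (k + 1) (Θ Z) y'

/-- `|T(Z)|_{L(Y₁,Y₁)} ≤ b` for all `Z ∈ Ω`. -/
def OpBoundedBy (T : E → (Y1 →L[ℂ] Y1)) (Ω : Set E) (b : ℝ) : Prop :=
  ∀ Z ∈ Ω, ∀ v : Y1, cnorm (T Z v) ≤ b * cnorm v

/-- `|g|_{C²(Ω, Y₁)} ≤ b`, where the `C²` norm is the sum of the suprema over `Ω` of the norms of
`g`, `D g` and `D² g`. -/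
def C2BoundedBy (g : E → Y1) (Ω : Set E) (b : ℝ) : Prop :=
  ∃ b₀ b₁ b₂ : ℝ, 0 ≤ b₀ ∧ 0 ≤ b₁ ∧ 0 ≤ b₂ ∧ b₀ + b₁ + b₂ ≤ b ∧
    ∀ Z ∈ Ω, cnorm (g Z) ≤ b₀ ∧
      (∀ U : E, cnorm (fderiv ℂ g Z U) ≤ b₁ * znorm U) ∧
      (∀ U V : E, cnorm (fderiv ℂ (fderiv ℂ g) Z U V) ≤ b₂ * znorm U * znorm V)

end

end KleinGordon

/-! Write `w` for ε^k G̃_k and `G` for ε G_k, so that the oscillatory equation reads ∂Zᶜ = ε⁻¹ J Zᶜ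
+ G(Z) Zᶜ + w(Z), and let T = J⁻¹, a bounded operator. The generating relation says Z'ᶜ = Zᶜ + ε T
w(q, 0) with q = (zʰ, z₁'ʰ). Hence ε⁻¹ J Zᶜ = ε⁻¹ J Z'ᶜ − w(q, 0), and the new term cancels the
remainder on {Zᶜ = 0} to leading order. The difference w(Z) − w(q, 0) is an average of the
Zᶜ-derivative of w applied to Zᶜ, which goes into the new G, plus the small effect of z₁ʰ − z₁'ʰ.
What remains is the change of G between the old and the new point, terms of size ε|w|, and ε T
applied to the derivative of w along the slow velocity.

Suppose |w| ≤ N on a ball. Cauchy's estimate gives |Dw| ≤ 4N/η after a loss of radius η/4, and the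
new remainder is O(εN/η) + O(εN) (`StepHyp.nextSys_w_le`). With η = K₂ε the first part is O(N/K₂):
the factor ε gained from T pays for the Cauchy loss. A large K₂, fixed before ε, makes the step a
contraction by θ ≤ 1/2. About c/ε steps cost a total radius of order cK₂, kept below 1, and leave a
remainder of order ε 2^(−c/ε). Meanwhile G grows by O(N/η) and F by O(N) per step, so both
increments sum geometrically (`exists_normalFormSequence`).

Two families of balls occur. The estimates run on sup-norm balls starting at radius R = 2K + 4.
There the rescaled nonlinearity is analytic and bounded uniformly in small ε, because f has a zero
of order at least three at 0 (`HypH.exists_initial`). The sets Ω_m stay well inside these balls. The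
loss K₁ε therefore only has to dominate the displacement of the transformation, which is O(εN) =
O(ε²), so any K₁ > 0 is admissible.

The implicit relation is resolved in the mixed variables M = ((zʰ, z₁'ʰ), Zᶜ). Old and new variables
are explicit near-identity analytic functions of M (`oldMap`, `newMap`), each a diffeomorphism by a
quantitative inverse function theorem, and the transformation is `newMap` composed with the inverse
of `oldMap` (`StepHyp.exists_next`). Symplecticity and conjugacy are identities between derivatives
of these two maps at the same M. In the latter the unbounded J enters the hyperbolic equations only
through ⟨L⁻¹ ·, ·⟩, where it cancels. -/

namespace KleinGordon

open Metric Set MeasureTheory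

noncomputable section

/-! ### Cauchy estimates in Banach spaces. -/

section Cauchy

variable {E F : Type*} [NormedAddCommGroup E] [NormedSpace ℂ E] [NormedAddCommGroup F]
  [NormedSpace ℂ F]

/-- Cauchy's estimate for the derivative of a bounded holomorphic map on a ball. -/
theorem norm_fderiv_le_of_ball {g : E → F} {x : E} {δ N : ℝ} (hδ : 0 < δ)
    (hg : ∀ z ∈ ball x δ, DifferentiableAt ℂ g z) (hN : ∀ z ∈ ball x δ, ‖g z‖ ≤ N) :
    ‖fderiv ℂ g x‖ ≤ N / δ := by
  have hN0 : 0 ≤ N := (norm_nonneg _).trans (hN x (mem_ball_self hδ))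
  have key : ∀ v : E, ‖v‖ < δ → ‖fderiv ℂ g x v‖ ≤ N := by
    intro v hv
    have hmem : ∀ z : ℂ, ‖z‖ ≤ 1 → x + z • v ∈ ball x δ := by
      intro z hz
      rw [mem_ball_iff_norm, add_sub_cancel_left, norm_smul]
      exact (mul_le_of_le_one_left (norm_nonneg _) hz).trans_lt hv
    have hd : ∀ z : ℂ, ‖z‖ ≤ 1 → HasDerivAt (fun z : ℂ => g (x + z • v))
        (fderiv ℂ g (x + z • v) v) z := by
      intro z hz
      have h1 : HasDerivAt (fun z : ℂ => x + z • v) v z := by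
        simpa using ((hasDerivAt_id z).smul_const v).const_add x
      exact (hg _ (hmem z hz)).hasFDerivAt.comp_hasDerivAt z h1
    have h2 : DiffContOnCl ℂ (fun z : ℂ => g (x + z • v)) (ball 0 1) := by
      apply DifferentiableOn.diffContOnCl
      rw [closure_ball _ one_ne_zero]
      intro z hz
      exact (hd z (by simpa using hz)).differentiableAt.differentiableWithinAt
    have h3 := Complex.norm_deriv_le_of_forall_mem_sphere_norm_le one_pos h2
      (fun z hz => hN _ (hmem z (by simpa using (mem_sphere_zero_iff_norm.1 hz).le)))
    rw [(hd 0 (by simp)).deriv] at h3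
    simpa using h3
  refine ContinuousLinearMap.opNorm_le_bound _ (by positivity) fun v => ?_
  rcases eq_or_ne v 0 with rfl | hv
  · simp
  have hv' : 0 < ‖v‖ := norm_pos_iff.2 hv
  -- The complex disc through x must stay in the open ball, so v is rescaled to norm r δ with r < 1,
  -- and r is then brought up to 1.
  have h4 : ∀ r : ℝ, 0 < r → r < 1 → r * ‖fderiv ℂ g x v‖ ≤ N / δ * ‖v‖ := by
    intro r hr hr1
    have hnorm : ‖((r * δ / ‖v‖ : ℝ) : ℂ)‖ = r * δ / ‖v‖ := by
      rw [Complex.norm_real, Real.norm_of_nonneg (by positivity)]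
    have := key (((r * δ / ‖v‖ : ℝ) : ℂ) • v) (by
      rw [norm_smul, hnorm, div_mul_cancel₀ _ hv'.ne']
      nlinarith)
    rw [map_smul, norm_smul, hnorm] at this
    rw [div_mul_eq_mul_div, div_le_iff₀ hv'] at this
    rw [div_mul_eq_mul_div, le_div_iff₀ hδ]
    linarith
  refine le_of_forall_lt_imp_le_of_dense fun a ha => ?_
  rcases le_or_gt a 0 with h | h
  · exact h.trans (by positivity)
  have hpos : 0 < ‖fderiv ℂ g x v‖ := h.trans ha
  have := h4 (a / ‖fderiv ℂ g x v‖) (by positivity) ((div_lt_one hpos).2 ha)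
  rwa [div_mul_cancel₀ _ hpos.ne'] at this

theorem norm_fderiv_le_of_ball_zero {g : E → F} {ρ δ N : ℝ} (hδ : 0 < δ)
    (hg : ∀ z ∈ ball (0 : E) ρ, DifferentiableAt ℂ g z) (hN : ∀ z ∈ ball (0 : E) ρ, ‖g z‖ ≤ N) :
    ∀ z ∈ ball (0 : E) (ρ - δ), ‖fderiv ℂ g z‖ ≤ N / δ := by
  intro z hz
  have hsub : ball z δ ⊆ ball (0 : E) ρ := by
    apply ball_subset_ball'
    rw [mem_ball] at hz
    linarith
  exact norm_fderiv_le_of_ball hδ (fun y hy => hg y (hsub hy)) fun y hy => hN y (hsub hy)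

end Cauchy

/-! ### A quantitative inverse function theorem near the identity. -/

section NearIdentity

variable {E : Type*} [NormedAddCommGroup E] [NormedSpace ℂ E] [CompleteSpace E]

/-- A holomorphic map close to the identity on a ball is an analytic diffeomorphism whose image
contains a slightly smaller ball. -/
theorem exists_openPartialHomeomorph_of_near_id {Φ : E → E} {ρ d : ℝ}
    (hd0 : 0 ≤ d) (hΦ : AnalyticOnNhd ℂ Φ (ball 0 ρ))
    (hd : ∀ x ∈ ball (0 : E) ρ, ‖Φ x - x‖ ≤ d)
    (hD : ∀ x ∈ ball (0 : E) ρ, ‖fderiv ℂ Φ x - ContinuousLinearMap.id ℂ E‖ ≤ 1 / 2) :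
    ∃ e : OpenPartialHomeomorph E E, e.source = ball 0 ρ ∧ (∀ x, e x = Φ x) ∧
      ball 0 (ρ - 2 * d) ⊆ e.target ∧ AnalyticOnNhd ℂ e.symm e.target := by
  have hnn : ∀ x ∈ ball (0 : E) ρ,
      ‖fderiv ℂ Φ x - ((ContinuousLinearEquiv.refl ℂ E : E ≃L[ℂ] E) : E →L[ℂ] E)‖₊
        ≤ (1 / 2 : NNReal) := by
    intro x hx
    have := hD x hx
    rw [← NNReal.coe_le_coe]
    simpa using this
  have hA : ApproximatesLinearOn Φ ((ContinuousLinearEquiv.refl ℂ E : E ≃L[ℂ] E) : E →L[ℂ] E)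
      (ball 0 ρ) (1 / 2) := by
    intro x hx y hy
    have h1 : ∀ z ∈ ball (0 : E) ρ, HasFDerivWithinAt
        (fun z => Φ z - ((ContinuousLinearEquiv.refl ℂ E : E ≃L[ℂ] E) : E →L[ℂ] E) z)
        (fderiv ℂ Φ z - ((ContinuousLinearEquiv.refl ℂ E : E ≃L[ℂ] E) : E →L[ℂ] E))
        (ball 0 ρ) z := fun z hz =>
      ((hΦ z hz).differentiableAt.hasFDerivAt.sub
        (ContinuousLinearMap.hasFDerivAt _)).hasFDerivWithinAt
    have h2 := (convex_ball (0 : E) ρ).norm_image_sub_le_of_norm_hasFDerivWithin_le h1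
      (fun z hz => by simpa using hD z hz) hy hx
    have h3 : Φ x - Φ y - ((ContinuousLinearEquiv.refl ℂ E : E ≃L[ℂ] E) : E →L[ℂ] E) (x - y) =
      (Φ x - ((ContinuousLinearEquiv.refl ℂ E : E ≃L[ℂ] E) : E →L[ℂ] E) x) -
      (Φ y - ((ContinuousLinearEquiv.refl ℂ E : E ≃L[ℂ] E) : E →L[ℂ] E) y) := by
      rw [map_sub]; abel
    rw [h3]
    simpa using h2
  have hN : ‖(((ContinuousLinearEquiv.refl ℂ E).symm : E ≃L[ℂ] E) : E →L[ℂ] E)‖₊ ≤ 1 := by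
    rw [← NNReal.coe_le_coe]
    exact ContinuousLinearMap.norm_id_le
  have hlt : Subsingleton E ∨ (1 / 2 : NNReal) <
      ‖(((ContinuousLinearEquiv.refl ℂ E).symm : E ≃L[ℂ] E) : E →L[ℂ] E)‖₊⁻¹ := by
    rcases subsingleton_or_nontrivial E with h | h
    · exact Or.inl h
    right
    have h0 : ‖(((ContinuousLinearEquiv.refl ℂ E).symm : E ≃L[ℂ] E) : E →L[ℂ] E)‖₊ = 1 := by
      rw [← NNReal.coe_inj]
      exact ContinuousLinearMap.norm_id
    rw [h0]
    norm_num
  refine ⟨hA.toOpenPartialHomeomorph Φ _ hlt isOpen_ball, rfl, fun _ => rfl, ?_, ?_⟩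
  · intro z hz
    rw [ApproximatesLinearOn.toOpenPartialHomeomorph_target]
    have hz0 : ‖z‖ < ρ - 2 * d := by simpa using hz
    rcases subsingleton_or_nontrivial E with h | h
    · exact ⟨0, by simp; linarith [norm_nonneg z], Subsingleton.elim _ _⟩
    have hzρ : z ∈ ball (0 : E) ρ := by simp; linarith
    have hsub : closedBall z (2 * d) ⊆ ball (0 : E) ρ := by
      intro y hy
      rw [mem_closedBall, dist_eq_norm] at hy
      rw [mem_ball_zero_iff]
      have : ‖y‖ ≤ ‖y - z‖ + ‖z‖ := by simpa using norm_add_le (y - z) z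
      linarith
    -- The identity has inverse of norm one and the deviation has Lipschitz constant 1/2, so the
    -- closed ball of radius 2d about z covers the one of radius (1 − 1/2)·2d = d about Φ z, which
    -- contains z.
    have h1 := hA.surjOn_closedBall_of_nonlinearRightInverse
      (ContinuousLinearEquiv.refl ℂ E).toNonlinearRightInverse (b := z) (ε := 2 * d)
      (by linarith) hsub
    have h2 : z ∈ closedBall (Φ z)
        (((((ContinuousLinearEquiv.refl ℂ E).toNonlinearRightInverse).nnnorm : ℝ)⁻¹ -
          ((1 / 2 : NNReal) : ℝ)) * (2 * d)) := by
      have h0 : (((ContinuousLinearEquiv.refl ℂ E).toNonlinearRightInverse).nnnorm : ℝ) = 1 :=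
        ContinuousLinearMap.norm_id
      rw [h0, mem_closedBall, dist_comm, dist_eq_norm]
      have := hd z hzρ
      norm_num
      linarith
    obtain ⟨x, hx, hxz⟩ := h1 h2
    exact ⟨x, hsub hx, hxz⟩
  · intro z hz
    set e := hA.toOpenPartialHomeomorph Φ _ hlt isOpen_ball with he
    have hmem : e.symm z ∈ ball (0 : E) ρ := e.map_target hz
    have hunit : IsUnit (fderiv ℂ Φ (e.symm z)) := by
      have h1 := hD _ hmem
      have h2 : fderiv ℂ Φ (e.symm z) =
          1 - (ContinuousLinearMap.id ℂ E - fderiv ℂ Φ (e.symm z)) := by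
        rw [ContinuousLinearMap.one_def]; abel
      rw [h2]
      apply isUnit_one_sub_of_norm_lt_one
      rw [norm_sub_rev]
      linarith
    obtain ⟨u, hu⟩ := hunit
    have h3 : HasFDerivAt e ((ContinuousLinearEquiv.unitsEquiv ℂ E u : E ≃L[ℂ] E) : E →L[ℂ] E)
        (e.symm z) := by
      have h4 : ((ContinuousLinearEquiv.unitsEquiv ℂ E u : E ≃L[ℂ] E) : E →L[ℂ] E) =
          fderiv ℂ Φ (e.symm z) := by
        rw [← hu]; rfl
      rw [h4]
      exact (hΦ _ hmem).differentiableAt.hasFDerivAt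
    -- Here `⊤` is the analytic smoothness exponent ω, so this is already analyticity of the
    -- inverse.
    have h5 : ContDiffAt ℂ ⊤ e.symm z := e.contDiffAt_symm hz h3 (hΦ _ hmem).contDiffAt
    exact h5.analyticAt

end NearIdentity

/-! ### Analytic dependence of integrals on a parameter. -/

section ParametricIntegral

variable {E F G : Type*} [NormedAddCommGroup E] [NormedSpace ℂ E] [NormedAddCommGroup F]
  [NormedSpace ℂ F] [CompleteSpace F] [NormedAddCommGroup G] [NormedSpace ℂ G]

/-- Averaging an analytic map over a continuous family of linear contractions of the source. -/
theorem analyticAt_integral_comp_clm {Ψ : G → F} {D : ℝ → E →L[ℂ] G} (hD : Continuous D)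
    (hD1 : ∀ u ∈ Icc (0 : ℝ) 1, ‖D u‖ ≤ 1) (hΨ : AnalyticAt ℂ Ψ 0) :
    AnalyticAt ℂ (fun x => ∫ u in (0 : ℝ)..1, Ψ (D u x)) 0 := by
  obtain ⟨P, r, hP⟩ := hΨ
  let q : ∀ n, ℝ → ContinuousMultilinearMap ℂ (fun _ : Fin n => E) F :=
    fun n u => (P n).compContinuousLinearMap (fun _ => D u)
  have hqcont : ∀ n, Continuous (q n) := by
    intro n
    have h1 := (ContinuousMultilinearMap.compContinuousLinearMapContinuousMultilinear ℂ
      (fun _ : Fin n => E) (fun _ : Fin n => G) F).cont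
    have h2 : Continuous fun u : ℝ =>
        ContinuousMultilinearMap.compContinuousLinearMapContinuousMultilinear ℂ
          (fun _ : Fin n => E) (fun _ : Fin n => G) F (fun _ => D u) :=
      h1.comp (continuous_pi fun _ => hD)
    exact h2.clm_apply continuous_const
  have hqnorm : ∀ n, ∀ u ∈ Icc (0 : ℝ) 1, ‖q n u‖ ≤ ‖P n‖ := by
    intro n u hu
    refine (ContinuousMultilinearMap.norm_compContinuousLinearMap_le _ _).trans ?_
    have : ∏ _i : Fin n, ‖D u‖ ≤ 1 :=
      Finset.prod_le_one (fun _ _ => norm_nonneg _) fun _ _ => hD1 u hu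
    exact mul_le_of_le_one_right (norm_nonneg _) this
  have hIoc : ∀ u : ℝ, u ∈ uIoc (0 : ℝ) 1 → u ∈ Icc (0 : ℝ) 1 := by
    intro u hu
    rw [uIoc_of_le zero_le_one] at hu
    exact ⟨hu.1.le, hu.2⟩
  -- Termwise integration: precomposition with contractions does not increase the coefficient norms,
  -- so the integrated series converges at least where P does.
  let Q : FormalMultilinearSeries ℂ E F := fun n => ∫ u in (0 : ℝ)..1, q n u
  have hQnorm : ∀ n, ‖Q n‖ ≤ ‖P n‖ := by
    intro n
    have := intervalIntegral.norm_integral_le_of_norm_le_const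
      (fun u hu => hqnorm n u (hIoc u hu))
    simpa using this
  have hrad : P.radius ≤ Q.radius := FormalMultilinearSeries.radius_le_of_le (fun n => hQnorm n)
  refine ⟨Q, r, hP.r_le.trans hrad, hP.r_pos, ?_⟩
  intro y hy
  rw [zero_add]
  have hmem : ∀ u ∈ Icc (0 : ℝ) 1, D u y ∈ eball (0 : G) r := by
    intro u hu
    have h1 : ‖D u y‖ ≤ ‖y‖ := ((D u).le_opNorm y).trans
      (mul_le_of_le_one_left (norm_nonneg _) (hD1 u hu))
    rw [mem_eball_zero_iff] at hy ⊢
    refine lt_of_le_of_lt ?_ hy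
    rw [enorm_le_iff_norm_le]
    exact h1
  have hval : ∀ n, Q n (fun _ => y) = ∫ u in (0 : ℝ)..1, q n u (fun _ => y) := by
    intro n
    have := ContinuousLinearMap.intervalIntegral_comp_comm
      (ContinuousMultilinearMap.apply ℂ (fun _ : Fin n => E) F (fun _ => y))
      ((hqcont n).intervalIntegrable (μ := volume) 0 1)
    exact this.symm
  simp_rw [hval]
  have hsum : Summable fun n => ‖P n‖ * ‖y‖ ^ n := by
    have h1 : (‖y‖₊ : ENNReal) < P.radius := by
      refine lt_of_lt_of_le ?_ hP.r_le
      simpa [enorm] using hy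
    simpa using P.summable_norm_mul_pow h1
  refine intervalIntegral.hasSum_integral_of_dominated_convergence
    (fun n _ => ‖P n‖ * ‖y‖ ^ n) ?_ ?_ ?_ ?_ ?_
  · intro n
    have : Continuous fun u => q n u (fun _ => y) :=
      (ContinuousMultilinearMap.apply ℂ (fun _ : Fin n => E) F (fun _ => y)).continuous.comp
        (hqcont n)
    exact this.aestronglyMeasurable
  · intro n
    refine Eventually.of_forall fun u hu => ?_
    refine ((q n u).le_opNorm _).trans ?_
    rw [Finset.prod_const, Finset.card_univ, Fintype.card_fin]
    gcongr
    exact hqnorm n u (hIoc u hu)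
  · exact Eventually.of_forall fun _ _ => hsum
  · exact intervalIntegrable_const
  · refine Eventually.of_forall fun u hu => ?_
    have := hP.hasSum (hmem u (hIoc u hu))
    rw [zero_add] at this
    exact this

/-- The integral over `[0, 1]` of a map that is jointly analytic in the parameter and the integration
variable is analytic in the parameter. -/
theorem analyticAt_integral_of_analyticAt_prod {Φ : ℂ × E → F} {x₀ : E}
    (hΦ : ∀ p ∈ Icc (0 : ℝ) 1, AnalyticAt ℂ Φ ((p : ℂ), x₀)) :
    AnalyticAt ℂ (fun x => ∫ p in (0 : ℝ)..1, Φ ((p : ℂ), x)) x₀ := by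
  -- Integrability for nearby parameters is carried along so that integrals over adjacent intervals
  -- can be added. Analyticity is then proved on short intervals and extended to [0, 1] by
  -- compactness.
  let Q : ℝ → ℝ → Prop := fun a b =>
    (∀ᶠ x in 𝓝 x₀, IntervalIntegrable (fun p : ℝ => Φ ((p : ℂ), x)) volume a b) ∧
      AnalyticAt ℂ (fun x => ∫ p in a..b, Φ ((p : ℂ), x)) x₀
  have hQtrans : ∀ a b c, Q a b → Q b c → Q a c := by
    rintro a b c ⟨h1, h2⟩ ⟨h3, h4⟩
    refine ⟨?_, (h2.add h4).congr ?_⟩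
    · filter_upwards [h1, h3] with x hx hx' using hx.trans hx'
    · filter_upwards [h1, h3] with x hx hx'
      exact intervalIntegral.integral_add_adjacent_intervals hx hx'
  have hQsymm : ∀ a b, Q a b → Q b a := by
    rintro a b ⟨h1, h2⟩
    refine ⟨?_, h2.neg.congr ?_⟩
    · filter_upwards [h1] with x hx using hx.symm
    · refine Eventually.of_forall fun x => ?_
      exact (intervalIntegral.integral_symm (f := fun p : ℝ => Φ ((p : ℂ), x)) (μ := volume)
        a b).symm
  have hloc : ∀ p₀ ∈ Icc (0 : ℝ) 1, ∃ δ > 0, ∀ b, |b - p₀| < δ → Q p₀ b := by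
    intro p₀ hp₀
    have h0 := hΦ p₀ hp₀
    have hcont : ∀ᶠ z in 𝓝 ((p₀ : ℂ), x₀), ContinuousAt Φ z :=
      h0.eventually_analyticAt.mono fun z hz => hz.continuousAt
    obtain ⟨δ₁, hδ₁, hball⟩ := Metric.eventually_nhds_iff_ball.1 hcont
    -- Substituting p = p₀ + (b − p₀)u turns the integral over [p₀, b] into an average over the
    -- contractions (s, x) ↦ (u s, x), evaluated at s = b − p₀. This is the situation of
    -- `analyticAt_integral_comp_clm`.
    let D : ℝ → (ℂ × E) →L[ℂ] (ℂ × E) := fun u =>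
      (u : ℂ) • (ContinuousLinearMap.inl ℂ ℂ E).comp (ContinuousLinearMap.fst ℂ ℂ E) +
        (ContinuousLinearMap.inr ℂ ℂ E).comp (ContinuousLinearMap.snd ℂ ℂ E)
    have hDapp : ∀ u z, D u z = ((u : ℂ) * z.1, z.2) := by
      intro u z
      simp [D]
    have hDc : Continuous D := by
      simp only [D]
      exact ((Complex.continuous_ofReal.smul continuous_const).add continuous_const)
    have hD1 : ∀ u ∈ Icc (0 : ℝ) 1, ‖D u‖ ≤ 1 := by
      intro u hu
      refine ContinuousLinearMap.opNorm_le_bound _ zero_le_one fun z => ?_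
      rw [hDapp, one_mul, Prod.norm_def, Prod.norm_def]
      refine max_le_max ?_ le_rfl
      simp only [norm_mul, Complex.norm_real, Real.norm_eq_abs, abs_of_nonneg hu.1]
      exact mul_le_of_le_one_left (norm_nonneg _) hu.2
    have hΨ : AnalyticAt ℂ (fun z : ℂ × E => Φ (((p₀ : ℂ), x₀) + z)) 0 := by
      have h1 : AnalyticAt ℂ Φ (((p₀ : ℂ), x₀) + 0) := by simpa using h0
      exact h1.comp_of_eq (analyticAt_const.add analyticAt_id) rfl
    have hW := analyticAt_integral_comp_clm hDc hD1 hΨ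
    set W : ℂ × E → F := fun z => ∫ u in (0 : ℝ)..1, Φ (((p₀ : ℂ), x₀) + D u z) with hWdef
    have hWe := hW.eventually_analyticAt
    obtain ⟨δ₂, hδ₂, hball₂⟩ := Metric.eventually_nhds_iff_ball.1 hWe
    refine ⟨min δ₁ δ₂, lt_min hδ₁ hδ₂, fun b hb => ⟨?_, ?_⟩⟩
    · have hx : ∀ᶠ x in 𝓝 x₀, dist x x₀ < δ₁ := Metric.eventually_nhds_iff.2 ⟨δ₁, hδ₁, fun _ h => h⟩
      filter_upwards [hx] with x hx
      apply ContinuousOn.intervalIntegrable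
      intro p hp
      have hp' : |p - p₀| ≤ |b - p₀| := by
        have := abs_sub_left_of_mem_uIcc hp
        simpa [abs_sub_comm] using this
      have hmem : ((p : ℂ), x) ∈ ball ((p₀ : ℂ), x₀) δ₁ := by
        rw [mem_ball, Prod.dist_eq]
        refine max_lt ?_ hx
        rw [dist_eq_norm, ← Complex.ofReal_sub, Complex.norm_real, Real.norm_eq_abs]
        exact (hp'.trans_lt hb).trans_le (min_le_left _ _)
      have h2 : ContinuousAt (fun p : ℝ => Φ ((p : ℂ), x)) p :=
        ContinuousAt.comp_of_eq (hball _ hmem)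
          ((Complex.continuous_ofReal.prodMk continuous_const).continuousAt) rfl
      exact h2.continuousWithinAt
    · have hmem : (((b - p₀ : ℝ) : ℂ), (0 : E)) ∈ ball (0 : ℂ × E) δ₂ := by
        rw [mem_ball_zero_iff, Prod.norm_def]
        refine max_lt ?_ (by simpa using hδ₂)
        rw [Complex.norm_real, Real.norm_eq_abs]
        exact hb.trans_le (min_le_right _ _)
      have h2 := hball₂ _ hmem
      have h3 : AnalyticAt ℂ (fun x : E => W (((b - p₀ : ℝ) : ℂ), x - x₀)) x₀ := by
        refine AnalyticAt.comp_of_eq (f := fun x : E => ((((b - p₀ : ℝ) : ℂ), x - x₀) : ℂ × E)) h2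
          (analyticAt_const.prod (analyticAt_id.sub analyticAt_const)) ?_
        simp
      have h4 : (fun x => ∫ p in p₀..b, Φ ((p : ℂ), x)) =
          fun x => ((b - p₀ : ℝ) : ℂ) • W (((b - p₀ : ℝ) : ℂ), x - x₀) := by
        funext x
        have h5 := intervalIntegral.smul_integral_comp_add_mul
          (fun p : ℝ => Φ ((p : ℂ), x)) (b - p₀) p₀ (a := 0) (b := 1)
        have h6 : W (((b - p₀ : ℝ) : ℂ), x - x₀) =
            ∫ u in (0 : ℝ)..1, Φ (((p₀ + (b - p₀) * u : ℝ) : ℂ), x) := by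
          simp only [hWdef]
          congr 1
          funext u
          rw [hDapp]
          congr 1
          ext
          · push_cast; simp; ring
          · simp
        rw [h6, Complex.coe_smul, h5]
        congr 1 <;> ring
      rw [h4]
      exact analyticAt_const.smul h3
  choose! δ hδ hδQ using hloc
  have hcover : (univ : Set (Icc (0 : ℝ) 1)) ⊆
      ⋃ i : Icc (0 : ℝ) 1, ball i (δ i) := by
    intro p _
    exact mem_iUnion.2 ⟨p, mem_ball_self (hδ p p.2)⟩
  obtain ⟨t, ht0, htm, ⟨m, hm⟩, ht⟩ :=
    exists_monotone_Icc_subset_open_cover_Icc (zero_le_one' ℝ) (fun _ => isOpen_ball) hcover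
  have hstep : ∀ n, Q 0 (t n) := by
    intro n
    induction n with
    | zero =>
      rw [ht0]
      refine ⟨Eventually.of_forall fun x => ?_, ?_⟩
      · simp
      · simpa using analyticAt_const
    | succ n ih =>
      refine hQtrans _ _ _ ih ?_
      obtain ⟨i, hi⟩ := ht n
      have h1 := hi (left_mem_Icc.2 (htm n.le_succ))
      have h2 := hi (right_mem_Icc.2 (htm n.le_succ))
      exact hQtrans _ _ _ (hQsymm _ _ (hδQ i i.2 _ h1)) (hδQ i i.2 _ h2)
  have := (hstep m).2
  rwa [hm m le_rfl] at this

end ParametricIntegral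

/-! ### Abstract data of one normal form step. -/

/-- The bounded operators entering the normal form step on a phase space `Y` of oscillatory modes:
`T` is the inverse of the generator, `ω` the symplectic form, and `β`, `κ` are the pairings that
appear in the generating function. -/
structure PairingData (Y : Type*) [NormedAddCommGroup Y] [NormedSpace ℂ Y] where
  T : Y →L[ℂ] Y
  β : Y →L[ℂ] Y →L[ℂ] ℂ
  ω : Y →L[ℂ] Y →L[ℂ] ℂ
  κ : Y →L[ℂ] Y →L[ℂ] ℂ
  T_injective : Function.Injective T
  ω_antisymm : ∀ u v, ω u v = -ω v u
  ω_T : ∀ u v, ω (T u) v = -β u v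
  β_symm : ∀ u v, β u v = β v u
  ω_T_T : ∀ u v, ω (T u) (T v) = κ v u - κ u v

/-- A system in which the powers of `ε` have been absorbed into the coefficients. -/
structure ScaledSys (Y : Type*) [NormedAddCommGroup Y] [NormedSpace ℂ Y] where
  F : (ℂ × ℂ) × Y → ℂ × ℂ
  G : (ℂ × ℂ) × Y → (Y →L[ℂ] Y)
  w : (ℂ × ℂ) × Y → Y

noncomputable section

variable {Y : Type*} [NormedAddCommGroup Y] [NormedSpace ℂ Y]

namespace PairingData

variable (D : PairingData Y)

theorem ω_T_right (u v : Y) : D.ω u (D.T v) = D.β u v := by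
  rw [D.ω_antisymm, D.ω_T, neg_neg, D.β_symm]

end PairingData

/-! ### The generating function in mixed variables, and symplecticity. -/

/-- The derivative of `w` at `(q, 0)` in a direction of the hyperbolic plane. -/
def slope (w : (ℂ × ℂ) × Y → Y) (e q : ℂ × ℂ) : Y := fderiv ℂ w (q, 0) (e, 0)

/-- The derivative in the direction `e` of the interaction part of the generating function. -/
def pot (D : PairingData Y) (ε : ℝ) (w : (ℂ × ℂ) × Y → Y) (e : ℂ × ℂ) (M : (ℂ × ℂ) × Y) : ℂ :=
  D.β (slope w e M.1) M.2 + (ε : ℂ) * D.κ (slope w e M.1) (w (M.1, 0))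

/-- The old variables in terms of the mixed variables `((zʰ, z₁'ʰ), Zᶜ)`. -/
def oldMap (D : PairingData Y) (ε : ℝ) (w : (ℂ × ℂ) × Y → Y) (M : (ℂ × ℂ) × Y) : (ℂ × ℂ) × Y :=
  ((M.1.1, M.1.2 - (ε : ℂ) ^ 2 * pot D ε w (1, 0) M), M.2)

/-- The new variables in terms of the mixed variables `((zʰ, z₁'ʰ), Zᶜ)`. -/
def newMap (D : PairingData Y) (ε : ℝ) (w : (ℂ × ℂ) × Y → Y) (M : (ℂ × ℂ) × Y) : (ℂ × ℂ) × Y :=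
  ((M.1.1 - (ε : ℂ) ^ 2 * pot D ε w (0, 1) M, M.1.2), M.2 + (ε : ℂ) • D.T (w (M.1, 0)))

section Derivatives

variable {D : PairingData Y} {ε : ℝ} {w : (ℂ × ℂ) × Y → Y} {M : (ℂ × ℂ) × Y}

/-- The projection `((a, s), y) ↦ ((a, s), 0)`. -/
def baseL (Y : Type*) [NormedAddCommGroup Y] [NormedSpace ℂ Y] :
    (ℂ × ℂ) × Y →L[ℂ] (ℂ × ℂ) × Y :=
  (ContinuousLinearMap.inl ℂ (ℂ × ℂ) Y).comp (ContinuousLinearMap.fst ℂ (ℂ × ℂ) Y)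

@[simp] theorem baseL_apply (M : (ℂ × ℂ) × Y) : baseL Y M = (M.1, 0) := by
  simp [baseL]

theorem analyticAt_clm_apply {E F G : Type*} [NormedAddCommGroup E] [NormedSpace ℂ E]
    [NormedAddCommGroup F] [NormedSpace ℂ F] [NormedAddCommGroup G] [NormedSpace ℂ G]
    {f : E → F →L[ℂ] G} {g : E → F} {x : E} (hf : AnalyticAt ℂ f x) (hg : AnalyticAt ℂ g x) :
    AnalyticAt ℂ (fun y => f y (g y)) x :=
  AnalyticAt.comp_of_eq (f := fun y => (f y, g y))
    ((ContinuousLinearMap.id ℂ (F →L[ℂ] G)).analyticAt_bilinear (f x, g x)) (hf.prod hg) rfl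

theorem analyticAt_base (hw : AnalyticAt ℂ w (M.1, 0)) :
    AnalyticAt ℂ (fun M : (ℂ × ℂ) × Y => w (M.1, 0)) M := by
  have h : AnalyticAt ℂ (fun M : (ℂ × ℂ) × Y => w (baseL Y M)) M :=
    hw.comp_of_eq ((baseL Y).analyticAt M) (by simp)
  simpa using h

theorem slope_eq (w : (ℂ × ℂ) × Y → Y) (v q : ℂ × ℂ) :
    slope w v q = v.1 • slope w (1, 0) q + v.2 • slope w (0, 1) q := by
  simp only [slope]
  rw [← map_smul, ← map_smul, ← map_add]
  congr 1
  ext <;> simp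

theorem second_eq (w : (ℂ × ℂ) × Y → Y) (v e q : ℂ × ℂ) :
    fderiv ℂ (fderiv ℂ w) (q, 0) (v, 0) (e, 0) =
      v.1 • fderiv ℂ (fderiv ℂ w) (q, 0) ((1, 0), 0) (e, 0) +
      v.2 • fderiv ℂ (fderiv ℂ w) (q, 0) ((0, 1), 0) (e, 0) := by
  have h : ((v, 0) : (ℂ × ℂ) × Y) = v.1 • ((1, 0), 0) + v.2 • ((0, 1), 0) := by
    ext <;> simp
  rw [h, map_add, map_smul, map_smul]
  rfl

theorem hasFDerivAt_base (hw : AnalyticAt ℂ w (M.1, 0)) :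
    HasFDerivAt (fun M : (ℂ × ℂ) × Y => w (M.1, 0)) ((fderiv ℂ w (M.1, 0)).comp (baseL Y)) M := by
  have h1 : HasFDerivAt w (fderiv ℂ w (M.1, 0)) (baseL Y M) := by
    simpa using hw.differentiableAt.hasFDerivAt
  have h2 := h1.comp M (baseL Y).hasFDerivAt
  have h3 : w ∘ baseL Y = fun M => w (M.1, 0) := by
    funext M; simp
  rwa [h3] at h2

variable [CompleteSpace Y]

theorem analyticAt_slope (hw : AnalyticAt ℂ w (M.1, 0)) (e : ℂ × ℂ) :
    AnalyticAt ℂ (fun M : (ℂ × ℂ) × Y => slope w e M.1) M := by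
  have h : AnalyticAt ℂ (fun M : (ℂ × ℂ) × Y => fderiv ℂ w (baseL Y M)) M :=
    hw.fderiv.comp_of_eq ((baseL Y).analyticAt M) (by simp)
  simpa [slope] using analyticAt_clm_apply h analyticAt_const

theorem hasFDerivAt_slope (hw : AnalyticAt ℂ w (M.1, 0)) (e : ℂ × ℂ) :
    HasFDerivAt (fun M : (ℂ × ℂ) × Y => slope w e M.1)
      (((fderiv ℂ (fderiv ℂ w) (M.1, 0)).comp (baseL Y)).flip (e, 0)) M := by
  have h1 : HasFDerivAt (fderiv ℂ w) (fderiv ℂ (fderiv ℂ w) (M.1, 0)) (baseL Y M) := by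
    simpa using hw.fderiv.differentiableAt.hasFDerivAt
  have h2 := (h1.comp M (baseL Y).hasFDerivAt).clm_apply (hasFDerivAt_const ((e, 0) : (ℂ × ℂ) × Y) M)
  simpa [slope, Function.comp_def] using h2

theorem analyticAt_pot (hw : AnalyticAt ℂ w (M.1, 0)) (e : ℂ × ℂ) :
    AnalyticAt ℂ (pot D ε w e) M := by
  have h1 := analyticAt_slope hw e
  have h2 := analyticAt_base hw
  have h3 : AnalyticAt ℂ (fun M : (ℂ × ℂ) × Y => D.β (slope w e M.1)) M :=
    (D.β.analyticAt _).comp_of_eq h1 rfl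
  have h4 : AnalyticAt ℂ (fun M : (ℂ × ℂ) × Y => D.κ (slope w e M.1)) M :=
    (D.κ.analyticAt _).comp_of_eq h1 rfl
  exact (analyticAt_clm_apply h3 analyticAt_snd).add
    (analyticAt_const.mul (analyticAt_clm_apply h4 h2))

theorem fderiv_pot_apply (hw : AnalyticAt ℂ w (M.1, 0)) (e : ℂ × ℂ) (V : (ℂ × ℂ) × Y) :
    fderiv ℂ (pot D ε w e) M V =
      D.β (fderiv ℂ (fderiv ℂ w) (M.1, 0) (V.1, 0) (e, 0)) M.2 + D.β (slope w e M.1) V.2 +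
      (ε : ℂ) * (D.κ (fderiv ℂ (fderiv ℂ w) (M.1, 0) (V.1, 0) (e, 0)) (w (M.1, 0)) +
        D.κ (slope w e M.1) (slope w V.1 M.1)) := by
  have h1 := hasFDerivAt_slope hw e
  have h2 := hasFDerivAt_base hw
  have h3 := ((D.β.hasFDerivAt (x := slope w e M.1)).comp M h1).clm_apply
    (hasFDerivAt_snd (𝕜 := ℂ) (p := M))
  have h4 := (((D.κ.hasFDerivAt (x := slope w e M.1)).comp M h1).clm_apply h2).const_mul (ε : ℂ)
  have h5 := (h3.add h4).fderiv
  have h6 : fderiv ℂ (pot D ε w e) M = _ := h5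
  rw [h6]
  simp [slope]
  ring

theorem analyticAt_oldMap (hw : AnalyticAt ℂ w (M.1, 0)) : AnalyticAt ℂ (oldMap D ε w) M := by
  have hp := analyticAt_pot (D := D) (ε := ε) hw (1, 0)
  have h1 : AnalyticAt ℂ (fun M : (ℂ × ℂ) × Y => M.1) M := analyticAt_fst
  have h2 : AnalyticAt ℂ (fun M : (ℂ × ℂ) × Y => M.1.1) M := analyticAt_fst.comp_of_eq h1 rfl
  have h3 : AnalyticAt ℂ (fun M : (ℂ × ℂ) × Y => M.1.2) M := analyticAt_snd.comp_of_eq h1 rfl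
  exact (h2.prod (h3.sub (analyticAt_const.mul hp))).prod analyticAt_snd

theorem analyticAt_newMap (hw : AnalyticAt ℂ w (M.1, 0)) : AnalyticAt ℂ (newMap D ε w) M := by
  have hp := analyticAt_pot (D := D) (ε := ε) hw (0, 1)
  have h1 : AnalyticAt ℂ (fun M : (ℂ × ℂ) × Y => M.1) M := analyticAt_fst
  have h2 : AnalyticAt ℂ (fun M : (ℂ × ℂ) × Y => M.1.1) M := analyticAt_fst.comp_of_eq h1 rfl
  have h3 : AnalyticAt ℂ (fun M : (ℂ × ℂ) × Y => M.1.2) M := analyticAt_snd.comp_of_eq h1 rfl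
  have h4 : AnalyticAt ℂ (fun M : (ℂ × ℂ) × Y => D.T (w (M.1, 0))) M :=
    (D.T.analyticAt _).comp_of_eq (analyticAt_base hw) rfl
  exact ((h2.sub (analyticAt_const.mul hp)).prod h3).prod
    (analyticAt_snd.add (analyticAt_const.smul h4))

theorem fderiv_oldMap_apply (hw : AnalyticAt ℂ w (M.1, 0)) (V : (ℂ × ℂ) × Y) :
    fderiv ℂ (oldMap D ε w) M V =
      ((V.1.1, V.1.2 - (ε : ℂ) ^ 2 * fderiv ℂ (pot D ε w (1, 0)) M V), V.2) := by
  have hp := (analyticAt_pot (D := D) (ε := ε) hw (1, 0)).differentiableAt.hasFDerivAt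
  have h1 : HasFDerivAt (fun M : (ℂ × ℂ) × Y => M.1.1) _ M :=
    (hasFDerivAt_fst (𝕜 := ℂ) (p := M.1)).comp M (hasFDerivAt_fst (𝕜 := ℂ) (p := M))
  have h2 : HasFDerivAt (fun M : (ℂ × ℂ) × Y => M.1.2) _ M :=
    (hasFDerivAt_snd (𝕜 := ℂ) (p := M.1)).comp M (hasFDerivAt_fst (𝕜 := ℂ) (p := M))
  have h3 := ((h1.prodMk (h2.sub (hp.const_mul ((ε : ℂ) ^ 2)))).prodMk
    (hasFDerivAt_snd (𝕜 := ℂ) (p := M))).fderiv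
  have h4 : fderiv ℂ (oldMap D ε w) M = _ := h3
  rw [h4]
  simp

theorem fderiv_newMap_apply (hw : AnalyticAt ℂ w (M.1, 0)) (V : (ℂ × ℂ) × Y) :
    fderiv ℂ (newMap D ε w) M V =
      ((V.1.1 - (ε : ℂ) ^ 2 * fderiv ℂ (pot D ε w (0, 1)) M V, V.1.2),
        V.2 + (ε : ℂ) • D.T (slope w V.1 M.1)) := by
  have hp := (analyticAt_pot (D := D) (ε := ε) hw (0, 1)).differentiableAt.hasFDerivAt
  have h1 : HasFDerivAt (fun M : (ℂ × ℂ) × Y => M.1.1) _ M :=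
    (hasFDerivAt_fst (𝕜 := ℂ) (p := M.1)).comp M (hasFDerivAt_fst (𝕜 := ℂ) (p := M))
  have h2 : HasFDerivAt (fun M : (ℂ × ℂ) × Y => M.1.2) _ M :=
    (hasFDerivAt_snd (𝕜 := ℂ) (p := M.1)).comp M (hasFDerivAt_fst (𝕜 := ℂ) (p := M))
  have h5 := ((D.T.hasFDerivAt (x := w (M.1, 0))).comp M (hasFDerivAt_base hw)).const_smul (ε : ℂ)
  have h3 := (((h1.sub (hp.const_mul ((ε : ℂ) ^ 2))).prodMk h2).prodMk
    ((hasFDerivAt_snd (𝕜 := ℂ) (p := M)).add h5)).fderiv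
  have h4 : fderiv ℂ (newMap D ε w) M = _ := h3
  rw [h4]
  simp [slope]

/-- The symplectic form `ε⁻¹ dzʰ ∧ dz₁ʰ + ω`. -/
def formOf (D : PairingData Y) (ε : ℝ) (U V : (ℂ × ℂ) × Y) : ℂ :=
  (ε : ℂ)⁻¹ * (U.1.1 * V.1.2 - U.1.2 * V.1.1) + D.ω U.2 V.2

/-- The transformation given by a generating function is symplectic. -/
theorem formOf_newMap_eq (hε : ε ≠ 0) (hw : AnalyticAt ℂ w (M.1, 0)) (U V : (ℂ × ℂ) × Y) :
    formOf D ε (fderiv ℂ (newMap D ε w) M U) (fderiv ℂ (newMap D ε w) M V) =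
      formOf D ε (fderiv ℂ (oldMap D ε w) M U) (fderiv ℂ (oldMap D ε w) M V) := by
  have hε' : (ε : ℂ) ≠ 0 := by exact_mod_cast hε
  -- Both partial derivatives of the generating function come from one function. Equality of its
  -- mixed second derivatives is the only analytic input; the rest is bilinear algebra with the
  -- relations between ω, β, κ and T.
  have hsymm : fderiv ℂ (fderiv ℂ w) (M.1, 0) ((1, 0), 0) ((0, 1), 0) =
      fderiv ℂ (fderiv ℂ w) (M.1, 0) ((0, 1), 0) ((1, 0), 0) := by
    have := (hw.contDiffAt (n := ⊤)).isSymmSndFDerivAt (by simp)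
    exact this.eq _ _
  rw [fderiv_newMap_apply hw, fderiv_newMap_apply hw, fderiv_oldMap_apply hw,
    fderiv_oldMap_apply hw]
  simp only [fderiv_pot_apply hw, formOf]
  rw [slope_eq w U.1, slope_eq w V.1]
  simp only [second_eq w U.1, second_eq w V.1]
  rw [hsymm]
  simp only [map_add, map_smul, add_apply, smul_apply,
    smul_eq_mul, D.ω_T_T, D.ω_T,
    D.ω_T_right, D.β_symm U.2 (slope _ _ _)]
  field_simp
  ring

end Derivatives

end

/-! ### Estimates for the maps from mixed to old and new variables. -/

variable {Y : Type*} [NormedAddCommGroup Y]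

theorem norm_triple_le {a b : ℂ} {y : Y} {C : ℝ} (ha : ‖a‖ ≤ C) (hb : ‖b‖ ≤ C) (hy : ‖y‖ ≤ C) :
    ‖(((a, b), y) : (ℂ × ℂ) × Y)‖ ≤ C :=
  max_le (max_le ha hb) hy

theorem base_mem_ball {M : (ℂ × ℂ) × Y} {r : ℝ} (hM : M ∈ ball (0 : (ℂ × ℂ) × Y) r) :
    ((M.1, 0) : (ℂ × ℂ) × Y) ∈ ball (0 : (ℂ × ℂ) × Y) r := by
  rw [mem_ball_zero_iff] at hM ⊢
  refine lt_of_le_of_lt (max_le (norm_fst_le M) ?_) hM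
  simp

variable [NormedSpace ℂ Y]

/-- A common bound for the operators of a `PairingData`. -/
structure PairingData.BoundedBy (D : PairingData Y) (Λ : ℝ) : Prop where
  one_le : 1 ≤ Λ
  T_le : ∀ u, ‖D.T u‖ ≤ Λ * ‖u‖
  β_le : ∀ u v, ‖D.β u v‖ ≤ Λ * ‖u‖ * ‖v‖
  ω_le : ∀ u v, ‖D.ω u v‖ ≤ Λ * ‖u‖ * ‖v‖
  κ_le : ∀ u v, ‖D.κ u v‖ ≤ Λ * ‖u‖ * ‖v‖

/-- The oscillatory velocity without its unbounded part. -/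
def oscRate (D : PairingData Y) (ε : ℝ) (S : ScaledSys Y) (M : (ℂ × ℂ) × Y) : Y :=
  S.G (oldMap D ε S.w M) M.2 + S.w (oldMap D ε S.w M)

/-- The velocity of the old hyperbolic variables. -/
def hypField (D : PairingData Y) (ε : ℝ) (S : ScaledSys Y) (M : (ℂ × ℂ) × Y) : ℂ × ℂ :=
  ((oldMap D ε S.w M).1.2, (oldMap D ε S.w M).1.1) + S.F (oldMap D ε S.w M)

/-- The time derivative of `ε² pot e` when the mixed variables move with hyperbolic velocity `v` and
oscillatory velocity `ε⁻¹ J Zᶜ + o`. The unbounded operator `J` cancels against `T`. -/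
def potRate (D : PairingData Y) (ε : ℝ) (w : (ℂ × ℂ) × Y → Y) (e : ℂ × ℂ) (M : (ℂ × ℂ) × Y)
    (v : ℂ × ℂ) (o : Y) : ℂ :=
  (ε : ℂ) ^ 2 * fderiv ℂ (pot D ε w e) M (v, o) + (ε : ℂ) * D.ω (slope w e M.1) M.2

/-- The velocity of the mixed hyperbolic variables `(zʰ, z₁'ʰ)`. -/
def mixedRate (D : PairingData Y) (ε : ℝ) (S : ScaledSys Y) (M : (ℂ × ℂ) × Y) : ℂ × ℂ :=
  ((hypField D ε S M).1,
    ((hypField D ε S M).2 + potRate D ε S.w (1, 0) M ((hypField D ε S M).1, 0) (oscRate D ε S M)) /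
      (1 - (ε : ℂ) ^ 2 * fderiv ℂ (pot D ε S.w (1, 0)) M ((0, 1), 0)))

/-- The segment from `((zʰ, z₁'ʰ), 0)` to the old variables, over the mixed variables. -/
def segMap (D : PairingData Y) (ε : ℝ) (w : (ℂ × ℂ) × Y → Y) (p : ℂ) (M : (ℂ × ℂ) × Y) :
    (ℂ × ℂ) × Y :=
  ((M.1.1, M.1.2 + p * ((oldMap D ε w M).1.2 - M.1.2)), p • M.2)

/-- The average of the oscillatory derivative of `w` over the segment `segMap`. -/
def avgMap (D : PairingData Y) (ε : ℝ) (w : (ℂ × ℂ) × Y → Y) (M : (ℂ × ℂ) × Y) : Y →L[ℂ] Y :=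
  ∫ p in (0 : ℝ)..1,
    (fderiv ℂ w (segMap D ε w p M)).comp (ContinuousLinearMap.inr ℂ (ℂ × ℂ) Y)

/-- The transformed system in terms of the mixed variables. -/
def nextSys (D : PairingData Y) (ε : ℝ) (S : ScaledSys Y) : ScaledSys Y where
  F M := ((mixedRate D ε S M).1 - potRate D ε S.w (0, 1) M (mixedRate D ε S M) (oscRate D ε S M) -
      M.1.2, (mixedRate D ε S M).2 - (newMap D ε S.w M).1.1)
  G M := S.G (newMap D ε S.w M) + avgMap D ε S.w M
  w M := oscRate D ε S M - S.w (M.1, 0) -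
    (S.G (newMap D ε S.w M) + avgMap D ε S.w M) (newMap D ε S.w M).2 +
    (ε : ℂ) • D.T (slope S.w (mixedRate D ε S M) M.1)

/-- Quantitative hypotheses for one normal form step on the ball of radius `ρ`, with loss `η`. -/
structure StepHyp (D : PairingData Y) (S : ScaledSys Y) (ε Λ R B N n η ρ : ℝ) : Prop where
  pair : D.BoundedBy Λ
  eps_pos : 0 < ε
  eps_le : ε ≤ 1
  one_le_R : 1 ≤ R
  ρ_le : ρ ≤ R
  B_nonneg : 0 ≤ B
  N_nonneg : 0 ≤ N
  N_le : N ≤ 1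
  n_nonneg : 0 ≤ n
  n_le : n ≤ 1
  eps_n_le : ε * n ≤ N
  η_pos : 0 < η
  F_an : AnalyticOnNhd ℂ S.F (ball 0 ρ)
  G_an : AnalyticOnNhd ℂ S.G (ball 0 ρ)
  w_an : AnalyticOnNhd ℂ S.w (ball 0 ρ)
  F_le : ∀ Z ∈ ball (0 : (ℂ × ℂ) × Y) ρ, ‖S.F Z‖ ≤ B
  G_le : ∀ Z ∈ ball (0 : (ℂ × ℂ) × Y) ρ, ‖S.G Z‖ ≤ 1
  w_le : ∀ Z ∈ ball (0 : (ℂ × ℂ) × Y) ρ, ‖S.w Z‖ ≤ N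
  dG_le : ∀ Z ∈ ball (0 : (ℂ × ℂ) × Y) (ρ - η / 4), ‖fderiv ℂ S.G Z‖ ≤ 4 / η
  dw_le : ∀ Z ∈ ball (0 : (ℂ × ℂ) × Y) (ρ - η / 4), ‖fderiv ℂ S.w Z‖ ≤ n
  ddw_le : ∀ Z ∈ ball (0 : (ℂ × ℂ) × Y) (ρ - η / 2), ε * ‖fderiv ℂ (fderiv ℂ S.w) Z‖ ≤ n
  small_deriv : 4 * Λ * R * (ε * n) ≤ 1 / 2
  small_disp : 2 * Λ * R * (ε * N) ≤ η / 8

namespace StepHyp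

variable {D : PairingData Y} {S : ScaledSys Y} {ε Λ R B N n η ρ : ℝ}
  (h : StepHyp D S ε Λ R B N n η ρ) {M : (ℂ × ℂ) × Y}

include h

theorem lam_nonneg : 0 ≤ Λ := zero_le_one.trans h.pair.one_le

theorem R_nonneg : 0 ≤ R := zero_le_one.trans h.one_le_R

theorem ball_half_subset : ball (0 : (ℂ × ℂ) × Y) (ρ - η / 2) ⊆ ball 0 ρ :=
  ball_subset_ball (by linarith [h.η_pos])

theorem ball_quarter_subset : ball (0 : (ℂ × ℂ) × Y) (ρ - η / 4) ⊆ ball 0 ρ :=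
  ball_subset_ball (by linarith [h.η_pos])

theorem ball_half_subset_quarter :
    ball (0 : (ℂ × ℂ) × Y) (ρ - η / 2) ⊆ ball 0 (ρ - η / 4) :=
  ball_subset_ball (by linarith [h.η_pos])

theorem w_base_an (hM : M ∈ ball (0 : (ℂ × ℂ) × Y) (ρ - η / 2)) :
    AnalyticAt ℂ S.w (M.1, 0) :=
  h.w_an _ (h.ball_half_subset (base_mem_ball hM))

theorem snd_le (hM : M ∈ ball (0 : (ℂ × ℂ) × Y) (ρ - η / 2)) : ‖M.2‖ ≤ R := by
  have h1 : ‖M‖ < ρ - η / 2 := by simpa using hM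
  linarith [norm_snd_le M, h.ρ_le, h.η_pos]

theorem slope_le (hM : M ∈ ball (0 : (ℂ × ℂ) × Y) (ρ - η / 2)) (e : ℂ × ℂ) :
    ‖slope S.w e M.1‖ ≤ n * ‖e‖ := by
  refine (ContinuousLinearMap.le_of_opNorm_le _
    (h.dw_le _ (h.ball_half_subset_quarter (base_mem_ball hM))) _).trans ?_
  simp [Prod.norm_def]

theorem second_le (hM : M ∈ ball (0 : (ℂ × ℂ) × Y) (ρ - η / 2)) (e v : ℂ × ℂ) :
    ε * ‖fderiv ℂ (fderiv ℂ S.w) (M.1, 0) (v, 0) (e, 0)‖ ≤ n * ‖v‖ * ‖e‖ := by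
  have h1 := h.ddw_le _ (base_mem_ball hM)
  have h2 := ContinuousLinearMap.le_opNorm₂ (fderiv ℂ (fderiv ℂ S.w) (M.1, 0))
    ((v, 0) : (ℂ × ℂ) × Y) ((e, 0) : (ℂ × ℂ) × Y)
  have h3 : ‖((v, 0) : (ℂ × ℂ) × Y)‖ = ‖v‖ := by simp [Prod.norm_def]
  have h4 : ‖((e, 0) : (ℂ × ℂ) × Y)‖ = ‖e‖ := by simp [Prod.norm_def]
  rw [h3, h4] at h2
  calc _ ≤ ε * (‖fderiv ℂ (fderiv ℂ S.w) (M.1, 0)‖ * ‖v‖ * ‖e‖) := by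
        gcongr; exact h.eps_pos.le
    _ = (ε * ‖fderiv ℂ (fderiv ℂ S.w) (M.1, 0)‖) * ‖v‖ * ‖e‖ := by ring
    _ ≤ _ := by gcongr

theorem w_base_le (hM : M ∈ ball (0 : (ℂ × ℂ) × Y) (ρ - η / 2)) : ‖S.w (M.1, 0)‖ ≤ 1 :=
  (h.w_le _ (h.ball_half_subset (base_mem_ball hM))).trans h.N_le

theorem norm_eps : ‖(ε : ℂ)‖ = ε := by
  rw [Complex.norm_real, Real.norm_of_nonneg h.eps_pos.le]

theorem pot_le (hM : M ∈ ball (0 : (ℂ × ℂ) × Y) (ρ - η / 2)) {e : ℂ × ℂ} (he : ‖e‖ ≤ 1) :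
    ‖pot D ε S.w e M‖ ≤ 2 * Λ * R * n := by
  have hΛ := h.lam_nonneg
  have hn := h.n_nonneg
  have hs : ‖slope S.w e M.1‖ ≤ n := (h.slope_le hM e).trans (mul_le_of_le_one_right hn he)
  have h1 : ‖D.β (slope S.w e M.1) M.2‖ ≤ Λ * n * R := by
    refine (h.pair.β_le _ _).trans ?_
    gcongr
    exact h.snd_le hM
  have h2 : ‖D.κ (slope S.w e M.1) (S.w (M.1, 0))‖ ≤ Λ * n * 1 := by
    refine (h.pair.κ_le _ _).trans ?_
    gcongr
    exact h.w_base_le hM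
  have h3 : ‖(ε : ℂ) * D.κ (slope S.w e M.1) (S.w (M.1, 0))‖ ≤ 1 * (Λ * n * 1) := by
    rw [norm_mul, h.norm_eps]
    have := h.eps_le
    gcongr
  refine (norm_add_le _ _).trans ((add_le_add h1 h3).trans ?_)
  have : Λ * n ≤ Λ * n * R := le_mul_of_one_le_right (by positivity) h.one_le_R
  linarith

/-- The factor ε on the left is needed because `ddw_le` controls the second derivative of w only
after multiplication by ε. In `oldMap` and `newMap` the potential carries ε², so one further ε is
left over. -/
theorem fderiv_pot_le [CompleteSpace Y] (hM : M ∈ ball (0 : (ℂ × ℂ) × Y) (ρ - η / 2))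
    {e : ℂ × ℂ} (he : ‖e‖ ≤ 1) (V : (ℂ × ℂ) × Y) :
    ε * ‖fderiv ℂ (pot D ε S.w e) M V‖ ≤ 4 * Λ * R * n * ‖V‖ := by
  have hΛ := h.lam_nonneg
  have hn := h.n_nonneg
  have hR := h.R_nonneg
  have hε := h.eps_pos.le
  have hs : ‖slope S.w e M.1‖ ≤ n := (h.slope_le hM e).trans (mul_le_of_le_one_right hn he)
  have hV1 : ‖V.1‖ ≤ ‖V‖ := norm_fst_le V
  have hV2 : ‖V.2‖ ≤ ‖V‖ := norm_snd_le V
  have hss : ε * ‖fderiv ℂ (fderiv ℂ S.w) (M.1, 0) (V.1, 0) (e, 0)‖ ≤ n * ‖V‖ :=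
    (h.second_le hM e V.1).trans <| by
      calc n * ‖V.1‖ * ‖e‖ ≤ n * ‖V‖ * 1 := by gcongr
        _ = _ := mul_one _
  rw [fderiv_pot_apply (h.w_base_an hM)]
  set s2 := fderiv ℂ (fderiv ℂ S.w) (M.1, 0) (V.1, 0) (e, 0)
  have h1 : ε * ‖D.β s2 M.2‖ ≤ Λ * R * n * ‖V‖ := by
    calc ε * ‖D.β s2 M.2‖ ≤ ε * (Λ * ‖s2‖ * R) := by
          gcongr
          refine (h.pair.β_le _ _).trans ?_
          gcongr
          exact h.snd_le hM
      _ = Λ * R * (ε * ‖s2‖) := by ring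
      _ ≤ Λ * R * (n * ‖V‖) := by gcongr
      _ = _ := by ring
  have hR1 : Λ * n * ‖V‖ ≤ Λ * R * n * ‖V‖ := by
    have : Λ * n * ‖V‖ * 1 ≤ Λ * n * ‖V‖ * R := by
      gcongr; exact h.one_le_R
    linarith
  have h2 : ε * ‖D.β (slope S.w e M.1) V.2‖ ≤ Λ * n * ‖V‖ := by
    calc ε * ‖D.β (slope S.w e M.1) V.2‖ ≤ 1 * (Λ * n * ‖V‖) := by
          gcongr
          · exact h.eps_le
          · refine (h.pair.β_le _ _).trans ?_
            gcongr
      _ = _ := one_mul _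
  have h3 : ε * ‖(ε : ℂ) * D.κ s2 (S.w (M.1, 0))‖ ≤ Λ * n * ‖V‖ := by
    rw [norm_mul, h.norm_eps]
    calc ε * (ε * ‖D.κ s2 (S.w (M.1, 0))‖) ≤ 1 * (ε * (Λ * ‖s2‖ * 1)) := by
          gcongr
          · exact h.eps_le
          · refine (h.pair.κ_le _ _).trans ?_
            gcongr
            exact h.w_base_le hM
      _ = Λ * (ε * ‖s2‖) := by ring
      _ ≤ Λ * (n * ‖V‖) := by gcongr
      _ = _ := by ring
  have h4 : ε * ‖(ε : ℂ) * D.κ (slope S.w e M.1) (slope S.w V.1 M.1)‖ ≤ Λ * n * ‖V‖ := by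
    rw [norm_mul, h.norm_eps]
    calc ε * (ε * ‖D.κ (slope S.w e M.1) (slope S.w V.1 M.1)‖)
        ≤ 1 * (1 * (Λ * n * (1 * ‖V‖))) := by
          gcongr
          · exact h.eps_le
          · exact h.eps_le
          · refine (h.pair.κ_le _ _).trans ?_
            gcongr
            refine (h.slope_le hM _).trans ?_
            gcongr
            exact h.n_le
      _ = _ := by ring
  have h5 : ‖D.β s2 M.2 + D.β (slope S.w e M.1) V.2 + (ε : ℂ) * (D.κ s2 (S.w (M.1, 0)) +
      D.κ (slope S.w e M.1) (slope S.w V.1 M.1))‖ ≤ ‖D.β s2 M.2‖ + ‖D.β (slope S.w e M.1) V.2‖ +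
      (‖(ε : ℂ) * D.κ s2 (S.w (M.1, 0))‖ +
        ‖(ε : ℂ) * D.κ (slope S.w e M.1) (slope S.w V.1 M.1)‖) := by
    rw [mul_add]
    exact (norm_add_le _ _).trans (add_le_add (norm_add_le _ _) (norm_add_le _ _))
  have h6 := mul_le_mul_of_nonneg_left h5 hε
  linarith

theorem eps_eps_n_le : ε * (ε * n) ≤ ε * N :=
  mul_le_mul_of_nonneg_left h.eps_n_le h.eps_pos.le

/-- The potential involves Dw, but one of its two factors ε turns the derivative bound n back into
N. The displacement is thus measured by w itself and does not see the Cauchy loss. -/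
theorem sq_pot_le (hM : M ∈ ball (0 : (ℂ × ℂ) × Y) (ρ - η / 2)) {e : ℂ × ℂ} (he : ‖e‖ ≤ 1) :
    ‖(ε : ℂ) ^ 2 * pot D ε S.w e M‖ ≤ 2 * Λ * R * (ε * N) := by
  have hΛ := h.lam_nonneg
  have hR := h.R_nonneg
  rw [norm_mul, norm_pow, h.norm_eps]
  calc ε ^ 2 * ‖pot D ε S.w e M‖ ≤ ε ^ 2 * (2 * Λ * R * n) := by
        gcongr; exact h.pot_le hM he
    _ = 2 * Λ * R * (ε * (ε * n)) := by ring
    _ ≤ _ := mul_le_mul_of_nonneg_left h.eps_eps_n_le (by positivity)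

theorem sq_fderiv_pot_le [CompleteSpace Y] (hM : M ∈ ball (0 : (ℂ × ℂ) × Y) (ρ - η / 2))
    {e : ℂ × ℂ} (he : ‖e‖ ≤ 1) (V : (ℂ × ℂ) × Y) :
    ‖(ε : ℂ) ^ 2 * fderiv ℂ (pot D ε S.w e) M V‖ ≤ 4 * Λ * R * (ε * n) * ‖V‖ := by
  rw [norm_mul, norm_pow, h.norm_eps]
  have := mul_le_mul_of_nonneg_left (h.fderiv_pot_le hM he V) h.eps_pos.le
  linarith

theorem oldMap_sub_le (hM : M ∈ ball (0 : (ℂ × ℂ) × Y) (ρ - η / 2)) :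
    ‖oldMap D ε S.w M - M‖ ≤ 2 * Λ * R * (ε * N) := by
  have h1 := h.sq_pot_le hM (e := (1, 0)) (by simp [Prod.norm_def])
  have h2 : oldMap D ε S.w M - M = ((0, -((ε : ℂ) ^ 2 * pot D ε S.w (1, 0) M)), 0) := by
    ext <;> simp [oldMap]
  have h0 := (norm_nonneg _).trans h1
  rw [h2]
  exact norm_triple_le (by simp [h0]) (by rwa [norm_neg]) (by simp [h0])

theorem osc_shift_le (hM : M ∈ ball (0 : (ℂ × ℂ) × Y) (ρ - η / 2)) :
    ‖(ε : ℂ) • D.T (S.w (M.1, 0))‖ ≤ Λ * (ε * N) := by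
  have hΛ := h.lam_nonneg
  rw [norm_smul, h.norm_eps]
  calc ε * ‖D.T (S.w (M.1, 0))‖ ≤ ε * (Λ * N) := by
        refine mul_le_mul_of_nonneg_left ((h.pair.T_le _).trans ?_) h.eps_pos.le
        gcongr
        exact h.w_le _ (h.ball_half_subset (base_mem_ball hM))
    _ = _ := by ring

theorem newMap_sub_le (hM : M ∈ ball (0 : (ℂ × ℂ) × Y) (ρ - η / 2)) :
    ‖newMap D ε S.w M - M‖ ≤ 2 * Λ * R * (ε * N) := by
  have h1 := h.sq_pot_le hM (e := (0, 1)) (by simp [Prod.norm_def])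
  have h2 : newMap D ε S.w M - M =
      ((-((ε : ℂ) ^ 2 * pot D ε S.w (0, 1) M), 0), (ε : ℂ) • D.T (S.w (M.1, 0))) := by
    ext <;> simp [newMap]
  have h3 : Λ * (ε * N) ≤ 2 * Λ * R * (ε * N) := by
    have h4 : 0 ≤ Λ * (ε * N) := mul_nonneg h.lam_nonneg (mul_nonneg h.eps_pos.le h.N_nonneg)
    nlinarith [h.one_le_R]
  have h0 := (norm_nonneg _).trans h1
  rw [h2]
  exact norm_triple_le (by rwa [norm_neg]) (by simpa using h0) ((h.osc_shift_le hM).trans h3)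

theorem fderiv_oldMap_sub_le [CompleteSpace Y] (hM : M ∈ ball (0 : (ℂ × ℂ) × Y) (ρ - η / 2)) :
    ‖fderiv ℂ (oldMap D ε S.w) M - ContinuousLinearMap.id ℂ ((ℂ × ℂ) × Y)‖ ≤ 1 / 2 := by
  refine ContinuousLinearMap.opNorm_le_bound _ (by norm_num) fun V => ?_
  have h1 := h.sq_fderiv_pot_le hM (e := (1, 0)) (by simp [Prod.norm_def]) V
  have h2 : (fderiv ℂ (oldMap D ε S.w) M - ContinuousLinearMap.id ℂ ((ℂ × ℂ) × Y)) V =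
      ((0, -((ε : ℂ) ^ 2 * fderiv ℂ (pot D ε S.w (1, 0)) M V)), 0) := by
    rw [sub_apply, fderiv_oldMap_apply (h.w_base_an hM)]
    ext <;> simp
  have h3 := h1.trans (mul_le_mul_of_nonneg_right h.small_deriv (norm_nonneg V))
  rw [h2]
  exact norm_triple_le (by simp) (by rwa [norm_neg]) (by simp)

theorem fderiv_newMap_sub_le [CompleteSpace Y] (hM : M ∈ ball (0 : (ℂ × ℂ) × Y) (ρ - η / 2)) :
    ‖fderiv ℂ (newMap D ε S.w) M - ContinuousLinearMap.id ℂ ((ℂ × ℂ) × Y)‖ ≤ 1 / 2 := by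
  have hΛ := h.lam_nonneg
  have hn := h.n_nonneg
  refine ContinuousLinearMap.opNorm_le_bound _ (by norm_num) fun V => ?_
  have h1 := h.sq_fderiv_pot_le hM (e := (0, 1)) (by simp [Prod.norm_def]) V
  have h2 : (fderiv ℂ (newMap D ε S.w) M - ContinuousLinearMap.id ℂ ((ℂ × ℂ) × Y)) V =
      ((-((ε : ℂ) ^ 2 * fderiv ℂ (pot D ε S.w (0, 1)) M V), 0),
        (ε : ℂ) • D.T (slope S.w V.1 M.1)) := by
    rw [sub_apply, fderiv_newMap_apply (h.w_base_an hM)]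
    ext <;> simp
  have h4 : ‖(ε : ℂ) • D.T (slope S.w V.1 M.1)‖ ≤ 4 * Λ * R * (ε * n) * ‖V‖ := by
    rw [norm_smul, h.norm_eps]
    have hε := h.eps_pos.le
    calc ε * ‖D.T (slope S.w V.1 M.1)‖ ≤ ε * (Λ * (n * ‖V‖)) := by
          gcongr
          refine (h.pair.T_le _).trans ?_
          gcongr
          refine (h.slope_le hM _).trans ?_
          gcongr
          exact norm_fst_le V
      _ = Λ * (ε * n) * ‖V‖ * 1 := by ring
      _ ≤ Λ * (ε * n) * ‖V‖ * (4 * R) := by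
          gcongr; linarith [h.one_le_R]
      _ = _ := by ring
  have h3 := mul_le_mul_of_nonneg_right h.small_deriv (norm_nonneg V)
  rw [h2]
  exact norm_triple_le (by rw [norm_neg]; exact h1.trans h3) (by simp) (h4.trans h3)

theorem disp_nonneg : 0 ≤ 2 * Λ * R * (ε * N) :=
  mul_nonneg (mul_nonneg (mul_nonneg zero_le_two h.lam_nonneg) h.R_nonneg)
    (mul_nonneg h.eps_pos.le h.N_nonneg)

theorem oldMap_mem (hM : M ∈ ball (0 : (ℂ × ℂ) × Y) (ρ - η / 2)) :
    oldMap D ε S.w M ∈ ball (0 : (ℂ × ℂ) × Y) (ρ - η / 4) := by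
  have h1 := h.oldMap_sub_le hM
  have h2 : ‖M‖ < ρ - η / 2 := by simpa using hM
  have h3 : ‖oldMap D ε S.w M‖ ≤ ‖oldMap D ε S.w M - M‖ + ‖M‖ := by
    simpa using norm_add_le (oldMap D ε S.w M - M) M
  rw [mem_ball_zero_iff]
  linarith [h.small_disp, h.η_pos]

theorem newMap_mem (hM : M ∈ ball (0 : (ℂ × ℂ) × Y) (ρ - η / 2)) :
    newMap D ε S.w M ∈ ball (0 : (ℂ × ℂ) × Y) (ρ - η / 4) := by
  have h1 := h.newMap_sub_le hM
  have h2 : ‖M‖ < ρ - η / 2 := by simpa using hM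
  have h3 : ‖newMap D ε S.w M‖ ≤ ‖newMap D ε S.w M - M‖ + ‖M‖ := by
    simpa using norm_add_le (newMap D ε S.w M - M) M
  rw [mem_ball_zero_iff]
  linarith [h.small_disp, h.η_pos]

theorem exists_oldHomeo [CompleteSpace Y] :
    ∃ e : OpenPartialHomeomorph ((ℂ × ℂ) × Y) ((ℂ × ℂ) × Y),
      e.source = ball 0 (ρ - η / 2) ∧ (∀ M, e M = oldMap D ε S.w M) ∧
      ball 0 (ρ - 3 / 4 * η) ⊆ e.target ∧ AnalyticOnNhd ℂ e.symm e.target := by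
  obtain ⟨e, h1, h2, h3, h4⟩ := exists_openPartialHomeomorph_of_near_id h.disp_nonneg
    (fun M hM => analyticAt_oldMap (D := D) (ε := ε) (h.w_base_an hM))
    (fun M hM => h.oldMap_sub_le hM) (fun M hM => h.fderiv_oldMap_sub_le hM)
  exact ⟨e, h1, h2, (ball_subset_ball (by linarith [h.small_disp])).trans h3, h4⟩

theorem exists_newHomeo [CompleteSpace Y] :
    ∃ e : OpenPartialHomeomorph ((ℂ × ℂ) × Y) ((ℂ × ℂ) × Y),
      e.source = ball 0 (ρ - η / 2) ∧ (∀ M, e M = newMap D ε S.w M) ∧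
      ball 0 (ρ - 3 / 4 * η) ⊆ e.target ∧ AnalyticOnNhd ℂ e.symm e.target := by
  obtain ⟨e, h1, h2, h3, h4⟩ := exists_openPartialHomeomorph_of_near_id h.disp_nonneg
    (fun M hM => analyticAt_newMap (D := D) (ε := ε) (h.w_base_an hM))
    (fun M hM => h.newMap_sub_le hM) (fun M hM => h.fderiv_newMap_sub_le hM)
  exact ⟨e, h1, h2, (ball_subset_ball (by linarith [h.small_disp])).trans h3, h4⟩

end StepHyp

variable {Y : Type*} [NormedAddCommGroup Y] [NormedSpace ℂ Y]

/-- The segment joins (M.1, 0) to `oldMap M`, so the claim is convexity of the ball. -/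
theorem segMap_mem_ball {D : PairingData Y} {ε r p : ℝ} {w : (ℂ × ℂ) × Y → Y} {M : (ℂ × ℂ) × Y}
    (hp : p ∈ Icc (0 : ℝ) 1) (hM : M ∈ ball (0 : (ℂ × ℂ) × Y) r)
    (hZ : oldMap D ε w M ∈ ball (0 : (ℂ × ℂ) × Y) r) :
    segMap D ε w p M ∈ ball (0 : (ℂ × ℂ) × Y) r := by
  have h1 : segMap D ε w p M =
      (1 - p) • ((M.1, 0) : (ℂ × ℂ) × Y) + p • oldMap D ε w M := by
    ext
    · simp [segMap, oldMap]; ring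
    · simp [segMap, oldMap]; ring
    · simp [segMap, oldMap]
  rw [h1]
  exact convex_ball _ _ (base_mem_ball hM) hZ (by linarith [hp.2]) hp.1 (by ring)

namespace StepHyp

variable {D : PairingData Y} {S : ScaledSys Y} {ε Λ R B N n η ρ : ℝ}
  (h : StepHyp D S ε Λ R B N n η ρ) {M : (ℂ × ℂ) × Y}

/-! ### The transformed vector field: conjugacy, analyticity and bounds. -/

section Dynamics

include h

theorem oldMap_norm_le (hM : M ∈ ball (0 : (ℂ × ℂ) × Y) (ρ - η / 2)) :
    ‖oldMap D ε S.w M‖ ≤ R := by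
  have h1 : ‖oldMap D ε S.w M‖ < ρ - η / 4 := by simpa using h.oldMap_mem hM
  linarith [h.ρ_le, h.η_pos]

theorem oscRate_le (hM : M ∈ ball (0 : (ℂ × ℂ) × Y) (ρ - η / 2)) :
    ‖oscRate D ε S M‖ ≤ 2 * R := by
  have hZ := h.ball_quarter_subset (h.oldMap_mem hM)
  have h1 : ‖S.G (oldMap D ε S.w M) M.2‖ ≤ 1 * R :=
    (ContinuousLinearMap.le_opNorm _ _).trans
      (mul_le_mul (h.G_le _ hZ) (h.snd_le hM) (norm_nonneg _) zero_le_one)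
  have h2 := (h.w_le _ hZ).trans h.N_le
  refine (norm_add_le _ _).trans ?_
  linarith [h.one_le_R]

theorem hypField_le (hM : M ∈ ball (0 : (ℂ × ℂ) × Y) (ρ - η / 2)) :
    ‖hypField D ε S M‖ ≤ R + B := by
  have hZ := h.ball_quarter_subset (h.oldMap_mem hM)
  refine (norm_add_le _ _).trans (add_le_add ?_ (h.F_le _ hZ))
  have h1 := (norm_fst_le (oldMap D ε S.w M)).trans (h.oldMap_norm_le hM)
  exact max_le ((norm_snd_le _).trans h1) ((norm_fst_le _).trans h1)

theorem avgMap_le (hM : M ∈ ball (0 : (ℂ × ℂ) × Y) (ρ - η / 2)) : ‖avgMap D ε S.w M‖ ≤ n := by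
  have h1 : ∀ p ∈ uIoc (0 : ℝ) 1, ‖(fderiv ℂ S.w (segMap D ε S.w p M)).comp
      (ContinuousLinearMap.inr ℂ (ℂ × ℂ) Y)‖ ≤ n := by
    intro p hp
    rw [uIoc_of_le zero_le_one] at hp
    have hZ := segMap_mem_ball ⟨hp.1.le, hp.2⟩ (h.ball_half_subset_quarter hM) (h.oldMap_mem hM)
    refine ContinuousLinearMap.opNorm_le_bound _ h.n_nonneg fun y => ?_
    refine (ContinuousLinearMap.le_of_opNorm_le _ (h.dw_le _ hZ) _).trans ?_
    simp [Prod.norm_def]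
  have h2 := intervalIntegral.norm_integral_le_of_norm_le_const h1
  rwa [sub_zero, abs_one, mul_one] at h2

theorem nextSys_G_le {b : ℝ} (hG : ∀ Z ∈ ball (0 : (ℂ × ℂ) × Y) ρ, ‖S.G Z‖ ≤ b)
    (hM : M ∈ ball (0 : (ℂ × ℂ) × Y) (ρ - η / 2)) : ‖(nextSys D ε S).G M‖ ≤ b + n :=
  (norm_add_le _ _).trans
    (add_le_add (hG _ (h.ball_quarter_subset (h.newMap_mem hM))) (h.avgMap_le hM))

variable [CompleteSpace Y]

theorem denom_norm_le (hM : M ∈ ball (0 : (ℂ × ℂ) × Y) (ρ - η / 2)) :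
    ‖(ε : ℂ) ^ 2 * fderiv ℂ (pot D ε S.w (1, 0)) M ((0, 1), 0)‖ ≤ 1 / 2 := by
  refine (h.sq_fderiv_pot_le hM (e := (1, 0)) (by simp [Prod.norm_def]) _).trans ?_
  have : ‖(((0, 1), 0) : (ℂ × ℂ) × Y)‖ = 1 := by simp [Prod.norm_def]
  rw [this, mul_one]
  exact h.small_deriv

theorem denom_ne (hM : M ∈ ball (0 : (ℂ × ℂ) × Y) (ρ - η / 2)) :
    1 - (ε : ℂ) ^ 2 * fderiv ℂ (pot D ε S.w (1, 0)) M ((0, 1), 0) ≠ 0 := by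
  intro h0
  have h1 := h.denom_norm_le hM
  rw [← sub_eq_zero.1 h0, norm_one] at h1
  norm_num at h1

/-- The velocity of z₁'ʰ satisfies an equation that contains it on both sides, since the potential
depends on z₁'ʰ. The equation is affine with coefficient at most 1/2, and the quotient in
`mixedRate` is its solution. -/
theorem mixedRate_snd (hM : M ∈ ball (0 : (ℂ × ℂ) × Y) (ρ - η / 2)) :
    (mixedRate D ε S M).2 = (hypField D ε S M).2 +
      potRate D ε S.w (1, 0) M (mixedRate D ε S M) (oscRate D ε S M) := by
  have h1 : (mixedRate D ε S M).2 *
      (1 - (ε : ℂ) ^ 2 * fderiv ℂ (pot D ε S.w (1, 0)) M ((0, 1), 0)) = (hypField D ε S M).2 +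
        potRate D ε S.w (1, 0) M ((hypField D ε S M).1, 0) (oscRate D ε S M) :=
    div_mul_cancel₀ _ (h.denom_ne hM)
  have h2 : ((mixedRate D ε S M, oscRate D ε S M) : (ℂ × ℂ) × Y) =
      (((hypField D ε S M).1, 0), oscRate D ε S M) + (mixedRate D ε S M).2 • ((0, 1), 0) := by
    ext <;> simp [mixedRate]
  rw [potRate, h2, map_add, map_smul, smul_eq_mul]
  rw [potRate] at h1
  linear_combination h1

/-- The unbounded velocity ε⁻¹ y, with y = J Zᶜ, enters only through β(·, y) = ω(·, T y) = ω(·, Zᶜ).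
This makes the hyperbolic part of the new field bounded. -/
theorem fderiv_pot_split (hM : M ∈ ball (0 : (ℂ × ℂ) × Y) (ρ - η / 2)) (e v : ℂ × ℂ) (o y : Y)
    (hy : M.2 = D.T y) :
    (ε : ℂ) ^ 2 * fderiv ℂ (pot D ε S.w e) M (v, (ε : ℂ)⁻¹ • y + o) =
      potRate D ε S.w e M v o := by
  have hε : (ε : ℂ) ≠ 0 := by exact_mod_cast h.eps_pos.ne'
  have h1 : ((v, (ε : ℂ)⁻¹ • y + o) : (ℂ × ℂ) × Y) = (v, o) + (ε : ℂ)⁻¹ • (0, y) := by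
    ext <;> simp [add_comm]
  have h2 : fderiv ℂ (pot D ε S.w e) M ((0, y) : (ℂ × ℂ) × Y) = D.ω (slope S.w e M.1) M.2 := by
    rw [fderiv_pot_apply (h.w_base_an hM), hy, D.ω_T_right]
    have h3 : ((0, 0) : (ℂ × ℂ) × Y) = 0 := rfl
    simp [slope, h3]
  rw [h1, map_add, map_smul, h2, potRate, smul_eq_mul]
  field_simp

/-- The vector fields of the old and the new system are images of one vector in the mixed
variables. -/
theorem exists_mixed_vector (hM : M ∈ ball (0 : (ℂ × ℂ) × Y) (ρ - η / 2)) {y y' : Y}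
    (hy : M.2 = D.T y) (hy' : (newMap D ε S.w M).2 = D.T y') :
    ∃ V : (ℂ × ℂ) × Y,
      fderiv ℂ (oldMap D ε S.w) M V = (hypField D ε S M, (ε : ℂ)⁻¹ • y + oscRate D ε S M) ∧
      fderiv ℂ (newMap D ε S.w) M V =
        (((newMap D ε S.w M).1.2, (newMap D ε S.w M).1.1) + (nextSys D ε S).F M,
          (ε : ℂ)⁻¹ • y' + (nextSys D ε S).G M (newMap D ε S.w M).2 + (nextSys D ε S).w M) := by
  have hε : (ε : ℂ) ≠ 0 := by exact_mod_cast h.eps_pos.ne'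
  -- The homological equation: applying J to Z'ᶜ = Zᶜ + ε T w(M.1, 0) gives ε⁻¹ y = ε⁻¹ y' − w(M.1,
  -- 0), which removes the leading part of the remainder.
  have hyy : y' = y + (ε : ℂ) • S.w (M.1, 0) := by
    apply D.T_injective
    rw [← hy', map_add, map_smul, ← hy]
    rfl
  refine ⟨(mixedRate D ε S M, (ε : ℂ)⁻¹ • y + oscRate D ε S M), ?_, ?_⟩
  · rw [fderiv_oldMap_apply (h.w_base_an hM)]
    simp only
    rw [h.fderiv_pot_split hM _ _ _ _ hy, h.mixedRate_snd hM]
    simp [mixedRate]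
  · rw [fderiv_newMap_apply (h.w_base_an hM)]
    simp only
    rw [h.fderiv_pot_split hM _ _ _ _ hy]
    have h1 : (newMap D ε S.w M).1.2 = M.1.2 := rfl
    refine Prod.ext (Prod.ext ?_ ?_) ?_
    · simp [nextSys, h1]
    · simp [nextSys]
    · simp only [nextSys, hyy, smul_add, smul_smul, inv_mul_cancel₀ hε, one_smul]
      abel

section Analytic

theorem oscRate_an (hM : M ∈ ball (0 : (ℂ × ℂ) × Y) (ρ - η / 2)) :
    AnalyticAt ℂ (oscRate D ε S) M := by
  have h0 := analyticAt_oldMap (D := D) (ε := ε) (h.w_base_an hM)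
  have hZ := h.ball_quarter_subset (h.oldMap_mem hM)
  exact (analyticAt_clm_apply ((h.G_an _ hZ).comp_of_eq h0 rfl) analyticAt_snd).add
    ((h.w_an _ hZ).comp_of_eq h0 rfl)

theorem hypField_an (hM : M ∈ ball (0 : (ℂ × ℂ) × Y) (ρ - η / 2)) :
    AnalyticAt ℂ (hypField D ε S) M := by
  have h0 := analyticAt_oldMap (D := D) (ε := ε) (h.w_base_an hM)
  have hZ := h.ball_quarter_subset (h.oldMap_mem hM)
  have h1 : AnalyticAt ℂ (fun M => (oldMap D ε S.w M).1) M := analyticAt_fst.comp_of_eq h0 rfl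
  have h2 : AnalyticAt ℂ (fun M => (oldMap D ε S.w M).1.1) M := analyticAt_fst.comp_of_eq h1 rfl
  have h3 : AnalyticAt ℂ (fun M => (oldMap D ε S.w M).1.2) M := analyticAt_snd.comp_of_eq h1 rfl
  exact (h3.prod h2).add ((h.F_an _ hZ).comp_of_eq h0 rfl)

theorem potRate_an (hM : M ∈ ball (0 : (ℂ × ℂ) × Y) (ρ - η / 2)) (e : ℂ × ℂ)
    {v : (ℂ × ℂ) × Y → ℂ × ℂ} (hv : AnalyticAt ℂ v M) :
    AnalyticAt ℂ (fun M => potRate D ε S.w e M (v M) (oscRate D ε S M)) M := by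
  have h1 := (analyticAt_pot (D := D) (ε := ε) (h.w_base_an hM) e).fderiv
  have h2 : AnalyticAt ℂ (fun M => D.ω (slope S.w e M.1)) M :=
    (D.ω.analyticAt _).comp_of_eq (analyticAt_slope (h.w_base_an hM) e) rfl
  exact (analyticAt_const.mul (analyticAt_clm_apply h1 (hv.prod (h.oscRate_an hM)))).add
    (analyticAt_const.mul (analyticAt_clm_apply h2 analyticAt_snd))

theorem mixedRate_an (hM : M ∈ ball (0 : (ℂ × ℂ) × Y) (ρ - η / 2)) :
    AnalyticAt ℂ (mixedRate D ε S) M := by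
  have h1 : AnalyticAt ℂ (fun M => (hypField D ε S M).1) M :=
    analyticAt_fst.comp_of_eq (h.hypField_an hM) rfl
  have h2 : AnalyticAt ℂ (fun M => (hypField D ε S M).2) M :=
    analyticAt_snd.comp_of_eq (h.hypField_an hM) rfl
  have h3 := h.potRate_an hM (1, 0) (h1.prod analyticAt_const (g := fun _ => (0 : ℂ)))
  have h4 := analyticAt_clm_apply (analyticAt_pot (D := D) (ε := ε) (h.w_base_an hM) (1, 0)).fderiv
    (analyticAt_const (v := (((0, 1), 0) : (ℂ × ℂ) × Y)))
  exact h1.prod ((h2.add h3).div (analyticAt_const.sub (analyticAt_const.mul h4)) (h.denom_ne hM))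

theorem avgMap_an (hM : M ∈ ball (0 : (ℂ × ℂ) × Y) (ρ - η / 2)) :
    AnalyticAt ℂ (avgMap D ε S.w) M := by
  refine analyticAt_integral_of_analyticAt_prod
    (Φ := fun z : ℂ × ((ℂ × ℂ) × Y) => (fderiv ℂ S.w (segMap D ε S.w z.1 z.2)).comp
      (ContinuousLinearMap.inr ℂ (ℂ × ℂ) Y)) fun p hp => ?_
  have hZ := segMap_mem_ball hp (h.ball_half_subset_quarter hM) (h.oldMap_mem hM)
  have h1 : AnalyticAt ℂ (fun z : ℂ × ((ℂ × ℂ) × Y) => z.2) ((p : ℂ), M) := analyticAt_snd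
  have h2 : AnalyticAt ℂ (fun z : ℂ × ((ℂ × ℂ) × Y) => z.2.1) ((p : ℂ), M) :=
    analyticAt_fst.comp_of_eq h1 rfl
  have h3 : AnalyticAt ℂ (fun z : ℂ × ((ℂ × ℂ) × Y) => z.2.1.1) ((p : ℂ), M) :=
    analyticAt_fst.comp_of_eq h2 rfl
  have h4 : AnalyticAt ℂ (fun z : ℂ × ((ℂ × ℂ) × Y) => z.2.1.2) ((p : ℂ), M) :=
    analyticAt_snd.comp_of_eq h2 rfl
  have h5 : AnalyticAt ℂ (fun z : ℂ × ((ℂ × ℂ) × Y) => z.2.2) ((p : ℂ), M) :=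
    analyticAt_snd.comp_of_eq h1 rfl
  have h6 : AnalyticAt ℂ (fun z : ℂ × ((ℂ × ℂ) × Y) => oldMap D ε S.w z.2) ((p : ℂ), M) :=
    (analyticAt_oldMap (D := D) (ε := ε) (h.w_base_an hM)).comp_of_eq h1 rfl
  have h7 : AnalyticAt ℂ (fun z : ℂ × ((ℂ × ℂ) × Y) => (oldMap D ε S.w z.2).1) ((p : ℂ), M) :=
    analyticAt_fst.comp_of_eq h6 rfl
  have h8 : AnalyticAt ℂ (fun z : ℂ × ((ℂ × ℂ) × Y) => (oldMap D ε S.w z.2).1.2) ((p : ℂ), M) :=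
    analyticAt_snd.comp_of_eq h7 rfl
  have h9 : AnalyticAt ℂ (fun z : ℂ × ((ℂ × ℂ) × Y) => segMap D ε S.w z.1 z.2) ((p : ℂ), M) :=
    (h3.prod (h4.add (analyticAt_fst.mul (h8.sub h4)))).prod (analyticAt_fst.smul h5)
  have h10 : AnalyticAt ℂ (fun z : ℂ × ((ℂ × ℂ) × Y) => fderiv ℂ S.w (segMap D ε S.w z.1 z.2))
      ((p : ℂ), M) := (h.w_an _ (h.ball_quarter_subset hZ)).fderiv.comp_of_eq h9 rfl
  exact (((ContinuousLinearMap.compL ℂ Y ((ℂ × ℂ) × Y) Y).flip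
    (ContinuousLinearMap.inr ℂ (ℂ × ℂ) Y)).analyticAt _).comp_of_eq h10 rfl

theorem nextSys_F_an (hM : M ∈ ball (0 : (ℂ × ℂ) × Y) (ρ - η / 2)) :
    AnalyticAt ℂ (nextSys D ε S).F M := by
  have h0 := analyticAt_newMap (D := D) (ε := ε) (h.w_base_an hM)
  have h1 := h.mixedRate_an hM
  have h2 : AnalyticAt ℂ (fun M => (mixedRate D ε S M).1) M := analyticAt_fst.comp_of_eq h1 rfl
  have h3 : AnalyticAt ℂ (fun M => (mixedRate D ε S M).2) M := analyticAt_snd.comp_of_eq h1 rfl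
  have h4 : AnalyticAt ℂ (fun M => (newMap D ε S.w M).1) M := analyticAt_fst.comp_of_eq h0 rfl
  have h5 : AnalyticAt ℂ (fun M => (newMap D ε S.w M).1.1) M := analyticAt_fst.comp_of_eq h4 rfl
  have h6 : AnalyticAt ℂ (fun M : (ℂ × ℂ) × Y => M.1.2) M :=
    analyticAt_snd.comp_of_eq analyticAt_fst rfl
  exact ((h2.sub (h.potRate_an hM (0, 1) h1)).sub h6).prod (h3.sub h5)

theorem nextSys_G_an (hM : M ∈ ball (0 : (ℂ × ℂ) × Y) (ρ - η / 2)) :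
    AnalyticAt ℂ (nextSys D ε S).G M := by
  have h0 := analyticAt_newMap (D := D) (ε := ε) (h.w_base_an hM)
  exact ((h.G_an _ (h.ball_quarter_subset (h.newMap_mem hM))).comp_of_eq h0 rfl).add (h.avgMap_an hM)

theorem nextSys_w_an (hM : M ∈ ball (0 : (ℂ × ℂ) × Y) (ρ - η / 2)) :
    AnalyticAt ℂ (nextSys D ε S).w M := by
  have h0 := analyticAt_newMap (D := D) (ε := ε) (h.w_base_an hM)
  have h1 := h.mixedRate_an hM
  have h2 : AnalyticAt ℂ (fun M => (newMap D ε S.w M).2) M := analyticAt_snd.comp_of_eq h0 rfl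
  have h3 := (analyticAt_base (h.w_base_an hM) : AnalyticAt ℂ (fun M => S.w (M.1, 0)) M)
  have h4 : AnalyticAt ℂ (fun M : (ℂ × ℂ) × Y => fderiv ℂ S.w (baseL Y M)) M :=
    (h.w_base_an hM).fderiv.comp_of_eq ((baseL Y).analyticAt M) (by simp)
  have h5 := analyticAt_clm_apply h4 (h1.prod analyticAt_const (g := fun _ => (0 : Y)))
  have h6 : AnalyticAt ℂ (fun M => slope S.w (mixedRate D ε S M) M.1) M := by
    simpa [slope] using h5
  have h7 : AnalyticAt ℂ (fun M => D.T (slope S.w (mixedRate D ε S M) M.1)) M :=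
    (D.T.analyticAt _).comp_of_eq h6 rfl
  exact (((h.oscRate_an hM).sub h3).sub (analyticAt_clm_apply (h.nextSys_G_an hM) h2)).add
    (analyticAt_const.smul h7)

end Analytic

section Bounds

theorem potRate_le (hM : M ∈ ball (0 : (ℂ × ℂ) × Y) (ρ - η / 2)) {e v : ℂ × ℂ} {o : Y} {C : ℝ}
    (he : ‖e‖ ≤ 1) (hv : ‖v‖ ≤ C) (ho : ‖o‖ ≤ C) :
    ‖potRate D ε S.w e M v o‖ ≤ Λ * R * (ε * n) * (4 * C + 1) := by
  have hΛ := h.lam_nonneg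
  have hn := h.n_nonneg
  have hR := h.R_nonneg
  have hε := h.eps_pos.le
  have h1 : ‖(ε : ℂ) ^ 2 * fderiv ℂ (pot D ε S.w e) M (v, o)‖ ≤ 4 * Λ * R * (ε * n) * C :=
    (h.sq_fderiv_pot_le hM he _).trans (by gcongr; exact max_le hv ho)
  have h2 : ‖(ε : ℂ) * D.ω (slope S.w e M.1) M.2‖ ≤ ε * (Λ * n * R) := by
    rw [norm_mul, h.norm_eps]
    gcongr
    refine (h.pair.ω_le _ _).trans ?_
    gcongr
    · exact (h.slope_le hM e).trans (mul_le_of_le_one_right hn he)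
    · exact h.snd_le hM
  refine (norm_add_le _ _).trans ((add_le_add h1 h2).trans (le_of_eq ?_))
  ring

/-- In the second component the numerator is at most (1 + 9/8)(R + B) ≤ (5/2)(R + B), and the
denominator is at least 1/2. -/
theorem mixedRate_le (hM : M ∈ ball (0 : (ℂ × ℂ) × Y) (ρ - η / 2)) :
    ‖mixedRate D ε S M‖ ≤ 5 * (R + B) := by
  have hQ : 1 ≤ R + B := by linarith [h.one_le_R, h.B_nonneg]
  have h1 := h.hypField_le hM
  have h2 : ‖potRate D ε S.w (1, 0) M ((hypField D ε S M).1, 0) (oscRate D ε S M)‖ ≤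
      1 / 8 * (9 * (R + B)) := by
    refine (h.potRate_le hM (C := 2 * (R + B)) (by simp [Prod.norm_def]) ?_ ?_).trans ?_
    · refine max_le (((norm_fst_le _).trans h1).trans ?_) ?_
      · linarith
      · simp only [norm_zero]; linarith
    · linarith [h.oscRate_le hM, h.B_nonneg]
    · have h3 := h.small_deriv
      have h4 : Λ * R * (ε * n) ≤ 1 / 8 := by linarith
      refine mul_le_mul h4 ?_ (by linarith) (by norm_num)
      linarith
  have h3 : (1 / 2 : ℝ) ≤ ‖1 - (ε : ℂ) ^ 2 * fderiv ℂ (pot D ε S.w (1, 0)) M ((0, 1), 0)‖ := by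
    have h4 := h.denom_norm_le hM
    have h5 := norm_sub_norm_le (1 : ℂ)
      ((ε : ℂ) ^ 2 * fderiv ℂ (pot D ε S.w (1, 0)) M ((0, 1), 0))
    rw [norm_one] at h5
    linarith
  refine max_le ?_ ?_
  · refine ((norm_fst_le _).trans h1).trans ?_
    linarith
  · simp only [mixedRate]
    rw [norm_div, div_le_iff₀ (by linarith)]
    have h5 := norm_add_le (hypField D ε S M).2
      (potRate D ε S.w (1, 0) M ((hypField D ε S M).1, 0) (oscRate D ε S M))
    have h6 := (norm_snd_le (hypField D ε S M)).trans h1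
    have h7 : 5 * (R + B) * (1 / 2) ≤ 5 * (R + B) *
        ‖1 - (ε : ℂ) ^ 2 * fderiv ℂ (pot D ε S.w (1, 0)) M ((0, 1), 0)‖ := by
      gcongr
    linarith

theorem potRate_mixed_le (hM : M ∈ ball (0 : (ℂ × ℂ) × Y) (ρ - η / 2)) {e : ℂ × ℂ}
    (he : ‖e‖ ≤ 1) :
    ‖potRate D ε S.w e M (mixedRate D ε S M) (oscRate D ε S M)‖ ≤ 21 * Λ * R * (R + B) * N := by
  have hΛ := h.lam_nonneg
  have hR := h.R_nonneg
  have hB := h.B_nonneg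
  have hn := mul_nonneg h.eps_pos.le h.n_nonneg
  have hQ : 1 ≤ R + B := by linarith [h.one_le_R, h.B_nonneg]
  have h1 := h.potRate_le hM he (h.mixedRate_le hM)
    (by linarith [h.oscRate_le hM] : ‖oscRate D ε S M‖ ≤ 5 * (R + B))
  calc _ ≤ _ := h1
    _ ≤ Λ * R * N * (21 * (R + B)) := by
        gcongr
        · exact mul_nonneg (mul_nonneg hΛ hR) h.N_nonneg
        · exact h.eps_n_le
        · linarith
    _ = _ := by ring

/-- The new F is the old one at the old point, corrected by one displacement (constant 2) and one
rate of change of the potential (constant 21). The linear parts A Z cancel up to that displacement.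
-/
theorem nextSys_F_le {b : ℝ} (hF : ∀ Z ∈ ball (0 : (ℂ × ℂ) × Y) ρ, ‖S.F Z‖ ≤ b)
    (hM : M ∈ ball (0 : (ℂ × ℂ) × Y) (ρ - η / 2)) :
    ‖(nextSys D ε S).F M‖ ≤ b + 23 * Λ * R * (R + B) * N := by
  have hQ : 1 ≤ R + B := by linarith [h.one_le_R, h.B_nonneg]
  have hZ := hF _ (h.ball_quarter_subset (h.oldMap_mem hM))
  have hd : 2 * Λ * R * (ε * N) ≤ 2 * Λ * R * (R + B) * N := by
    have h0 : 0 ≤ 2 * Λ * R * N := mul_nonneg (mul_nonneg (mul_nonneg zero_le_two h.lam_nonneg)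
      h.R_nonneg) h.N_nonneg
    have : 2 * Λ * R * N * ε ≤ 2 * Λ * R * N * (R + B) := by
      gcongr; linarith [h.eps_le]
    linarith
  refine max_le ?_ ?_
  · have h1 := h.potRate_mixed_le hM (e := (0, 1)) (by simp [Prod.norm_def])
    have h2 := h.sq_pot_le hM (e := (1, 0)) (by simp [Prod.norm_def])
    have h3 : ((nextSys D ε S).F M).1 = (S.F (oldMap D ε S.w M)).1 -
        ((ε : ℂ) ^ 2 * pot D ε S.w (1, 0) M +
          potRate D ε S.w (0, 1) M (mixedRate D ε S M) (oscRate D ε S M)) := by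
      simp only [nextSys, mixedRate, hypField, Prod.fst_add, oldMap]
      ring
    rw [h3]
    refine (norm_sub_le _ _).trans ?_
    have h4 := norm_add_le ((ε : ℂ) ^ 2 * pot D ε S.w (1, 0) M)
      (potRate D ε S.w (0, 1) M (mixedRate D ε S M) (oscRate D ε S M))
    have h5 := (norm_fst_le _).trans hZ
    linarith
  · have h1 := h.potRate_mixed_le hM (e := (1, 0)) (by simp [Prod.norm_def])
    have h2 := h.sq_pot_le hM (e := (0, 1)) (by simp [Prod.norm_def])
    have h3 : ((nextSys D ε S).F M).2 = (S.F (oldMap D ε S.w M)).2 +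
        ((ε : ℂ) ^ 2 * pot D ε S.w (0, 1) M +
          potRate D ε S.w (1, 0) M (mixedRate D ε S M) (oscRate D ε S M)) := by
      have h6 : ((nextSys D ε S).F M).2 = (mixedRate D ε S M).2 - (newMap D ε S.w M).1.1 := rfl
      rw [h6, h.mixedRate_snd hM]
      simp only [hypField, Prod.snd_add, oldMap, newMap]
      ring
    rw [h3]
    refine (norm_add_le _ _).trans ?_
    have h4 := norm_add_le ((ε : ℂ) ^ 2 * pot D ε S.w (0, 1) M)
      (potRate D ε S.w (1, 0) M (mixedRate D ε S M) (oscRate D ε S M))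
    have h5 := (norm_snd_le _).trans hZ
    linarith

theorem continuousOn_fderiv_segMap (hM : M ∈ ball (0 : (ℂ × ℂ) × Y) (ρ - η / 2)) :
    ContinuousOn (fun p : ℝ => fderiv ℂ S.w (segMap D ε S.w p M)) (Icc 0 1) := by
  intro p hp
  have hZ := segMap_mem_ball hp (h.ball_half_subset_quarter hM) (h.oldMap_mem hM)
  have h1 : ContinuousAt (fderiv ℂ S.w) (segMap D ε S.w p M) :=
    (h.w_an _ (h.ball_quarter_subset hZ)).fderiv.continuousAt
  have h2 : Continuous fun p : ℝ => segMap D ε S.w p M := by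
    unfold segMap
    fun_prop
  exact (ContinuousAt.comp_of_eq h1 h2.continuousAt rfl).continuousWithinAt

/-- By the fundamental theorem of calculus along the segment, w(Z) − w(M.1, 0) is the average of Dw
applied to the full direction. The averaged operator accounts for the Zᶜ-component, so the error
involves only the z₁ʰ-component −ε² `pot`. -/
theorem difference_le (hM : M ∈ ball (0 : (ℂ × ℂ) × Y) (ρ - η / 2)) :
    ‖S.w (oldMap D ε S.w M) - S.w (M.1, 0) - avgMap D ε S.w M M.2‖ ≤
      n * (2 * Λ * R * (ε * N)) := by
  set dir : (ℂ × ℂ) × Y := ((0, (oldMap D ε S.w M).1.2 - M.1.2), M.2) with hdir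
  have hcont := h.continuousOn_fderiv_segMap hM
  have hcont' : ∀ v : (ℂ × ℂ) × Y, IntervalIntegrable
      (fun p : ℝ => fderiv ℂ S.w (segMap D ε S.w p M) v) volume 0 1 := by
    intro v
    apply ContinuousOn.intervalIntegrable
    rw [uIcc_of_le zero_le_one]
    exact hcont.clm_apply continuousOn_const
  have h1 : ∫ p in (0 : ℝ)..1, fderiv ℂ S.w (segMap D ε S.w p M) dir =
      S.w (oldMap D ε S.w M) - S.w (M.1, 0) := by
    have h2 : ∀ p ∈ uIcc (0 : ℝ) 1, HasDerivAt (fun p : ℝ => S.w (segMap D ε S.w p M))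
        (fderiv ℂ S.w (segMap D ε S.w p M) dir) p := by
      intro p hp
      rw [uIcc_of_le zero_le_one] at hp
      have hZ := segMap_mem_ball hp (h.ball_half_subset_quarter hM) (h.oldMap_mem hM)
      have h3 : HasDerivAt (fun p : ℂ => segMap D ε S.w p M) dir (p : ℂ) := by
        have h4 := ((hasDerivAt_const (p : ℂ) M.1.1).prodMk
          (((hasDerivAt_id (p : ℂ)).mul_const
            ((oldMap D ε S.w M).1.2 - M.1.2)).const_add M.1.2)).prodMk
          ((hasDerivAt_id (p : ℂ)).smul_const M.2)
        simpa [segMap, hdir] using h4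
      have h5 := ((h.w_an _ (h.ball_quarter_subset hZ)).differentiableAt.hasFDerivAt).comp_hasDerivAt
        (p : ℂ) h3
      have h6 := h5.scomp p (Complex.ofRealCLM.hasDerivAt (x := p))
      simpa [Function.comp_def] using h6
    rw [intervalIntegral.integral_eq_sub_of_hasDerivAt h2 (hcont' dir)]
    simp [segMap, oldMap, sub_eq_add_neg]
  have h2 : avgMap D ε S.w M M.2 =
      ∫ p in (0 : ℝ)..1, fderiv ℂ S.w (segMap D ε S.w p M) (0, M.2) := by
    rw [avgMap, ContinuousLinearMap.intervalIntegral_apply]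
    · rfl
    · apply ContinuousOn.intervalIntegrable
      rw [uIcc_of_le zero_le_one]
      exact hcont.clm_comp continuousOn_const
  rw [← h1, h2, ← intervalIntegral.integral_sub (hcont' _) (hcont' _)]
  have h3 : ∀ p ∈ uIoc (0 : ℝ) 1, ‖fderiv ℂ S.w (segMap D ε S.w p M) dir -
      fderiv ℂ S.w (segMap D ε S.w p M) (0, M.2)‖ ≤ n * (2 * Λ * R * (ε * N)) := by
    intro p hp
    rw [uIoc_of_le zero_le_one] at hp
    have hZ := segMap_mem_ball ⟨hp.1.le, hp.2⟩ (h.ball_half_subset_quarter hM) (h.oldMap_mem hM)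
    rw [← map_sub]
    refine (ContinuousLinearMap.le_opNorm _ _).trans
      (mul_le_mul (h.dw_le _ hZ) ?_ (norm_nonneg _) h.n_nonneg)
    have h4 := h.sq_pot_le hM (e := (1, 0)) (by simp [Prod.norm_def])
    have h5 : dir - ((0, M.2) : (ℂ × ℂ) × Y) =
        ((0, -((ε : ℂ) ^ 2 * pot D ε S.w (1, 0) M)), 0) := by
      ext <;> simp [hdir, oldMap]
    rw [h5]
    exact norm_triple_le (by simpa using h.disp_nonneg) (by rwa [norm_neg])
      (by simpa using h.disp_nonneg)
  simpa using intervalIntegral.norm_integral_le_of_norm_le_const h3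

/-- Once w(M.1, 0) is cancelled, every surviving term has a factor ε. The variation of G between old
and new point costs 1/η by Cauchy, the slow drift of w costs n, and the rest is O(εN). These are the
three summands of the bound. -/
theorem nextSys_w_le (hM : M ∈ ball (0 : (ℂ × ℂ) × Y) (ρ - η / 2)) :
    ‖(nextSys D ε S).w M‖ ≤ 16 * Λ * R ^ 2 * (ε * N) / η + 4 * Λ * R * (ε * N) +
      5 * Λ * (R + B) * (ε * n) := by
  have hΛ := h.lam_nonneg
  have hn := h.n_nonneg
  have hR := h.R_nonneg
  have hε := h.eps_pos.le
  have hη := h.η_pos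
  set Z := oldMap D ε S.w M with hZdef
  set Z' := newMap D ε S.w M with hZ'def
  have hZ := h.oldMap_mem hM
  have hZ' := h.newMap_mem hM
  have hsplit : (nextSys D ε S).w M = (S.G Z - S.G Z') M.2 - S.G Z' (Z'.2 - M.2) +
      (S.w Z - S.w (M.1, 0) - avgMap D ε S.w M M.2) - avgMap D ε S.w M (Z'.2 - M.2) +
      (ε : ℂ) • D.T (slope S.w (mixedRate D ε S M) M.1) := by
    simp only [nextSys, oscRate, sub_apply, add_apply, map_sub, ← hZdef, ← hZ'def]
    abel
  have hdy : ‖Z'.2 - M.2‖ ≤ Λ * (ε * N) := by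
    have := h.osc_shift_le hM
    simpa [hZ'def, newMap] using this
  have hZZ : ‖Z - Z'‖ ≤ 4 * Λ * R * (ε * N) := by
    have h1 := norm_sub_le (Z - M) (Z' - M)
    rw [sub_sub_sub_cancel_right] at h1
    linarith [h.oldMap_sub_le hM, h.newMap_sub_le hM]
  have hGG : ‖S.G Z - S.G Z'‖ ≤ 4 / η * (4 * Λ * R * (ε * N)) := by
    refine ((convex_ball (0 : (ℂ × ℂ) × Y) (ρ - η / 4)).norm_image_sub_le_of_norm_fderiv_le
      (𝕜 := ℂ) (fun x hx => (h.G_an x (h.ball_quarter_subset hx)).differentiableAt)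
      (fun x hx => h.dG_le x hx) hZ' hZ).trans ?_
    gcongr
  have t1 : ‖(S.G Z - S.G Z') M.2‖ ≤ 4 / η * (4 * Λ * R * (ε * N)) * R :=
    (ContinuousLinearMap.le_opNorm _ _).trans
      (mul_le_mul hGG (h.snd_le hM) (norm_nonneg _) ((norm_nonneg _).trans hGG))
  have t2 : ‖S.G Z' (Z'.2 - M.2)‖ ≤ 1 * (Λ * (ε * N)) :=
    (ContinuousLinearMap.le_opNorm _ _).trans
      (mul_le_mul (h.G_le _ (h.ball_quarter_subset hZ')) hdy (norm_nonneg _) zero_le_one)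
  have t3 := h.difference_le hM
  have t4 : ‖avgMap D ε S.w M (Z'.2 - M.2)‖ ≤ n * (Λ * (ε * N)) :=
    (ContinuousLinearMap.le_opNorm _ _).trans
      (mul_le_mul (h.avgMap_le hM) hdy (norm_nonneg _) hn)
  have t5 : ‖(ε : ℂ) • D.T (slope S.w (mixedRate D ε S M) M.1)‖ ≤ ε * (Λ * (n * (5 * (R + B)))) := by
    rw [norm_smul, h.norm_eps]
    gcongr
    refine (h.pair.T_le _).trans ?_
    gcongr
    refine (h.slope_le hM _).trans ?_
    gcongr
    exact h.mixedRate_le hM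
  rw [hsplit]
  refine (norm_add_le _ _).trans ?_
  refine (add_le_add_left ((norm_sub_le _ _).trans (add_le_add_left ((norm_add_le _ _).trans
    (add_le_add_left (norm_sub_le _ _) _)) _)) _).trans ?_
  have hX : 0 ≤ Λ * (ε * N) := mul_nonneg hΛ (mul_nonneg hε h.N_nonneg)
  have e1 : Λ * (ε * N) ≤ Λ * R * (ε * N) := by nlinarith [h.one_le_R]
  have e3 : n * (2 * Λ * R * (ε * N)) ≤ 2 * Λ * R * (ε * N) :=
    mul_le_of_le_one_left h.disp_nonneg h.n_le
  have e4 : n * (Λ * (ε * N)) ≤ Λ * (ε * N) := mul_le_of_le_one_left hX h.n_le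
  have e5 : 4 / η * (4 * Λ * R * (ε * N)) * R = 16 * Λ * R ^ 2 * (ε * N) / η := by ring
  have e6 : ε * (Λ * (n * (5 * (R + B)))) = 5 * Λ * (R + B) * (ε * n) := by ring
  linarith

end Bounds

end Dynamics

end StepHyp

/-! ### Weighted reindexing operators and the bilinear form on ℓ². -/

section SequenceOperators

variable {ι ι' : Type*}

theorem memℓp_two_of_weight {σ : ι → ι'} (hσ : Function.Injective σ) {c : ι → ℂ} {C : ℝ}
    (hc : ∀ i, ‖c i‖ ≤ C) (y : lp (fun _ : ι' => ℂ) 2) :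
    Memℓp (fun i => c i * y (σ i)) 2 ∧
      ∀ h : Memℓp (fun i => c i * y (σ i)) 2,
        ‖(⟨_, h⟩ : lp (fun _ : ι => ℂ) 2)‖ ≤ |C| * ‖y‖ := by
  have h2 : (0 : ℝ) < (2 : ENNReal).toReal := by norm_num
  have hy := (lp.hasSum_norm h2 y)
  simp only [ENNReal.toReal_ofNat, Real.rpow_two] at hy
  have hsum : Summable fun i => C ^ 2 * ‖y (σ i)‖ ^ 2 := (hy.summable.comp_injective hσ).mul_left _
  have hle : ∀ i, ‖c i * y (σ i)‖ ^ 2 ≤ C ^ 2 * ‖y (σ i)‖ ^ 2 := by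
    intro i
    rw [norm_mul, mul_pow]
    have := pow_le_pow_left₀ (norm_nonneg _) (hc i) 2
    gcongr
  have hs := Summable.of_nonneg_of_le (fun i => by positivity) hle hsum
  refine ⟨?_, fun h => ?_⟩
  · apply memℓp_gen
    simpa only [ENNReal.toReal_ofNat, Real.rpow_two] using hs
  · have h3 := lp.norm_rpow_eq_tsum h2 (⟨_, h⟩ : lp (fun _ : ι => ℂ) 2)
    simp only [ENNReal.toReal_ofNat, Real.rpow_two] at h3
    refine abs_le_of_sq_le_sq' ?_ (by positivity) |>.2
    rw [h3, mul_pow, sq_abs]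
    calc ∑' i, ‖c i * y (σ i)‖ ^ 2 ≤ ∑' i, C ^ 2 * ‖y (σ i)‖ ^ 2 := hs.tsum_le_tsum hle hsum
      _ = C ^ 2 * ∑' i, ‖y (σ i)‖ ^ 2 := tsum_mul_left
      _ ≤ C ^ 2 * ‖y‖ ^ 2 := by
          gcongr
          rw [← hy.tsum_eq]
          exact tsum_comp_le_tsum_of_inj hy.summable (fun i => by positivity) hσ

/-- The bounded operator `(y i) ↦ (c i * y (σ i))` on `ℓ²`. -/
def weightOp (σ : ι → ι') (hσ : Function.Injective σ) (c : ι → ℂ) (C : ℝ) (hc : ∀ i, ‖c i‖ ≤ C) :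
    lp (fun _ : ι' => ℂ) 2 →L[ℂ] lp (fun _ : ι => ℂ) 2 :=
  LinearMap.mkContinuous
    { toFun := fun y => ⟨fun i => c i * y (σ i), (memℓp_two_of_weight hσ hc y).1⟩
      map_add' := fun u v => by
        ext i
        exact mul_add _ _ _
      map_smul' := fun a u => by
        ext i
        simp
        ring } |C|
    fun y => (memℓp_two_of_weight hσ hc y).2 _

@[simp] theorem weightOp_apply (σ : ι → ι') (hσ : Function.Injective σ) (c : ι → ℂ) (C : ℝ)
    (hc : ∀ i, ‖c i‖ ≤ C) (y : lp (fun _ : ι' => ℂ) 2) (i : ι) :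
    weightOp σ hσ c C hc y i = c i * y (σ i) := rfl

/-- The bilinear form `∑ u i * v i` on `ℓ²`. -/
def dotL : lp (fun _ : ι => ℂ) 2 →L[ℂ] lp (fun _ : ι => ℂ) 2 →L[ℂ] ℂ :=
  LinearMap.mkContinuous₂
    (LinearMap.mk₂ ℂ (fun u v : lp (fun _ : ι => ℂ) 2 => inner ℂ (star u) v)
      (fun u u' v => by simp)
      (fun a u v => by simp [mul_comm])
      (fun u v v' => by simp)
      (fun a u v => by simp)) 1
    fun u v => by
      have := norm_inner_le_norm (𝕜 := ℂ) (star u) v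
      simpa using this

theorem dotL_hasSum (u v : lp (fun _ : ι => ℂ) 2) : HasSum (fun i => u i * v i) (dotL u v) := by
  have h := lp.hasSum_inner (𝕜 := ℂ) (star u) v
  have h2 : (fun i => inner ℂ (star u i) (v i)) = fun i => u i * v i := by
    funext i
    simp [mul_comm]
  rw [← h2]
  exact h

end SequenceOperators

/-! ### The Klein–Gordon pairings as Fourier multipliers. -/

section Symbols

/-- The symbol `√((n+2)² - 1)` of `L`. -/
def symL (n : ℕ) : ℝ := √(((n : ℝ) + 2) ^ 2 - 1)

/-- The weight of the `H¹` pairing in the coordinates of `Y₁`. -/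
def symH (n : ℕ) : ℝ := (1 + ((n : ℝ) + 2) ^ 2) / ((n : ℝ) + 2) ^ 2

theorem one_le_symL (n : ℕ) : 1 ≤ symL n := by
  rw [symL, Real.one_le_sqrt]
  have : (0 : ℝ) ≤ n := n.cast_nonneg
  nlinarith

theorem symL_ne (n : ℕ) : (symL n : ℂ) ≠ 0 := by
  have := one_le_symL n
  exact_mod_cast (by linarith : symL n ≠ 0)

theorem norm_inv_symL_le (n : ℕ) : ‖(symL n : ℂ)⁻¹‖ ≤ 1 := by
  have := one_le_symL n
  rw [norm_inv, Complex.norm_real, Real.norm_of_nonneg (by linarith)]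
  exact inv_le_one_of_one_le₀ this

theorem norm_symH_le (n : ℕ) : ‖(symH n : ℂ)‖ ≤ 2 := by
  have h0 : (0 : ℝ) ≤ n := n.cast_nonneg
  rw [Complex.norm_real, symH, Real.norm_of_nonneg (by positivity), div_le_iff₀ (by positivity)]
  nlinarith

/-- Exchanging the two components. -/
def swapIdx (i : ℕ × Fin 2) : ℕ × Fin 2 := (i.1, 1 - i.2)

theorem swapIdx_injective : Function.Injective swapIdx := by
  rintro ⟨n, i⟩ ⟨m, j⟩ h
  simp only [swapIdx, Prod.mk.injEq, sub_right_inj] at h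
  exact Prod.ext h.1 h.2

end Symbols

/-- The inverse of `J` on `Y₁`. -/
def opT : Y1 →L[ℂ] Y1 :=
  weightOp swapIdx swapIdx_injective
    (fun i => if i.2 = 0 then -(symL i.1 : ℂ)⁻¹ else (symL i.1 : ℂ)⁻¹) 1 (by
      intro i
      split_ifs
      · rw [norm_neg]; exact norm_inv_symL_le _
      · exact norm_inv_symL_le _)

/-- The symplectic form of `Y₁`, as an operator. -/
def opω : Y1 →L[ℂ] Y1 :=
  weightOp swapIdx swapIdx_injective
    (fun i => if i.2 = 0 then (symH i.1 : ℂ) else -(symH i.1 : ℂ)) 2 (by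
      intro i
      split_ifs
      · exact norm_symH_le _
      · rw [norm_neg]; exact norm_symH_le _)

/-- The pairing `⟨L⁻¹ u, v⟩`, as an operator. -/
def opβ : Y1 →L[ℂ] Y1 :=
  weightOp id Function.injective_id (fun i => (symH i.1 : ℂ) * (symL i.1 : ℂ)⁻¹) (2 * 1) (by
    intro i
    rw [norm_mul]
    exact mul_le_mul (norm_symH_le _) (norm_inv_symL_le _) (norm_nonneg _) zero_le_two)

/-- The pairing `⟨L⁻¹ u₁, L⁻¹ v⟩`, as an operator. -/
def opκ : Y1 →L[ℂ] Y1 :=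
  weightOp swapIdx swapIdx_injective
    (fun i => if i.2 = 0 then 0 else (symH i.1 : ℂ) * ((symL i.1 : ℂ)⁻¹ * (symL i.1 : ℂ)⁻¹))
    (2 * (1 * 1)) (by
      intro i
      split_ifs
      · simp
      · rw [norm_mul, norm_mul]
        have := norm_inv_symL_le i.1
        exact mul_le_mul (norm_symH_le _) (mul_le_mul this this (norm_nonneg _) zero_le_one)
          (by positivity) zero_le_two)

/-- The form `∑ u i * (A v) i`. -/
def formL (A : Y1 →L[ℂ] Y1) : Y1 →L[ℂ] Y1 →L[ℂ] ℂ :=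
  (ContinuousLinearMap.compL ℂ Y1 Y1 ℂ).flip A ∘L dotL

@[simp] theorem formL_apply (A : Y1 →L[ℂ] Y1) (u v : Y1) : formL A u v = dotL u (A v) := by
  simp [formL]

theorem opT_zero (y : Y1) (n : ℕ) : opT y (n, 0) = -(symL n : ℂ)⁻¹ * y (n, 1) := by
  simp [opT, swapIdx]

theorem opT_one (y : Y1) (n : ℕ) : opT y (n, 1) = (symL n : ℂ)⁻¹ * y (n, 0) := by
  simp [opT, swapIdx]

theorem opω_zero (y : Y1) (n : ℕ) : opω y (n, 0) = symH n * y (n, 1) := by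
  simp [opω, swapIdx]

theorem opω_one (y : Y1) (n : ℕ) : opω y (n, 1) = -(symH n * y (n, 0)) := by
  simp [opω, swapIdx]

theorem opβ_apply (y : Y1) (n : ℕ) (i : Fin 2) :
    opβ y (n, i) = symH n * (symL n : ℂ)⁻¹ * y (n, i) := by
  simp [opβ]

theorem opκ_zero (y : Y1) (n : ℕ) : opκ y (n, 0) = 0 := by
  simp [opκ, swapIdx]

theorem opκ_one (y : Y1) (n : ℕ) :
    opκ y (n, 1) = symH n * ((symL n : ℂ)⁻¹ * (symL n : ℂ)⁻¹) * y (n, 0) := by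
  simp [opκ, swapIdx]

theorem Y1.ext_pair {u v : Y1} (h0 : ∀ n, u (n, 0) = v (n, 0)) (h1 : ∀ n, u (n, 1) = v (n, 1)) :
    u = v := by
  ext ⟨n, i⟩
  fin_cases i
  · exact h0 n
  · exact h1 n

theorem dotL_hasSum_pair (u v : Y1) :
    HasSum (fun n => u (n, 0) * v (n, 0) + u (n, 1) * v (n, 1)) (dotL u v) := by
  have h := (dotL_hasSum u v).prod_fiberwise (fun n => hasSum_fintype _)
  simpa [Fin.sum_univ_two] using h

theorem dotL_eq_of_hasSum {u v : Y1} {φ : ℕ → ℂ} {a : ℂ} (h : HasSum φ a)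
    (e : ∀ n, u (n, 0) * v (n, 0) + u (n, 1) * v (n, 1) = φ n) : dotL u v = a :=
  (dotL_hasSum_pair u v).unique (by simpa only [e] using h)

/-- The pairings of the Klein-Gordon phase space. -/
def kgData : PairingData Y1 where
  T := opT
  β := formL opβ
  ω := formL opω
  κ := formL opκ
  T_injective := by
    intro u v huv
    refine Y1.ext_pair (fun n => ?_) (fun n => ?_)
    · have := congrArg (fun y : Y1 => y (n, 1)) huv
      simpa only [opT_one, mul_right_inj' (inv_ne_zero (symL_ne n))] using this
    · have := congrArg (fun y : Y1 => y (n, 0)) huv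
      simpa only [opT_zero, mul_right_inj' (neg_ne_zero.2 (inv_ne_zero (symL_ne n)))] using this
  ω_antisymm u v := by
    rw [formL_apply, formL_apply]
    refine dotL_eq_of_hasSum ((dotL_hasSum_pair v (opω u)).neg) fun n => ?_
    simp only [opω_zero, opω_one]
    ring
  ω_T u v := by
    rw [formL_apply, formL_apply]
    refine dotL_eq_of_hasSum ((dotL_hasSum_pair u (opβ v)).neg) fun n => ?_
    simp only [opω_zero, opω_one, opT_zero, opT_one, opβ_apply]
    ring
  β_symm u v := by
    rw [formL_apply, formL_apply]
    refine dotL_eq_of_hasSum (dotL_hasSum_pair v (opβ u)) fun n => ?_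
    simp only [opβ_apply]
    ring
  ω_T_T u v := by
    rw [formL_apply, formL_apply, formL_apply]
    refine dotL_eq_of_hasSum ((dotL_hasSum_pair v (opκ u)).sub (dotL_hasSum_pair u (opκ v))) fun n => ?_
    simp only [opω_zero, opω_one, opT_zero, opT_one, opκ_zero, opκ_one]
    ring

theorem exists_boundedBy {Y : Type*} [NormedAddCommGroup Y] [NormedSpace ℂ Y] (D : PairingData Y) :
    ∃ Λ, D.BoundedBy Λ := by
  have hβ := norm_nonneg D.β
  have hω := norm_nonneg D.ω
  have hκ := norm_nonneg D.κ
  have hT := norm_nonneg D.T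
  have key : ∀ A : Y →L[ℂ] Y →L[ℂ] ℂ, ‖A‖ ≤ 1 + ‖D.T‖ + ‖D.β‖ + ‖D.ω‖ + ‖D.κ‖ →
      ∀ u v, ‖A u v‖ ≤ (1 + ‖D.T‖ + ‖D.β‖ + ‖D.ω‖ + ‖D.κ‖) * ‖u‖ * ‖v‖ := fun A hA u v =>
    (A.le_opNorm₂ u v).trans (by gcongr)
  exact ⟨1 + ‖D.T‖ + ‖D.β‖ + ‖D.ω‖ + ‖D.κ‖, by linarith,
    fun u => ContinuousLinearMap.le_of_opNorm_le _ (by linarith) u,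
    key _ (by linarith), key _ (by linarith), key _ (by linarith)⟩

/-! ### Sine coefficients, J and the H¹ pairing in ℓ² coordinates. -/

section Coefficients

theorem weight_ne (n : ℕ) : ((√Real.pi * ((n : ℝ) + 2) : ℝ) : ℂ) ≠ 0 := by
  have h1 : (0 : ℝ) < √Real.pi := Real.sqrt_pos.2 Real.pi_pos
  have h2 : (0 : ℝ) < (n : ℝ) + 2 := by positivity
  exact_mod_cast (mul_pos h1 h2).ne'

theorem fstC_inj {u v : Y1} {n : ℕ} : fstC u n = fstC v n ↔ u (n, 0) = v (n, 0) :=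
  div_left_inj' (weight_ne n)

theorem sndC_inj {u v : Y1} {n : ℕ} : sndC u n = sndC v n ↔ u (n, 1) = v (n, 1) :=
  div_left_inj' (weight_ne n)

theorem Y1.ext_coeff {u v : Y1} (h0 : ∀ n, fstC u n = fstC v n) (h1 : ∀ n, sndC u n = sndC v n) :
    u = v :=
  Y1.ext_pair (fun n => fstC_inj.1 (h0 n)) (fun n => sndC_inj.1 (h1 n))

@[simp] theorem fstC_add (u v : Y1) (n : ℕ) : fstC (u + v) n = fstC u n + fstC v n := by
  simp [fstC, add_div]

@[simp] theorem sndC_add (u v : Y1) (n : ℕ) : sndC (u + v) n = sndC u n + sndC v n := by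
  simp [sndC, add_div]

@[simp] theorem fstC_smul (a : ℂ) (u : Y1) (n : ℕ) : fstC (a • u) n = a * fstC u n := by
  simp [fstC, mul_div_assoc]

@[simp] theorem sndC_smul (a : ℂ) (u : Y1) (n : ℕ) : sndC (a • u) n = a * sndC u n := by
  simp [sndC, mul_div_assoc]

theorem fstC_opT (u : Y1) (n : ℕ) : fstC (opT u) n = -linv (sndC u) n := by
  have : linv (sndC u) n = sndC u n / (symL n : ℂ) := rfl
  rw [this, fstC, sndC, opT_zero]
  ring

theorem sndC_opT (u : Y1) (n : ℕ) : sndC (opT u) n = linv (fstC u) n := by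
  have : linv (fstC u) n = fstC u n / (symL n : ℂ) := rfl
  rw [this, fstC, sndC, opT_one]
  ring

theorem isJ_iff {z y : Y1} : IsJ z y ↔ z = opT y := by
  constructor
  · intro h
    refine Y1.ext_coeff (fun n => ?_) (fun n => ?_)
    · rw [fstC_opT]
      have : linv (sndC y) n = sndC y n / (symL n : ℂ) := rfl
      rw [this, (h n).2]
      change _ = -(-((symL n : ℂ) * fstC z n) / (symL n : ℂ))
      field_simp [symL_ne n]
    · rw [sndC_opT]
      have : linv (fstC y) n = fstC y n / (symL n : ℂ) := rfl
      rw [this, (h n).1]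
      change _ = ((symL n : ℂ) * sndC z n) / (symL n : ℂ)
      field_simp [symL_ne n]
  · rintro rfl n
    rw [sndC_opT, fstC_opT]
    have h1 : linv (sndC y) n = sndC y n / (symL n : ℂ) := rfl
    have h2 : linv (fstC y) n = fstC y n / (symL n : ℂ) := rfl
    rw [h1, h2]
    change _ = (symL n : ℂ) * _ ∧ _ = -((symL n : ℂ) * _)
    constructor <;> field_simp [symL_ne n]

theorem pair_weight (n : ℕ) (a b : ℂ) :
    ((Real.pi * (1 + ((n : ℝ) + 2) ^ 2) : ℝ) : ℂ) *
      (a / ((√Real.pi * ((n : ℝ) + 2) : ℝ) : ℂ) * (b / ((√Real.pi * ((n : ℝ) + 2) : ℝ) : ℂ))) =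
      symH n * (a * b) := by
  have h0 := weight_ne n
  have h1 : ((√Real.pi * ((n : ℝ) + 2) : ℝ) : ℂ) * ((√Real.pi * ((n : ℝ) + 2) : ℝ) : ℂ) =
      ((Real.pi * ((n : ℝ) + 2) ^ 2 : ℝ) : ℂ) := by
    rw [← Complex.ofReal_mul]
    congr 1
    have := Real.mul_self_sqrt Real.pi_pos.le
    linear_combination ((n : ℝ) + 2) ^ 2 * this
  have h2 : ((n : ℂ) + 2) ≠ 0 := by
    have : (0 : ℝ) < (n : ℝ) + 2 := by positivity
    exact_mod_cast this.ne'
  have h3 : (Real.pi : ℂ) ≠ 0 := by exact_mod_cast Real.pi_ne_zero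
  rw [div_mul_div_comm, h1, symH]
  push_cast
  field_simp

end Coefficients

section Pairings

theorem linv_eq (p : ℕ → ℂ) (n : ℕ) : linv p n = p n * (symL n : ℂ)⁻¹ := div_eq_mul_inv _ _

theorem summable_component (u v : Y1) (i : Fin 2) : Summable fun n => u (n, i) * v (n, i) :=
  (dotL_hasSum u v).summable.comp_injective (i := fun n : ℕ => (n, i))
    fun _ _ h => (Prod.ext_iff.1 h).1

theorem pairH1_eq_tsum {p q φ : ℕ → ℂ} (a b : ℕ → ℂ)
    (hp : ∀ n, p n = a n / ((√Real.pi * ((n : ℝ) + 2) : ℝ) : ℂ))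
    (hq : ∀ n, q n = b n / ((√Real.pi * ((n : ℝ) + 2) : ℝ) : ℂ))
    (h : ∀ n, symH n * (a n * b n) = φ n) : pairH1 p q = ∑' n, φ n := by
  refine tsum_congr fun n => ?_
  rw [hp, hq, pair_weight, h]

theorem pairH1_fst_snd_sub (u v : Y1) :
    pairH1 (fstC u) (sndC v) - pairH1 (sndC u) (fstC v) = kgData.ω u v := by
  have h1 : pairH1 (fstC u) (sndC v) = ∑' n, u (n, 0) * opω v (n, 0) :=
    pairH1_eq_tsum (fun n => u (n, 0)) (fun n => v (n, 1)) (fun n => rfl) (fun n => rfl)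
      fun n => by rw [opω_zero]; ring
  have h2 : pairH1 (sndC u) (fstC v) = ∑' n, -(u (n, 1) * opω v (n, 1)) :=
    pairH1_eq_tsum (fun n => u (n, 1)) (fun n => v (n, 0)) (fun n => rfl) (fun n => rfl)
      fun n => by rw [opω_one]; ring
  rw [h1, h2, tsum_neg, sub_neg_eq_add,
    ← (summable_component u (opω v) 0).tsum_add (summable_component u (opω v) 1)]
  exact (dotL_hasSum_pair u (opω v)).tsum_eq

/-- The relation pairs the second component with the new z₁'ᶜ and the first with the old zᶜ.
Expanding z₁'ᶜ = z₁ᶜ + ε L⁻¹x₀, where x₀ is the first component of x, gives the symmetric form β in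
old variables and the correction κ. -/
theorem pairH1_generating (u v x : Y1) (ε : ℂ) :
    pairH1 (linv (sndC u)) (sndC (v + ε • opT x)) + pairH1 (linv (fstC u)) (fstC v) =
      kgData.β u v + ε * kgData.κ u x := by
  have h1 : pairH1 (linv (sndC u)) (sndC (v + ε • opT x)) =
      ∑' n, u (n, 1) * opβ (v + ε • opT x) (n, 1) :=
    pairH1_eq_tsum (fun n => u (n, 1) * (symL n : ℂ)⁻¹) (fun n => (v + ε • opT x) (n, 1))
      (fun n => by rw [linv_eq, sndC]; ring) (fun n => rfl)
      fun n => by rw [opβ_apply]; ring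
  have h2 : pairH1 (linv (fstC u)) (fstC v) = ∑' n, u (n, 0) * opβ v (n, 0) :=
    pairH1_eq_tsum (fun n => u (n, 0) * (symL n : ℂ)⁻¹) (fun n => v (n, 0))
      (fun n => by rw [linv_eq, fstC]; ring) (fun n => rfl)
      fun n => by rw [opβ_apply]; ring
  rw [h1, h2, ← (summable_component u _ 1).tsum_add (summable_component u _ 0)]
  refine HasSum.tsum_eq ?_
  have h3 := (dotL_hasSum_pair u (opβ v)).add ((dotL_hasSum_pair u (opκ x)).mul_left ε)
  convert! h3 using 1
  funext n
  simp only [opβ_apply, opκ_zero, opκ_one]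
  have h4 : (v + ε • opT x) (n, 1) = v (n, 1) + ε * ((symL n : ℂ)⁻¹ * x (n, 0)) := by
    rw [← opT_one]; rfl
  rw [h4]
  ring

theorem sympForm_eq (ε : ℝ) (U V : E) : sympForm ε U V = formOf kgData ε U V := by
  rw [sympForm, formOf, pairH1_fst_snd_sub]

theorem fderiv_scaled (c : ℂ) (w : E → Y1) (Z : E) :
    fderiv ℂ (fun Z => c • w Z) Z = c • fderiv ℂ w Z :=
  congrFun (fderiv_const_smul_field c (f := w)) Z

/-- The generating function relation, in terms of the mixed variables. -/
theorem genRel_iff {ε : ℝ} (hε : ε ≠ 0) (k : ℕ) (w : E → Y1) (Z Z' : E) :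
    GenRel ε k (fun Z => ((ε : ℂ) ^ k)⁻¹ • w Z) Z Z' ↔
      Z = oldMap kgData ε w ((Z.1.1, Z'.1.2), Z.2) ∧
      Z' = newMap kgData ε w ((Z.1.1, Z'.1.2), Z.2) := by
  have hε' : (ε : ℂ) ≠ 0 := by exact_mod_cast hε
  have hk : (ε : ℂ) ^ k ≠ 0 := pow_ne_zero _ hε'
  set q : ℂ × ℂ := (Z.1.1, Z'.1.2) with hq
  have hosc : ((∀ n, fstC Z'.2 n = fstC Z.2 n - (ε : ℂ) ^ (k + 1) *
        linv (sndC (((ε : ℂ) ^ k)⁻¹ • w (q, 0))) n) ∧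
      (∀ n, sndC Z'.2 n = sndC Z.2 n + (ε : ℂ) ^ (k + 1) *
        linv (fstC (((ε : ℂ) ^ k)⁻¹ • w (q, 0))) n)) ↔
      Z'.2 = Z.2 + (ε : ℂ) • opT (w (q, 0)) := by
    have h1 : ∀ n, fstC (Z.2 + (ε : ℂ) • opT (w (q, 0))) n = fstC Z.2 n - (ε : ℂ) ^ (k + 1) *
        linv (sndC (((ε : ℂ) ^ k)⁻¹ • w (q, 0))) n := by
      intro n
      rw [fstC_add, fstC_smul, fstC_opT, linv_eq, linv_eq, sndC_smul]
      field_simp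
      ring
    have h2 : ∀ n, sndC (Z.2 + (ε : ℂ) • opT (w (q, 0))) n = sndC Z.2 n + (ε : ℂ) ^ (k + 1) *
        linv (fstC (((ε : ℂ) ^ k)⁻¹ • w (q, 0))) n := by
      intro n
      rw [sndC_add, sndC_smul, sndC_opT, linv_eq, linv_eq, fstC_smul]
      field_simp
      ring
    constructor
    · rintro ⟨h3, h4⟩
      exact Y1.ext_coeff (fun n => by rw [h1, h3]) (fun n => by rw [h2, h4])
    · intro h3
      rw [h3]
      exact ⟨h1, h2⟩
  -- The hyperbolic equations contain z₁'ᶜ, so they become explicit in the mixed variables only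
  -- after the oscillatory equation is known. The powers of ε agree because the remainder is ε^(−k)
  -- w.
  have hpot : ∀ e : ℂ × ℂ, Z'.2 = Z.2 + (ε : ℂ) • opT (w (q, 0)) →
      (ε : ℂ) ^ (k + 2) *
        (pairH1 (linv (sndC (((ε : ℂ) ^ k)⁻¹ • slope w e q))) (sndC Z'.2) +
          pairH1 (linv (fstC (((ε : ℂ) ^ k)⁻¹ • slope w e q))) (fstC Z.2)) =
      (ε : ℂ) ^ 2 * pot kgData ε w e (q, Z.2) := by
    intro e h
    rw [h, pairH1_generating, pot]
    simp only [map_smul, smul_apply, smul_eq_mul]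
    field_simp
    ring
  have hmid : GenRel ε k (fun Z => ((ε : ℂ) ^ k)⁻¹ • w Z) Z Z' ↔
      (Z'.1.1 = Z.1.1 - (ε : ℂ) ^ (k + 2) *
        (pairH1 (linv (sndC (((ε : ℂ) ^ k)⁻¹ • slope w (0, 1) q))) (sndC Z'.2) +
          pairH1 (linv (fstC (((ε : ℂ) ^ k)⁻¹ • slope w (0, 1) q))) (fstC Z.2)) ∧
      Z'.1.2 = Z.1.2 + (ε : ℂ) ^ (k + 2) *
        (pairH1 (linv (sndC (((ε : ℂ) ^ k)⁻¹ • slope w (1, 0) q))) (sndC Z'.2) +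
          pairH1 (linv (fstC (((ε : ℂ) ^ k)⁻¹ • slope w (1, 0) q))) (fstC Z.2))) ∧
      Z'.2 = Z.2 + (ε : ℂ) • opT (w (q, 0)) := by
    rw [← hosc]
    simp only [GenRel, fderiv_scaled]
    constructor
    · rintro ⟨a, b, c, d⟩
      exact ⟨⟨a, b⟩, c, d⟩
    · rintro ⟨⟨a, b⟩, c, d⟩
      exact ⟨a, b, c, d⟩
  rw [hmid]
  constructor
  · rintro ⟨⟨h1, h2⟩, h3⟩
    rw [hpot _ h3] at h1 h2
    refine ⟨Prod.ext (Prod.ext rfl ?_) rfl, Prod.ext (Prod.ext h1 rfl) h3⟩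
    change Z.1.2 = Z'.1.2 - _
    rw [h2]
    ring
  · rintro ⟨h1, h2⟩
    have h3 : Z'.2 = Z.2 + (ε : ℂ) • opT (w (q, 0)) := congrArg Prod.snd h2
    refine ⟨?_, h3⟩
    rw [hpot _ h3, hpot _ h3]
    refine ⟨congrArg (fun V : E => V.1.1) h2, ?_⟩
    have h4 : Z.1.2 = Z'.1.2 - (ε : ℂ) ^ 2 * pot kgData ε w (1, 0) (q, Z.2) :=
      congrArg (fun V : E => V.1.2) h1
    rw [h4]
    ring

end Pairings

/-! ### Comparison of the stated norms with the sup norm. -/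

section Norms

/-- Packing two real coordinates into one complex number turns the Euclidean norm of ℝ² into the
norm of ℂ and supplies the triangle inequality. -/
theorem hnorm_eq (v : ℂ × ℂ) :
    hnorm v = ‖(⟨v.1.re, v.2.re⟩ : ℂ)‖ + ‖(⟨v.1.im, v.2.im⟩ : ℂ)‖ := by
  rw [hnorm, Complex.norm_def, Complex.norm_def, Complex.normSq_mk, Complex.normSq_mk]
  simp only [sq]

theorem hnorm_add_le (u v : ℂ × ℂ) : hnorm (u + v) ≤ hnorm u + hnorm v := by
  simp only [hnorm_eq]
  have h1 := norm_add_le (⟨u.1.re, u.2.re⟩ : ℂ) ⟨v.1.re, v.2.re⟩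
  have h2 := norm_add_le (⟨u.1.im, u.2.im⟩ : ℂ) ⟨v.1.im, v.2.im⟩
  have h3 : (⟨(u + v).1.re, (u + v).2.re⟩ : ℂ) = ⟨u.1.re, u.2.re⟩ + ⟨v.1.re, v.2.re⟩ := rfl
  have h4 : (⟨(u + v).1.im, (u + v).2.im⟩ : ℂ) = ⟨u.1.im, u.2.im⟩ + ⟨v.1.im, v.2.im⟩ := rfl
  rw [h3, h4]
  linarith

theorem norm_le_hnorm (v : ℂ × ℂ) : ‖v‖ ≤ hnorm v := by
  rw [hnorm_eq]
  have h1 := Complex.abs_re_le_norm (⟨v.1.re, v.2.re⟩ : ℂ)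
  have h2 := Complex.abs_re_le_norm (⟨v.1.im, v.2.im⟩ : ℂ)
  have h3 := Complex.abs_im_le_norm (⟨v.1.re, v.2.re⟩ : ℂ)
  have h4 := Complex.abs_im_le_norm (⟨v.1.im, v.2.im⟩ : ℂ)
  refine max_le ((Complex.norm_le_abs_re_add_abs_im _).trans ?_)
    ((Complex.norm_le_abs_re_add_abs_im _).trans ?_)
  · exact add_le_add h1 h2
  · exact add_le_add h3 h4

theorem hnorm_le (v : ℂ × ℂ) : hnorm v ≤ 4 * ‖v‖ := by
  rw [hnorm_eq]
  have h1 := Complex.norm_le_abs_re_add_abs_im (⟨v.1.re, v.2.re⟩ : ℂ)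
  have h2 := Complex.norm_le_abs_re_add_abs_im (⟨v.1.im, v.2.im⟩ : ℂ)
  have h3 := (Complex.abs_re_le_norm v.1).trans (norm_fst_le v)
  have h4 := (Complex.abs_im_le_norm v.1).trans (norm_fst_le v)
  have h5 := (Complex.abs_re_le_norm v.2).trans (norm_snd_le v)
  have h6 := (Complex.abs_im_le_norm v.2).trans (norm_snd_le v)
  simp only at h1 h2
  linarith

theorem cnorm_term (n : ℕ) (a b : ℂ) :
    Real.pi * ((n : ℝ) + 2) ^ 2 * ((a / ((√Real.pi * ((n : ℝ) + 2) : ℝ) : ℂ)).re ^ 2 +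
      (b / ((√Real.pi * ((n : ℝ) + 2) : ℝ) : ℂ)).re ^ 2) = a.re ^ 2 + b.re ^ 2 ∧
    Real.pi * ((n : ℝ) + 2) ^ 2 * ((a / ((√Real.pi * ((n : ℝ) + 2) : ℝ) : ℂ)).im ^ 2 +
      (b / ((√Real.pi * ((n : ℝ) + 2) : ℝ) : ℂ)).im ^ 2) = a.im ^ 2 + b.im ^ 2 := by
  have h1 : (0 : ℝ) < √Real.pi := Real.sqrt_pos.2 Real.pi_pos
  have h2 : (0 : ℝ) < (n : ℝ) + 2 := by positivity
  have h3 : Real.pi = √Real.pi ^ 2 := (Real.sq_sqrt Real.pi_pos.le).symm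
  simp only [Complex.div_ofReal_re, Complex.div_ofReal_im]
  have h4 : Real.pi * ((n : ℝ) + 2) ^ 2 = (√Real.pi * ((n : ℝ) + 2)) ^ 2 := by
    rw [mul_pow, ← h3]
  rw [h4]
  have h5 : √Real.pi * ((n : ℝ) + 2) ≠ 0 := (mul_pos h1 h2).ne'
  generalize √Real.pi * ((n : ℝ) + 2) = c at h5
  constructor <;> field_simp

theorem norm_sq_eq_tsum (y : Y1) : ‖y‖ ^ 2 = ∑' n : ℕ, (‖y (n, 0)‖ ^ 2 + ‖y (n, 1)‖ ^ 2) := by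
  have h2 : (0 : ℝ) < (2 : ENNReal).toReal := by norm_num
  have h := lp.hasSum_norm h2 y
  simp only [ENNReal.toReal_ofNat, Real.rpow_two] at h
  have h3 := h.prod_fiberwise (fun n => hasSum_fintype _)
  simp only [Fin.sum_univ_two] at h3
  exact h3.tsum_eq.symm

/-- The star operation is coefficientwise conjugation, so the two terms are the ℓ² norms of the real
and imaginary parts. The weights π(n+2)² are exactly those absorbed in the coordinates of `Y1`. -/
theorem cnorm_eq (y : Y1) : cnorm y = ‖(1 / 2 : ℂ) • (y + star y)‖ + ‖(1 / 2 : ℂ) • (y - star y)‖ := by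
  have h1 : ∀ u : Y1, ∀ φ : ℕ → ℝ, (∀ n, ‖u (n, 0)‖ ^ 2 + ‖u (n, 1)‖ ^ 2 = φ n) →
      √(∑' n, φ n) = ‖u‖ := by
    intro u φ hφ
    rw [← tsum_congr hφ, ← norm_sq_eq_tsum, Real.sqrt_sq (norm_nonneg _)]
  have hre : ∀ z : ℂ, ‖(1 / 2 : ℂ) * (z + star z)‖ ^ 2 = z.re ^ 2 := by
    intro z
    have : (1 / 2 : ℂ) * (z + star z) = (z.re : ℂ) := by
      apply Complex.ext <;> simp <;> ring
    rw [this, Complex.norm_real, Real.norm_eq_abs, sq_abs]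
  have him : ∀ z : ℂ, ‖(1 / 2 : ℂ) * (z - star z)‖ ^ 2 = z.im ^ 2 := by
    intro z
    have : (1 / 2 : ℂ) * (z - star z) = (z.im : ℂ) * Complex.I := by
      apply Complex.ext <;> simp <;> ring
    rw [this, norm_mul, Complex.norm_I, mul_one, Complex.norm_real, Real.norm_eq_abs, sq_abs]
  rw [cnorm]
  congr 1
  · refine h1 _ _ fun n => ?_
    rw [fstC, sndC, (cnorm_term n _ _).1]
    exact congrArg₂ (· + ·) (hre _) (hre _)
  · refine h1 _ _ fun n => ?_
    rw [fstC, sndC, (cnorm_term n _ _).2]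
    exact congrArg₂ (· + ·) (him _) (him _)

theorem norm_le_cnorm (y : Y1) : ‖y‖ ≤ cnorm y := by
  rw [cnorm_eq]
  have h : y = (1 / 2 : ℂ) • (y + star y) + (1 / 2 : ℂ) • (y - star y) := by
    rw [← smul_add, add_add_sub_cancel, ← two_smul ℂ y, smul_smul]
    norm_num
  calc ‖y‖ = ‖(1 / 2 : ℂ) • (y + star y) + (1 / 2 : ℂ) • (y - star y)‖ := congrArg _ h
    _ ≤ _ := norm_add_le _ _

theorem cnorm_le (y : Y1) : cnorm y ≤ 2 * ‖y‖ := by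
  rw [cnorm_eq, norm_smul, norm_smul]
  have h1 := norm_add_le y (star y)
  have h2 := norm_sub_le y (star y)
  rw [norm_star] at h1 h2
  norm_num
  linarith

theorem cnorm_add_le (u v : Y1) : cnorm (u + v) ≤ cnorm u + cnorm v := by
  simp only [cnorm_eq]
  have h1 : (1 / 2 : ℂ) • (u + v + star (u + v)) =
      (1 / 2 : ℂ) • (u + star u) + (1 / 2 : ℂ) • (v + star v) := by
    rw [star_add]; module
  have h2 : (1 / 2 : ℂ) • (u + v - star (u + v)) =
      (1 / 2 : ℂ) • (u - star u) + (1 / 2 : ℂ) • (v - star v) := by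
    rw [star_add]; module
  rw [h1, h2]
  have h3 := norm_add_le ((1 / 2 : ℂ) • (u + star u)) ((1 / 2 : ℂ) • (v + star v))
  have h4 := norm_add_le ((1 / 2 : ℂ) • (u - star u)) ((1 / 2 : ℂ) • (v - star v))
  linarith

theorem cnorm_nonneg (y : Y1) : 0 ≤ cnorm y := (norm_nonneg y).trans (norm_le_cnorm y)

theorem hnorm_nonneg (v : ℂ × ℂ) : 0 ≤ hnorm v := (norm_nonneg v).trans (norm_le_hnorm v)

theorem norm_le_znorm (Z : E) : ‖Z‖ ≤ znorm Z :=
  max_le ((norm_le_hnorm _).trans (le_add_of_nonneg_right (cnorm_nonneg _)))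
    ((norm_le_cnorm _).trans (le_add_of_nonneg_left (hnorm_nonneg _)))

theorem znorm_le (Z : E) : znorm Z ≤ 6 * ‖Z‖ := by
  have h1 := hnorm_le Z.1
  have h2 := cnorm_le Z.2
  have h3 := norm_fst_le Z
  have h4 := norm_snd_le Z
  rw [znorm]
  linarith

theorem znorm_add_le (U V : E) : znorm (U + V) ≤ znorm U + znorm V := by
  have h1 := hnorm_add_le U.1 V.1
  have h2 := cnorm_add_le U.2 V.2
  rw [znorm, znorm, znorm, Prod.fst_add, Prod.snd_add]
  linarith

theorem znorm_le_add (U V : E) : znorm U ≤ znorm V + 6 * ‖U - V‖ := by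
  have h1 := znorm_add_le V (U - V)
  rw [add_sub_cancel] at h1
  linarith [znorm_le (U - V)]

theorem isOpen_zball (r : ℝ) : IsOpen (zball r) := by
  rw [Metric.isOpen_iff]
  intro Z hZ
  refine ⟨(r - znorm Z) / 6, by have : znorm Z < r := hZ; linarith, fun W hW => ?_⟩
  rw [mem_ball, dist_eq_norm] at hW
  have := znorm_le_add W Z
  change znorm W < r
  linarith

theorem zball_subset_ball (r : ℝ) : zball r ⊆ ball (0 : E) r := fun Z hZ => by
  rw [mem_ball_zero_iff]
  exact (norm_le_znorm Z).trans_lt hZ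

theorem znorm_mixedPt_le (M : E) : znorm (M.1, 0) ≤ znorm M := by
  have h : cnorm 0 ≤ 0 := by simpa using cnorm_le 0
  have := cnorm_nonneg M.2
  rw [znorm, znorm]
  simp only
  linarith

end Norms

/-! ### One normal form step in the original scaling. -/

/-- The system at stage `k` whose rescaling is `S`. -/
def ScaledSys.toSys (S : ScaledSys Y1) (ε : ℝ) (k : ℕ) : Sys where
  F := S.F
  G Z := (ε : ℂ)⁻¹ • S.G Z
  Gt Z := ((ε : ℂ) ^ k)⁻¹ • S.w Z

theorem ScaledSys.toSys_field (S : ScaledSys Y1) {ε : ℝ} (hε : ε ≠ 0) (k : ℕ) (Z : E) (y : Y1) :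
    (S.toSys ε k).field ε k Z y =
      ((Z.1.2, Z.1.1) + S.F Z, (ε : ℂ)⁻¹ • y + S.G Z Z.2 + S.w Z) := by
  have hε' : (ε : ℂ) ≠ 0 := by exact_mod_cast hε
  simp only [Sys.field, ScaledSys.toSys, smul_apply]
  rw [smul_inv_smul₀ hε', smul_inv_smul₀ (pow_ne_zero _ hε')]

theorem avgDc_scaled (c : ℂ) (w : E → Y1) (Z Z' : E) :
    avgDc (fun Z => c • w Z) Z Z' = c • avgDc w Z Z' := by
  simp only [avgDc, fderiv_scaled, ContinuousLinearMap.smul_comp]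
  exact intervalIntegral.integral_smul _ _

/-- The transformation is `newMap` after the inverse of `oldMap`, and the new coefficients are those
of `nextSys` pulled back by the inverse of `newMap`. The coefficients live on the sup-norm ball of
radius ρ − η; the transformation itself is restricted to the prescribed ball in `znorm`. -/
theorem StepHyp.exists_next {S : ScaledSys Y1} {ε Λ R B N n η ρ : ℝ}
    (h : StepHyp kgData S ε Λ R B N n η ρ) {K K₁ : ℝ} {k : ℕ}
    (hr : radius K K₁ ε k ≤ ρ - η) (hK₁ : 0 < K₁)
    (hsmall : 24 * Λ * R * (ε * N) ≤ K₁ * ε / 2) :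
    ∃ (S' : ScaledSys Y1) (Θ : OpenPartialHomeomorph E E),
      IsNormalFormStep K K₁ ε k (S.toSys ε k) (S'.toSys ε (k + 1)) Θ ∧
      AnalyticOnNhd ℂ S'.F (ball 0 (ρ - η)) ∧ AnalyticOnNhd ℂ S'.G (ball 0 (ρ - η)) ∧
      AnalyticOnNhd ℂ S'.w (ball 0 (ρ - η)) ∧
      ∀ Z' ∈ ball (0 : E) (ρ - η), ∃ M ∈ ball (0 : E) (ρ - η / 2),
        S'.F Z' = (nextSys kgData ε S).F M ∧ S'.G Z' = (nextSys kgData ε S).G M ∧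
        S'.w Z' = (nextSys kgData ε S).w M := by
  have hε := h.eps_pos
  have hη := h.η_pos
  have hε' : (ε : ℂ) ≠ 0 := by exact_mod_cast hε.ne'
  obtain ⟨e₁, hs₁, hc₁, ht₁, ha₁⟩ := h.exists_oldHomeo
  obtain ⟨e₂, hs₂, hc₂, ht₂, ha₂⟩ := h.exists_newHomeo
  have hρ₁ : ball (0 : E) (ρ - η) ⊆ e₁.target := (ball_subset_ball (by linarith)).trans ht₁
  have hρ₂ : ball (0 : E) (ρ - η) ⊆ e₂.target := (ball_subset_ball (by linarith)).trans ht₂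
  have hm₂ : ∀ Z' ∈ ball (0 : E) (ρ - η), e₂.symm Z' ∈ ball (0 : E) (ρ - η / 2) := fun Z' hZ' => by
    rw [← hs₂]; exact e₂.map_target (hρ₂ hZ')
  set r := radius K K₁ ε k with hrdef
  set U : Set E := zball (r - K₁ * ε / 2) with hU
  have hKε : 0 < K₁ * ε := mul_pos hK₁ hε
  have hUball : U ⊆ ball (0 : E) (ρ - η) :=
    (zball_subset_ball _).trans (ball_subset_ball (by linarith))
  set Θ : OpenPartialHomeomorph E E := (e₁.symm.trans e₂).restrOpen U (isOpen_zball _) with hΘ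
  have hsource : Θ.source = U := by
    have h1 : Θ.source = (e₁.target ∩ e₁.symm ⁻¹' e₂.source) ∩ U := rfl
    rw [h1, inter_eq_right]
    intro Z hZ
    have h2 := hρ₁ (hUball hZ)
    refine ⟨h2, ?_⟩
    change e₁.symm Z ∈ e₂.source
    rw [hs₂, ← hs₁]
    exact e₁.map_target h2
  have hΘapp : ∀ Z, Θ Z = newMap kgData ε S.w (e₁.symm Z) := fun Z => hc₂ _
  have hΘsymm : ∀ Z, Θ.symm Z = oldMap kgData ε S.w (e₂.symm Z) := fun Z => hc₁ _
  have hM : ∀ Z ∈ U, e₁.symm Z ∈ ball (0 : E) (ρ - η / 2) := fun Z hZ => by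
    rw [← hs₁]; exact e₁.map_target (hρ₁ (hUball hZ))
  have hMold : ∀ Z ∈ U, oldMap kgData ε S.w (e₁.symm Z) = Z := fun Z hZ => by
    rw [← hc₁]; exact e₁.right_inv (hρ₁ (hUball hZ))
  have hMnew : ∀ Z ∈ U, e₂.symm (Θ Z) = e₁.symm Z := fun Z hZ => by
    rw [hΘapp, ← hc₂]
    exact e₂.left_inv (by rw [hs₂]; exact hM Z hZ)
  have hΘan : ∀ Z ∈ U, AnalyticAt ℂ Θ Z := by
    intro Z hZ
    have h1 : AnalyticAt ℂ (fun Z => newMap kgData ε S.w (e₁.symm Z)) Z :=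
      (analyticAt_newMap (h.w_base_an (hM Z hZ))).comp_of_eq (ha₁ Z (hρ₁ (hUball hZ))) rfl
    rwa [← funext hΘapp] at h1
  have hderiv : ∀ Z ∈ U, ∀ V : E, fderiv ℂ Θ Z (fderiv ℂ (oldMap kgData ε S.w) (e₁.symm Z) V) =
      fderiv ℂ (newMap kgData ε S.w) (e₁.symm Z) V := by
    intro Z hZ V
    have h1 := (analyticAt_oldMap (D := kgData) (ε := ε)
      (h.w_base_an (hM Z hZ))).differentiableAt.hasFDerivAt
    have h2 : HasFDerivAt Θ (fderiv ℂ Θ Z) (oldMap kgData ε S.w (e₁.symm Z)) := by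
      rw [hMold Z hZ]
      exact (hΘan Z hZ).differentiableAt.hasFDerivAt
    have h3 := h2.comp _ h1
    have h4 : newMap kgData ε S.w =ᶠ[𝓝 (e₁.symm Z)] Θ ∘ oldMap kgData ε S.w := by
      filter_upwards [isOpen_ball.mem_nhds (hM Z hZ)] with M' hM'
      have h5 : e₁.symm (oldMap kgData ε S.w M') = M' := by
        rw [← hc₁]; exact e₁.left_inv (by rw [hs₁]; exact hM')
      rw [Function.comp_apply, hΘapp, h5]
    rw [(h3.congr_of_eventuallyEq h4).fderiv]
    rfl
  -- Every tangent vector at Z is the image of one at M, so statements about the derivative of Θ may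
  -- be checked on images under the derivative of `oldMap`.
  have hsurj : ∀ Z ∈ U, ∀ W : E, ∃ V : E,
      fderiv ℂ (oldMap kgData ε S.w) (e₁.symm Z) V = W := by
    intro Z hZ W
    have h1 := (analyticAt_oldMap (D := kgData) (ε := ε)
      (h.w_base_an (hM Z hZ))).differentiableAt.hasFDerivAt
    have h2 := (ha₁ Z (hρ₁ (hUball hZ))).differentiableAt.hasFDerivAt
    have h3 := h1.comp Z h2
    have h4 : id =ᶠ[𝓝 Z] oldMap kgData ε S.w ∘ e₁.symm := by
      filter_upwards [(isOpen_zball _).mem_nhds hZ] with Z₁ hZ₁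
      exact (hMold Z₁ hZ₁).symm
    have h5 := (h3.congr_of_eventuallyEq h4).unique (hasFDerivAt_id Z)
    exact ⟨_, congrArg (fun A : E →L[ℂ] E => A W) h5⟩
  refine ⟨⟨fun Z' => (nextSys kgData ε S).F (e₂.symm Z'),
    fun Z' => (nextSys kgData ε S).G (e₂.symm Z'), fun Z' => (nextSys kgData ε S).w (e₂.symm Z')⟩,
    Θ, ?_, ?_, ?_, ?_, ?_⟩
  · constructor
    · exact hsource
    · intro Z' hZ'
      have hrad : radius K K₁ ε (k + 1) = r - K₁ * ε := by
        rw [hrdef, radius, radius]; push_cast; ring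
      have hZ'r : znorm Z' < r - K₁ * ε := hrad ▸ hZ'
      have hZ'b : Z' ∈ ball (0 : E) (ρ - η) :=
        ball_subset_ball (by linarith) (zball_subset_ball _ hZ'r)
      have hMb := hm₂ Z' hZ'b
      have hZ'eq : newMap kgData ε S.w (e₂.symm Z') = Z' := by
        rw [← hc₂]; exact e₂.right_inv (hρ₂ hZ'b)
      have h1 := h.oldMap_sub_le hMb
      have h2 := h.newMap_sub_le hMb
      -- Old and new points differ by at most (2 + 2)ΛRεN in the sup norm, hence by six times that
      -- in `znorm`. This is the 24 in `hsmall`, and the gap between the target and source radii is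
      -- K₁ε/2.
      have hZU : oldMap kgData ε S.w (e₂.symm Z') ∈ U := by
        have h3 := znorm_le_add (oldMap kgData ε S.w (e₂.symm Z')) Z'
        have h4 := norm_sub_le (oldMap kgData ε S.w (e₂.symm Z') - e₂.symm Z') (Z' - e₂.symm Z')
        rw [hZ'eq] at h2
        rw [sub_sub_sub_cancel_right] at h4
        change znorm _ < _
        linarith
      have h5 : Θ (oldMap kgData ε S.w (e₂.symm Z')) = Z' := by
        have h6 : e₁.symm (oldMap kgData ε S.w (e₂.symm Z')) = e₂.symm Z' := by
          rw [← hc₁]; exact e₁.left_inv (by rw [hs₁]; exact hMb)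
        rw [hΘapp, h6, hZ'eq]
      rw [← h5]
      exact Θ.map_source (hsource ▸ hZU)
    · rw [hsource]
      exact hΘan
    · intro Z' hZ'
      have h1 : Z' ∈ e₂.target := hZ'.1.1
      have h2 : e₂.symm Z' ∈ ball (0 : E) (ρ - η / 2) := hs₂ ▸ e₂.map_target h1
      have h3 : AnalyticAt ℂ (fun Z => oldMap kgData ε S.w (e₂.symm Z)) Z' :=
        (analyticAt_oldMap (h.w_base_an h2)).comp_of_eq (ha₂ Z' h1) rfl
      rwa [← funext hΘsymm] at h3
    · intro Z hZ Z'
      rw [hsource] at hZ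
      have hZr : znorm Z < r - K₁ * ε / 2 := hZ
      have hgen := genRel_iff hε.ne' k S.w Z Z'
      change (mixedPt Z Z' ∈ Omega K K₁ ε k ∧
        GenRel ε k (fun Z => ((ε : ℂ) ^ k)⁻¹ • S.w Z) Z Z') ↔ _
      rw [hgen]
      constructor
      · rintro ⟨hmix, h1, h2⟩
        -- For uniqueness: any solution with mixed point in Ω_k yields a point of the domain on
        -- which `oldMap` is injective. It must be the inverse image of Z, and this determines Z'.
        have hMb : (((Z.1.1, Z'.1.2), Z.2) : E) ∈ ball (0 : E) (ρ - η / 2) := by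
          rw [mem_ball_zero_iff]
          have h3 : ‖((Z.1.1, Z'.1.2) : ℂ × ℂ)‖ < r := by
            have h4 : ‖mixedPt Z Z'‖ < r := (norm_le_znorm _).trans_lt hmix
            exact (norm_fst_le (mixedPt Z Z')).trans_lt h4
          have h5 : ‖Z.2‖ < r := by
            have := (norm_snd_le Z).trans (norm_le_znorm Z)
            linarith
          have h6 : ‖(((Z.1.1, Z'.1.2), Z.2) : E)‖ < r := max_lt h3 h5
          linarith
        have h7 : e₁.symm Z = ((Z.1.1, Z'.1.2), Z.2) := by
          have h8 := e₁.left_inv (x := ((Z.1.1, Z'.1.2), Z.2)) (by rw [hs₁]; exact hMb)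
          rwa [hc₁, ← h1] at h8
        rw [hΘapp, h7]
        exact h2
      · rintro rfl
        have hold := hMold Z hZ
        have hMb := hM Z hZ
        have h1 : ((Z.1.1, (Θ Z).1.2), Z.2) = e₁.symm Z := by
          rw [hΘapp]
          conv_lhs => rw [← hold]
          have : e₁.symm (oldMap kgData ε S.w (e₁.symm Z)) = e₁.symm Z := by rw [hold]
          rw [this]
          rfl
        have h2 : mixedPt Z (Θ Z) = ((e₁.symm Z).1, 0) := by
          rw [← h1]; rfl
        rw [h1, h2]
        refine ⟨?_, hold.symm, hΘapp Z⟩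
        have h3 := znorm_mixedPt_le (e₁.symm Z)
        have h4 := znorm_le_add (e₁.symm Z) Z
        have h5 := h.oldMap_sub_le hMb
        rw [hold, norm_sub_rev] at h5
        have h6 := h.disp_nonneg
        change znorm _ < r
        linarith
    · intro Z hZ V W
      rw [hsource] at hZ
      obtain ⟨V', rfl⟩ := hsurj Z hZ V
      obtain ⟨W', rfl⟩ := hsurj Z hZ W
      rw [hderiv Z hZ, hderiv Z hZ, sympForm_eq, sympForm_eq]
      exact formOf_newMap_eq hε.ne' (h.w_base_an (hM Z hZ)) _ _
    · intro Z hZ _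
      rw [hsource] at hZ
      have hav : avgDc S.w Z (Θ Z) = avgMap kgData ε S.w (e₁.symm Z) := by
        have hold := hMold Z hZ
        rw [hΘapp]
        conv_lhs => rw [← hold]
        have : e₁.symm (oldMap kgData ε S.w (e₁.symm Z)) = e₁.symm Z := by rw [hold]
        rw [this]
        rfl
      simp only [ScaledSys.toSys]
      rw [avgDc_scaled, smul_inv_smul₀ hε', smul_inv_smul₀ hε',
        smul_inv_smul₀ (pow_ne_zero _ hε'), hMnew Z hZ, hav, hΘapp]
      rfl
    · intro Z hZ _ y y' hy hy'
      rw [hsource] at hZ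
      have hold := hMold Z hZ
      rw [isJ_iff] at hy hy'
      have hy1 : (e₁.symm Z).2 = kgData.T y := by
        have h1 : (oldMap kgData ε S.w (e₁.symm Z)).2 = (e₁.symm Z).2 := rfl
        rw [← h1, hold]
        exact hy
      obtain ⟨V, hV1, hV2⟩ := h.exists_mixed_vector (hM Z hZ) hy1 (hΘapp Z ▸ hy')
      rw [ScaledSys.toSys_field _ hε.ne', ScaledSys.toSys_field _ hε.ne']
      have h2 : ((Z.1.2, Z.1.1) + S.F Z, (ε : ℂ)⁻¹ • y + S.G Z Z.2 + S.w Z) =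
          fderiv ℂ (oldMap kgData ε S.w) (e₁.symm Z) V := by
        rw [hV1, hypField, oscRate, hold, ← add_assoc]
        have h3 : (e₁.symm Z).2 = Z.2 := by rw [hy1]; exact hy.symm
        rw [h3]
      rw [h2, hderiv Z hZ, hV2]
      simp only [hMnew Z hZ]
      rw [hΘapp]
  · intro Z' hZ'
    exact (h.nextSys_F_an (hm₂ Z' hZ')).comp_of_eq (ha₂ Z' (hρ₂ hZ')) rfl
  · intro Z' hZ'
    exact (h.nextSys_G_an (hm₂ Z' hZ')).comp_of_eq (ha₂ Z' (hρ₂ hZ')) rfl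
  · intro Z' hZ'
    exact (h.nextSys_w_an (hm₂ Z' hZ')).comp_of_eq (ha₂ Z' (hρ₂ hZ')) rfl
  · intro Z' hZ'
    exact ⟨e₂.symm Z', hm₂ Z' hZ', rfl, rfl, rfl⟩

/-! ### Sine series and Fourier coefficients in the continuous functions on the circle. -/

section CircleAlgebra

instance fact_two_pi_pos : Fact (0 < 2 * Real.pi) := ⟨Real.two_pi_pos⟩

/-- The Banach algebra of continuous functions on the circle. -/
abbrev CircleAlg : Type := C(AddCircle (2 * Real.pi), ℂ)

/-- The function `x ↦ sin (j x)` on the circle. -/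
def sinC (j : ℤ) : CircleAlg := (-Complex.I / 2) • (fourier j - fourier (-j))

theorem sinC_coe (j : ℤ) (x : ℝ) :
    sinC j (x : AddCircle (2 * Real.pi)) = Complex.sin ((j : ℂ) * x) := by
  have h : ∀ k : ℤ, fourier k (x : AddCircle (2 * Real.pi)) = Complex.exp ((k : ℂ) * x * Complex.I) := by
    intro k
    rw [fourier_coe_apply]
    congr 1
    have hπ : (Real.pi : ℂ) ≠ 0 := by exact_mod_cast Real.pi_ne_zero
    push_cast
    field_simp
  rw [sinC, ContinuousMap.smul_apply, ContinuousMap.sub_apply, h, h, Complex.sin, smul_eq_mul]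
  push_cast
  rw [show -((j : ℂ) * x) * Complex.I = -(j : ℂ) * x * Complex.I by ring]
  ring

theorem norm_sinC_le (j : ℤ) : ‖sinC j‖ ≤ 1 := by
  rw [sinC, norm_smul]
  have h := norm_sub_le (fourier j : CircleAlg) (fourier (-j))
  rw [fourier_norm, fourier_norm] at h
  have h2 : ‖-Complex.I / 2‖ = 1 / 2 := by simp
  rw [h2]
  linarith

/-- The embedding of H¹ into C⁰: the coefficients are an ℓ² sequence divided by √π(n+2), hence
absolutely summable by Cauchy–Schwarz. -/
theorem summable_sine_series (y : Y1) :
    (Summable fun n : ℕ => fstC y n • sinC ((n : ℤ) + 2)) ∧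
      ‖∑' n : ℕ, fstC y n • sinC ((n : ℤ) + 2)‖ ≤
        √(∑' n : ℕ, (1 / ((n : ℝ) + 2)) ^ 2) * ‖y‖ := by
  have h2 : (0 : ℝ) < (2 : ENNReal).toReal := by norm_num
  have hy := lp.hasSum_norm h2 y
  simp only [ENNReal.toReal_ofNat, Real.rpow_two] at hy
  have hinj : Function.Injective fun n : ℕ => ((n, 0) : ℕ × Fin 2) := fun _ _ h =>
    (Prod.ext_iff.1 h).1
  have hf : Summable fun n : ℕ => ‖y (n, 0)‖ ^ 2 := hy.summable.comp_injective hinj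
  have hg : Summable fun n : ℕ => (1 / ((n : ℝ) + 2)) ^ 2 := by
    have h3 : Summable fun n : ℕ => 1 / ((n : ℝ)) ^ 2 := Real.summable_one_div_nat_pow.2 one_lt_two
    have h4 := (summable_nat_add_iff 2).2 h3
    refine h4.congr fun n => ?_
    push_cast
    rw [one_div_pow]
  have hH := Real.summable_and_inner_le_Lp_mul_Lq_tsum_of_nonneg Real.HolderConjugate.two_two
    (fun n : ℕ => by positivity : ∀ n : ℕ, 0 ≤ 1 / ((n : ℝ) + 2)) (fun n => norm_nonneg (y (n, 0)))
    (by simpa only [Real.rpow_two] using hg) (by simpa only [Real.rpow_two] using hf)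
  simp only [Real.rpow_two, ← Real.sqrt_eq_rpow] at hH
  have hterm : ∀ n : ℕ, ‖fstC y n • sinC ((n : ℤ) + 2)‖ ≤ 1 / ((n : ℝ) + 2) * ‖y (n, 0)‖ := by
    intro n
    rw [norm_smul, fstC, norm_div, Complex.norm_real, Real.norm_of_nonneg (by positivity)]
    have h1 : (1 : ℝ) ≤ √Real.pi := by
      rw [Real.one_le_sqrt]; linarith [Real.pi_gt_three]
    have h5 : (0 : ℝ) < (n : ℝ) + 2 := by positivity
    calc ‖y (n, 0)‖ / (√Real.pi * ((n : ℝ) + 2)) * ‖sinC ((n : ℤ) + 2)‖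
        ≤ ‖y (n, 0)‖ / (1 * ((n : ℝ) + 2)) * 1 := by
          gcongr
          exact norm_sinC_le _
      _ = _ := by ring
  have hs : Summable fun n : ℕ => ‖fstC y n • sinC ((n : ℤ) + 2)‖ :=
    Summable.of_nonneg_of_le (fun _ => norm_nonneg _) hterm hH.1
  refine ⟨hs.of_norm, (norm_tsum_le_tsum_norm hs).trans ((hs.tsum_le_tsum hterm hH.1).trans
    (hH.2.trans ?_))⟩
  gcongr
  refine Real.sqrt_le_iff.2 ⟨norm_nonneg _, ?_⟩
  rw [← hy.tsum_eq]
  exact tsum_comp_le_tsum_of_inj hy.summable (fun i => by positivity) hinj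

/-- The sine series of the first component, as a continuous function on the circle. -/
def seriesL : Y1 →L[ℂ] CircleAlg :=
  LinearMap.mkContinuous
    { toFun := fun y => ∑' n : ℕ, fstC y n • sinC ((n : ℤ) + 2)
      map_add' := fun u v => by
        rw [← (summable_sine_series u).1.tsum_add (summable_sine_series v).1]
        simp only [fstC_add, add_smul]
      map_smul' := fun a u => by
        simp only [fstC_smul, mul_smul, RingHom.id_apply]
        exact tsum_const_smul'' a }
    (√(∑' n : ℕ, (1 / ((n : ℝ) + 2)) ^ 2))
    fun y => (summable_sine_series y).2

/-- The map `W ↦ wʰ sin x + wᶜ(x)`. -/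
def profileL : E →L[ℂ] CircleAlg :=
  (ContinuousLinearMap.smulRight (ContinuousLinearMap.fst ℂ ℂ ℂ ∘L ContinuousLinearMap.fst ℂ (ℂ × ℂ) Y1)
    (sinC 1)) + seriesL ∘L ContinuousLinearMap.snd ℂ (ℂ × ℂ) Y1

theorem profileL_coe (W : E) (x : ℝ) : profileL W (x : AddCircle (2 * Real.pi)) = profile W x := by
  have h1 : profileL W = W.1.1 • sinC 1 + ∑' n : ℕ, fstC W.2 n • sinC ((n : ℤ) + 2) := rfl
  rw [h1, ContinuousMap.add_apply, ContinuousMap.smul_apply,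
    ← ContinuousMap.tsum_apply (summable_sine_series W.2).1, profile, sinC_coe]
  congr 1
  · simp
  · refine tsum_congr fun n => ?_
    rw [ContinuousMap.smul_apply, sinC_coe, smul_eq_mul]
    push_cast
    rfl

/-- The Fourier coefficients of a continuous function on the circle. -/
def fourierL : CircleAlg →L[ℂ] lp (fun _ : ℤ => ℂ) 2 :=
  (fourierBasis (T := 2 * Real.pi)).repr.toContinuousLinearEquiv.toContinuousLinearMap ∘L
    ContinuousMap.toLp 2 AddCircle.haarAddCircle ℂ

theorem fourierL_apply (g : CircleAlg) (j : ℤ) : fourierL g j = fourierCoeff g j := by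
  have h1 : fourierL g j = (fourierBasis (T := 2 * Real.pi)).repr
    (ContinuousMap.toLp (E := ℂ) 2 AddCircle.haarAddCircle ℂ g) j := rfl
  rw [h1, fourierBasis_repr, fourierCoeff_toLp]

/-- The sine coefficient `π⁻¹ ∫ g sin (j x)` in terms of Fourier coefficients. -/
theorem sine_coeff_eq (g : CircleAlg) (j : ℤ) :
    Complex.I * (fourierL g j - fourierL g (-j)) =
      (1 / (Real.pi : ℂ)) * ∫ x in (-Real.pi)..Real.pi,
        g (x : AddCircle (2 * Real.pi)) * Complex.sin ((j : ℂ) * x) := by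
  have hint : ∀ k : ℤ, fourierL g k = (1 / (2 * Real.pi) : ℝ) • ∫ x in (-Real.pi)..Real.pi,
      fourier (-k) (x : AddCircle (2 * Real.pi)) • g (x : AddCircle (2 * Real.pi)) := by
    intro k
    rw [fourierL_apply, fourierCoeff_eq_intervalIntegral _ _ (-Real.pi)]
    congr 2
    ring
  have hcont : ∀ k : ℤ, IntervalIntegrable (fun x : ℝ =>
      fourier k (x : AddCircle (2 * Real.pi)) • g (x : AddCircle (2 * Real.pi))) volume
      (-Real.pi) Real.pi := by
    intro k
    apply Continuous.intervalIntegrable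
    exact ((fourier k).continuous.comp (AddCircle.continuous_mk' _)).smul
      (g.continuous.comp (AddCircle.continuous_mk' _))
  rw [hint, hint, ← smul_sub, ← intervalIntegral.integral_sub (hcont _) (hcont _), neg_neg]
  have h2 : ∀ x : ℝ, fourier (-j) (x : AddCircle (2 * Real.pi)) • g (x : AddCircle (2 * Real.pi)) -
      fourier j (x : AddCircle (2 * Real.pi)) • g (x : AddCircle (2 * Real.pi)) =
      (-2 * Complex.I) * (g (x : AddCircle (2 * Real.pi)) * Complex.sin ((j : ℂ) * x)) := by
    intro x
    rw [← sinC_coe, sinC, ContinuousMap.smul_apply, ContinuousMap.sub_apply]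
    simp only [smul_eq_mul]
    linear_combination -((fourier j (x : AddCircle (2 * Real.pi)) -
      fourier (-j) (x : AddCircle (2 * Real.pi))) * g (x : AddCircle (2 * Real.pi))) * Complex.I_sq
  simp only [h2]
  rw [intervalIntegral.integral_const_mul, Complex.real_smul]
  push_cast
  have hπ : (Real.pi : ℂ) ≠ 0 := by exact_mod_cast Real.pi_ne_zero
  field_simp
  linear_combination (-∫ x in (-Real.pi)..Real.pi,
        g (x : AddCircle (2 * Real.pi)) * Complex.sin ((j : ℂ) * x)) * Complex.I_sq

end CircleAlgebra

/-! ### Composition with a holomorphic function as an analytic map. -/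

section FunctionalCalculus

/-- A function holomorphic near `0` acts analytically by composition on small elements. -/
theorem exists_analytic_comp {φ : ℂ → ℂ} (hφ : AnalyticAt ℂ φ 0) :
    ∃ (r C : ℝ) (H : CircleAlg → CircleAlg), 0 < r ∧ 0 < C ∧ AnalyticOnNhd ℂ H (ball 0 r) ∧
      (∀ u ∈ ball (0 : CircleAlg) r, ‖H u‖ ≤ C) ∧
      ∀ u ∈ ball (0 : CircleAlg) r, ∀ x, H u x = φ (u x) := by
  obtain ⟨p, r, hp⟩ := hφ
  -- The Taylor series of φ is summed in the Banach algebra. Evaluation at a point is a continuous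
  -- algebra homomorphism, so the sum is pointwise composition with φ.
  set P := FormalMultilinearSeries.ofScalars CircleAlg p.coeff with hP
  have hrad : p.radius ≤ P.radius := by
    refine FormalMultilinearSeries.radius_le_of_le fun n => ?_
    rw [hP, FormalMultilinearSeries.ofScalars_norm]
    rw [FormalMultilinearSeries.norm_apply_eq_norm_coef]
  have hPpos : 0 < P.radius := hp.r_pos.trans_le (hp.r_le.trans hrad)
  have hH := P.hasFPowerSeriesOnBall hPpos
  have heval : ∀ u ∈ eball (0 : CircleAlg) r, ∀ x, P.sum u x = φ (u x) := by
    intro u hu x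
    have h1 : HasSum (fun n => P n (fun _ => u)) (P.sum u) := by
      have := hH.hasSum (y := u) (eball_subset_eball (hp.r_le.trans hrad) hu)
      simpa using this
    have h2 : HasSum (fun n => (P n (fun _ => u)) x) (P.sum u x) :=
      ContinuousMap.hasSum_apply h1 x
    have h3 : u x ∈ eball (0 : ℂ) r := by
      rw [mem_eball_zero_iff] at hu ⊢
      refine lt_of_le_of_lt ?_ hu
      rw [enorm_le_iff_norm_le]
      exact u.norm_coe_le_norm x
    have h4 := hp.hasSum h3
    rw [zero_add] at h4
    refine h2.unique ?_
    convert! h4 using 1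
    funext n
    rw [hP, FormalMultilinearSeries.ofScalars_apply_eq, ContinuousMap.smul_apply,
      ContinuousMap.pow_apply, FormalMultilinearSeries.apply_eq_pow_smul_coeff, smul_eq_mul,
      smul_eq_mul, mul_comm]
  have hcont : ContinuousAt P.sum 0 := hH.analyticAt.continuousAt
  obtain ⟨δ, hδ, hball⟩ := Metric.eventually_nhds_iff_ball.1
    (hcont.norm.eventually (gt_mem_nhds (lt_add_one ‖P.sum 0‖)))
  obtain ⟨s, hs0, hsr⟩ := ENNReal.lt_iff_exists_nnreal_btwn.1 hp.r_pos
  have hs : (0 : ℝ) < s := by exact_mod_cast hs0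
  refine ⟨min δ s, ‖P.sum 0‖ + 1, P.sum, lt_min hδ hs, by positivity, ?_, ?_, ?_⟩
  all_goals
    intro u hu
    have hu1 : u ∈ ball (0 : CircleAlg) δ := ball_subset_ball (min_le_left _ _) hu
    have hu2 : u ∈ eball (0 : CircleAlg) r := by
      have : u ∈ ball (0 : CircleAlg) s := ball_subset_ball (min_le_right _ _) hu
      rw [← eball_coe] at this
      exact eball_subset_eball hsr.le this
  · exact hH.analyticAt_of_mem (eball_subset_eball (hp.r_le.trans hrad) hu2)
  · exact (hball u hu1).le
  · exact heval u hu2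

end FunctionalCalculus

/-! ### The rescaled nonlinearity, uniformly in ε. -/

theorem fstC_sub (u v : Y1) (n : ℕ) : fstC (u - v) n = fstC u n - fstC v n := sub_div _ _ _

theorem sndC_sub (u v : Y1) (n : ℕ) : sndC (u - v) n = sndC u n - sndC v n := sub_div _ _ _

/-- Oddness kills the even derivatives and f'(0) = 0 the first, so f vanishes to order at least
three. Then ε⁻³ f(εu) = u³ φ(εu) stays bounded as ε → 0. -/
theorem HypH.exists_cubic {f : ℂ → ℂ} (hf : HypH f) :
    ∃ φ : ℂ → ℂ, AnalyticAt ℂ φ 0 ∧ ∀ᶠ z in 𝓝 (0 : ℂ), f z = z ^ 3 * φ z := by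
  have hodd : (fun z => f (-z)) =ᶠ[𝓝 0] fun z => -f z := hf.odd
  have heven : ∀ n : ℕ, Even n → iteratedDeriv n f 0 = 0 := by
    intro n hn
    have h1 := hodd.iteratedDeriv_eq n
    have h2 := iteratedDeriv_comp_neg n f 0
    rw [h1, iteratedDeriv_fun_neg, hn.neg_one_pow, one_smul, neg_zero] at h2
    exact self_eq_neg.1 h2.symm
  have hord : ((3 : ℕ) : ℕ∞) ≤ analyticOrderAt f 0 := by
    rw [natCast_le_analyticOrderAt_iff_iteratedDeriv_eq_zero hf.holomorphic]
    intro i hi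
    interval_cases i
    · exact heven 0 (by decide)
    · rw [iteratedDeriv_one]; exact hf.deriv_zero
    · exact heven 2 (by decide)
  obtain ⟨φ, hφ, h⟩ := (natCast_le_analyticOrderAt hf.holomorphic).1 hord
  exact ⟨φ, hφ, by simpa using h⟩

/-- The `j`-th sine coefficient of a continuous function on the circle. -/
def coefL (j : ℤ) : CircleAlg →L[ℂ] ℂ :=
  Complex.I • ((lp.evalCLM ℂ (fun _ : ℤ => ℂ) 2 j - lp.evalCLM ℂ (fun _ : ℤ => ℂ) 2 (-j)) ∘L
    fourierL)

theorem coefL_apply (j : ℤ) (g : CircleAlg) :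
    coefL j g = Complex.I * (fourierL g j - fourierL g (-j)) := by
  simp [coefL, lp.evalCLM]

/-- The frequency `n + 2` for the second and `-(n + 2)` for the first component. -/
def freqIdx (i : ℕ × Fin 2) : ℤ := if i.2 = 0 then -((i.1 : ℤ) + 2) else (i.1 : ℤ) + 2

/-- `weightOp` requires an injective index map. The first component has weight zero in `invWeight`;
its negative frequencies serve only to keep the indices distinct. -/
theorem freqIdx_injective : Function.Injective freqIdx := by
  rintro ⟨n, i⟩ ⟨m, j⟩ h
  simp only [freqIdx] at h
  fin_cases i <;> fin_cases j <;> simp at h ⊢ <;> omega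

/-- The weight of the `n`-th coefficient of `L⁻¹ g`. -/
def invWeight (i : ℕ × Fin 2) : ℂ :=
  if i.2 = 0 then 0 else
    Complex.I * (((√Real.pi * ((i.1 : ℝ) + 2) : ℝ) : ℂ) * (symL i.1 : ℂ)⁻¹)

/-- L⁻¹ gains exactly the derivative in the norm of `Y1`: (n+2)/√((n+2)² − 1) ≤ 2 and √π ≤ 2. Thus
L⁻¹ P_c needs only square-summable Fourier coefficients, and the nonlinearity can be treated in C⁰.
-/
theorem norm_invWeight_le (i : ℕ × Fin 2) : ‖invWeight i‖ ≤ 4 := by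
  rw [invWeight]
  split_ifs
  · simp
  · have h1 := one_le_symL i.1
    have h0 : (0 : ℝ) ≤ i.1 := i.1.cast_nonneg
    have h2 : √Real.pi ≤ 2 := by
      rw [Real.sqrt_le_left (by norm_num)]
      linarith [Real.pi_le_four]
    have h3 : (i.1 : ℝ) + 2 ≤ 2 * symL i.1 := by
      have : ((i.1 : ℝ) + 2) / 2 ≤ symL i.1 := by
        rw [symL]
        apply Real.le_sqrt_of_sq_le
        nlinarith
      linarith
    rw [norm_mul, Complex.norm_I, one_mul, norm_mul, norm_inv, Complex.norm_real, Complex.norm_real,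
      Real.norm_of_nonneg (by positivity), Real.norm_of_nonneg (by linarith),
      ← div_eq_mul_inv, div_le_iff₀ (by linarith)]
    calc √Real.pi * ((i.1 : ℝ) + 2) ≤ 2 * (2 * symL i.1) := by gcongr
      _ = 4 * symL i.1 := by ring

/-- The map `g ↦ (0, L⁻¹ P_c g)`. -/
def invPcL : CircleAlg →L[ℂ] Y1 :=
  (weightOp freqIdx freqIdx_injective invWeight 4 norm_invWeight_le -
    weightOp (fun i => -freqIdx i) (neg_injective.comp freqIdx_injective) invWeight 4
      norm_invWeight_le) ∘L fourierL

theorem invPcL_eq (g : CircleAlg) (i : ℕ × Fin 2) :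
    invPcL g i = invWeight i * (fourierL g (freqIdx i) - fourierL g (-freqIdx i)) := by
  rw [mul_sub]
  rfl

theorem fstC_invPcL (g : CircleAlg) (n : ℕ) : fstC (invPcL g) n = 0 := by
  simp [fstC, invPcL_eq, invWeight]

theorem sndC_invPcL (g : CircleAlg) (n : ℕ) :
    sndC (invPcL g) n = coefL ((n : ℤ) + 2) g * (symL n : ℂ)⁻¹ := by
  have h := weight_ne n
  rw [sndC, invPcL_eq, coefL_apply, div_eq_iff h]
  simp only [invWeight, freqIdx, one_ne_zero, if_false]
  ring

/-- The map `(u, v) ↦ (0, L⁻¹ u)`. -/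
def invFstL : Y1 →L[ℂ] Y1 :=
  weightOp swapIdx swapIdx_injective (fun i => if i.2 = 0 then 0 else (symL i.1 : ℂ)⁻¹) 1 (by
    intro i
    split_ifs
    · simp
    · exact norm_inv_symL_le _)

theorem fstC_invFstL (y : Y1) (n : ℕ) : fstC (invFstL y) n = 0 := by
  simp [fstC, invFstL]

theorem sndC_invFstL (y : Y1) (n : ℕ) : sndC (invFstL y) n = fstC y n * (symL n : ℂ)⁻¹ := by
  simp [sndC, fstC, invFstL, swapIdx]
  ring

theorem sineCoeff_eq {f : ℂ → ℂ} {ε : ℝ} {W : E} {g : CircleAlg}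
    (hg : ∀ x : ℝ, f ((ε : ℂ) * profile W x) =
      (ε : ℂ) ^ 3 * g (x : AddCircle (2 * Real.pi))) (j : ℕ) :
    sineCoeff f ε W j = (ε : ℂ) ^ 3 * coefL j g := by
  rw [sineCoeff, coefL_apply, sine_coeff_eq]
  simp only [hg, mul_assoc]
  rw [intervalIntegral.integral_const_mul]
  push_cast
  ring

/-- The nonlinearity `ε⁻³ f (ε wʰ sin x + ε wᶜ)` as an analytic map with bounds uniform in `ε`. -/
theorem HypH.exists_nonlinearity {f : ℂ → ℂ} (hf : HypH f) (R : ℝ) (hR : 0 < R) :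
    ∃ C ε₁ : ℝ, 0 < C ∧ 0 < ε₁ ∧ ∀ ε : ℝ, 0 < ε → ε < ε₁ → ∃ Φ : E → CircleAlg,
      AnalyticOnNhd ℂ Φ (ball 0 R) ∧ (∀ W ∈ ball (0 : E) R, ‖Φ W‖ ≤ C) ∧
      ∀ W ∈ ball (0 : E) R, ∀ x : ℝ, f ((ε : ℂ) * profile W x) =
        (ε : ℂ) ^ 3 * Φ W (x : AddCircle (2 * Real.pi)) := by
  obtain ⟨φ, hφ, hfφ⟩ := hf.exists_cubic
  obtain ⟨r, C, H, hr, hC, hH, hHC, hHφ⟩ := exists_analytic_comp hφ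
  obtain ⟨r', hr', hfr⟩ := Metric.eventually_nhds_iff_ball.1 hfφ
  set P : ℝ := ‖profileL‖ * R + 1 with hP
  have hP0 : 0 < P := by positivity
  have hu : ∀ W ∈ ball (0 : E) R, ‖profileL W‖ ≤ P := by
    intro W hW
    have h1 := profileL.le_opNorm W
    have h2 : ‖profileL‖ * ‖W‖ ≤ ‖profileL‖ * R := by
      gcongr
      exact (mem_ball_zero_iff.1 hW).le
    linarith
  refine ⟨P ^ 3 * C, min r r' / P, by positivity, by positivity, fun ε hε hε₁ => ?_⟩
  rw [lt_div_iff₀ hP0, lt_min_iff] at hε₁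
  have hεu : ∀ W ∈ ball (0 : E) R, ‖(ε : ℂ) • profileL W‖ ≤ ε * P := by
    intro W hW
    rw [norm_smul, Complex.norm_real, Real.norm_of_nonneg hε.le]
    exact mul_le_mul_of_nonneg_left (hu W hW) hε.le
  have hmem : ∀ W ∈ ball (0 : E) R, (ε : ℂ) • profileL W ∈ ball (0 : CircleAlg) r := fun W hW =>
    mem_ball_zero_iff.2 ((hεu W hW).trans_lt hε₁.1)
  refine ⟨fun W => profileL W ^ 3 * H ((ε : ℂ) • profileL W), fun W hW => ?_, fun W hW => ?_,
    fun W hW x => ?_⟩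
  · have h1 : AnalyticAt ℂ (fun W : E => (ε : ℂ) • profileL W) W :=
      ((ε : ℂ) • profileL).analyticAt W
    have h2 : AnalyticAt ℂ (fun W : E => H ((ε : ℂ) • profileL W)) W :=
      AnalyticAt.fun_comp (g := H) (hH _ (hmem W hW)) h1
    exact ((profileL.analyticAt W).pow 3).mul h2
  · refine (norm_mul_le _ _).trans (mul_le_mul ((norm_pow_le _ 3).trans ?_) (hHC _ (hmem W hW))
      (norm_nonneg _) (by positivity))
    exact pow_le_pow_left₀ (norm_nonneg _) (hu W hW) 3
  · have h1 : ((ε : ℂ) * profile W x) ∈ ball (0 : ℂ) r' := by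
      rw [mem_ball_zero_iff]
      have h2 := ((ε : ℂ) • profileL W).norm_coe_le_norm (x : AddCircle (2 * Real.pi))
      rw [ContinuousMap.smul_apply, profileL_coe, smul_eq_mul] at h2
      exact (h2.trans (hεu W hW)).trans_lt hε₁.2
    rw [hfr _ h1, ContinuousMap.mul_apply, ContinuousMap.pow_apply, hHφ _ (hmem W hW),
      ContinuousMap.smul_apply, profileL_coe, smul_eq_mul]
    ring

/-- The rescaled Klein-Gordon system as a stage-one system, with bounds uniform in `ε`. -/
theorem HypH.exists_initial {f : ℂ → ℂ} (hf : HypH f) (R : ℝ) (hR : 0 < R) :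
    ∃ C₀ B₀ ε₁ : ℝ, 0 < C₀ ∧ 0 ≤ B₀ ∧ 0 < ε₁ ∧ ∀ ε : ℝ, 0 < ε → ε < ε₁ →
      ∃ S : ScaledSys Y1, (∀ Z, S.G Z = 0) ∧
        AnalyticOnNhd ℂ S.F (ball 0 R) ∧ AnalyticOnNhd ℂ S.w (ball 0 R) ∧
        (∀ Z ∈ ball (0 : E) R, ‖S.F Z‖ ≤ B₀) ∧ (∀ Z ∈ ball (0 : E) R, ‖S.w Z‖ ≤ C₀ * ε) ∧
        IsKGSystem f ε (ball 0 R) (S.toSys ε 1) := by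
  obtain ⟨C, ε₁, hC, hε₁, hΦ⟩ := hf.exists_nonlinearity R hR
  refine ⟨2 * (‖invFstL‖ * R + ‖invPcL‖ * C) + 1, R + 2 * (‖coefL 1‖ * C), min ε₁ (1 / 2),
    by positivity, by positivity, by positivity, fun ε hε hεlt => ?_⟩
  rw [lt_min_iff] at hεlt
  obtain ⟨Φ, hΦan, hΦC, hΦf⟩ := hΦ ε hε hεlt.1
  have hε' : (ε : ℂ) ≠ 0 := by exact_mod_cast hε.ne'
  -- The restriction ε < 1/2 is there to bound both prefactors 1/√(1 − ε²) and 1/(1 − ε²) by 2.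
  have hsq : (1 : ℝ) / 2 ≤ 1 - ε ^ 2 := by nlinarith [hεlt.2]
  have hs0 : (0 : ℝ) < √(1 - ε ^ 2) := Real.sqrt_pos.2 (by linarith)
  have hs1 : √(1 - ε ^ 2) ≤ 1 := Real.sqrt_le_one.2 (by nlinarith)
  have hs2 : (1 : ℝ) / 2 ≤ √(1 - ε ^ 2) := Real.le_sqrt_of_sq_le (by linarith)
  set s : ℝ := 1 / √(1 - ε ^ 2) with hs
  have hsge : 1 ≤ s := by rw [hs, le_div_iff₀ hs0]; linarith
  have hsle : s ≤ 2 := by rw [hs, div_le_iff₀ hs0]; linarith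
  set q : ℝ := 1 / (1 - ε ^ 2) with hq
  have hq0 : 0 ≤ q := by rw [hq]; apply div_nonneg <;> linarith
  have hq2 : q ≤ 2 := by rw [hq, div_le_iff₀ (by linarith)]; linarith
  have hns : ‖((s - 1 : ℝ) : ℂ)‖ ≤ 1 := by
    rw [Complex.norm_real, Real.norm_of_nonneg (by linarith)]; linarith
  set S : ScaledSys Y1 :=
    { F := fun W => (((s - 1 : ℝ) : ℂ) * W.1.2,
        ((s - 1 : ℝ) : ℂ) * W.1.1 - (s : ℂ) * coefL 1 (Φ W))
      G := fun _ => 0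
      w := fun W => ((ε * q : ℝ) : ℂ) • (invFstL W.2 - invPcL (Φ W)) } with hS
  refine ⟨S, fun _ => rfl, fun W hW => ?_, fun W hW => ?_, fun W hW => ?_, fun W hW => ?_, ?_⟩
  · have h1 : AnalyticAt ℂ (fun W : E => coefL 1 (Φ W)) W :=
      ((coefL 1).analyticAt _).fun_comp (hΦan W hW)
    have h11 : AnalyticAt ℂ (fun W : E => W.1.1) W := analyticAt_fst.fun_comp analyticAt_fst
    have h12 : AnalyticAt ℂ (fun W : E => W.1.2) W := analyticAt_snd.fun_comp analyticAt_fst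
    exact (analyticAt_const.mul h12).prod ((analyticAt_const.mul h11).sub (analyticAt_const.mul h1))
  · have h1 : AnalyticAt ℂ (fun W : E => invPcL (Φ W)) W :=
      (invPcL.analyticAt _).fun_comp (hΦan W hW)
    have h2 : AnalyticAt ℂ (fun W : E => invFstL W.2) W :=
      (invFstL.analyticAt _).fun_comp analyticAt_snd
    exact (analyticAt_const (v := ((ε * q : ℝ) : ℂ))).smul (h2.sub h1)
  · have hWR := (mem_ball_zero_iff.1 hW).le
    have h11 : ‖W.1.1‖ ≤ R := ((norm_fst_le W.1).trans (norm_fst_le W)).trans hWR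
    have h12 : ‖W.1.2‖ ≤ R := ((norm_snd_le W.1).trans (norm_fst_le W)).trans hWR
    have hc : ‖coefL 1 (Φ W)‖ ≤ ‖coefL 1‖ * C :=
      (ContinuousLinearMap.le_opNorm _ _).trans
        (mul_le_mul_of_nonneg_left (hΦC W hW) (norm_nonneg _))
    have hc0 : 0 ≤ ‖coefL 1‖ * C := by positivity
    have hmul : ∀ a : ℂ, ‖a‖ ≤ R → ‖((s - 1 : ℝ) : ℂ) * a‖ ≤ R := fun a ha => by
      rw [norm_mul]
      nlinarith [norm_nonneg a, norm_nonneg ((s - 1 : ℝ) : ℂ)]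
    refine max_le ((hmul _ h12).trans (by linarith)) ((norm_sub_le _ _).trans
      (add_le_add (hmul _ h11) ?_))
    rw [norm_mul, Complex.norm_real, Real.norm_of_nonneg (by linarith)]
    exact mul_le_mul hsle hc (norm_nonneg _) zero_le_two
  · have h1 : ‖invFstL W.2‖ ≤ ‖invFstL‖ * R := (ContinuousLinearMap.le_opNorm _ _).trans
      (mul_le_mul_of_nonneg_left ((norm_snd_le W).trans (mem_ball_zero_iff.1 hW).le)
        (norm_nonneg _))
    have h2 : ‖invPcL (Φ W)‖ ≤ ‖invPcL‖ * C := (ContinuousLinearMap.le_opNorm _ _).trans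
      (mul_le_mul_of_nonneg_left (hΦC W hW) (norm_nonneg _))
    have h3 := norm_sub_le (invFstL W.2) (invPcL (Φ W))
    have h4 : ‖S.w W‖ = ε * q * ‖invFstL W.2 - invPcL (Φ W)‖ := by
      rw [hS, norm_smul, Complex.norm_real, Real.norm_of_nonneg (by positivity)]
    rw [h4]
    calc ε * q * ‖invFstL W.2 - invPcL (Φ W)‖
        ≤ ε * 2 * (‖invFstL‖ * R + ‖invPcL‖ * C) := by gcongr; linarith
      _ ≤ _ := by nlinarith
  · intro W hW
    have hco := fun j => sineCoeff_eq (hΦf W hW) j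
    refine ⟨?_, ?_, fun n => ?_, fun n => ?_⟩
    · rw [hco, Nat.cast_one]
      refine Prod.ext rfl ?_
      change _ * _ - (s : ℂ) * coefL 1 (Φ W) = _
      congr 1
      rw [← mul_assoc]
      congr 1
      rw [hs]
      have hs' : ((√(1 - ε ^ 2) : ℝ) : ℂ) ≠ 0 := by exact_mod_cast hs0.ne'
      push_cast
      field_simp
    · exact smul_zero _
    · simp only [ScaledSys.toSys, hS, fstC_smul, fstC_sub, fstC_invFstL, fstC_invPcL, sub_zero,
        mul_zero]
    · simp only [hco, linv_eq, ScaledSys.toSys, hS, sndC_smul, sndC_sub, sndC_invFstL, sndC_invPcL]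
      have h3 := symL_ne n
      have hqc : (q : ℂ) = 1 / (1 - (ε : ℂ) ^ 2) := by rw [hq]; push_cast; rfl
      push_cast
      field_simp
      rw [hqc]
      ring

/-! ### One step in terms of sup bounds alone. -/

/-- Analyticity and bounds for a rescaled system on the ball of radius `r`. -/
structure ScaledSys.Bounds (S : ScaledSys Y1) (r b g N : ℝ) : Prop where
  F_an : AnalyticOnNhd ℂ S.F (ball 0 r)
  G_an : AnalyticOnNhd ℂ S.G (ball 0 r)
  w_an : AnalyticOnNhd ℂ S.w (ball 0 r)
  F_le : ∀ Z ∈ ball (0 : E) r, ‖S.F Z‖ ≤ b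
  G_le : ∀ Z ∈ ball (0 : E) r, ‖S.G Z‖ ≤ g
  w_le : ∀ Z ∈ ball (0 : E) r, ‖S.w Z‖ ≤ N

namespace ScaledSys.Bounds

variable {S : ScaledSys Y1} {r b g N : ℝ}

theorem fderiv_w_le (h : S.Bounds r b g N) {δ : ℝ} (hδ : 0 < δ) :
    ∀ Z ∈ ball (0 : E) (r - δ), ‖fderiv ℂ S.w Z‖ ≤ N / δ :=
  norm_fderiv_le_of_ball_zero hδ (fun z hz => (h.w_an z hz).differentiableAt) h.w_le

theorem fderiv_fderiv_w_le (h : S.Bounds r b g N) {δ : ℝ} (hδ : 0 < δ) :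
    ∀ Z ∈ ball (0 : E) (r - δ - δ), ‖fderiv ℂ (fderiv ℂ S.w) Z‖ ≤ N / δ / δ :=
  norm_fderiv_le_of_ball_zero hδ
    (fun z hz => (h.w_an z (ball_subset_ball (by linarith) hz)).fderiv.differentiableAt)
    (h.fderiv_w_le hδ)

theorem fderiv_G_le (h : S.Bounds r b g N) {δ : ℝ} (hδ : 0 < δ) :
    ∀ Z ∈ ball (0 : E) (r - δ), ‖fderiv ℂ S.G Z‖ ≤ g / δ :=
  norm_fderiv_le_of_ball_zero hδ (fun z hz => (h.G_an z hz).differentiableAt) h.G_le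

/-- Bounded analytic data satisfy the hypotheses of a normal form step, by the Cauchy
estimates. -/
theorem stepHyp (h : S.Bounds r b g N) {ε Λ R B η : ℝ} (hΛ : kgData.BoundedBy Λ) (hε : 0 < ε)
    (hε1 : ε ≤ 1) (hR : 1 ≤ R) (hr : r ≤ R) (hB : 0 ≤ B) (hb : b ≤ B) (hg : g ≤ 1) (hN : 0 ≤ N)
    (hN1 : N ≤ 1) (hn : 4 * N ≤ η) (hη : 4 * ε ≤ η) (hd : 4 * Λ * R * ε ≤ 1 / 2)
    (hdisp : 2 * Λ * R * (ε * N) ≤ η / 8) :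
    StepHyp kgData S ε Λ R B N (4 * N / η) η r := by
  have hη0 : 0 < η := by linarith
  have hη4 : 0 < η / 4 := by positivity
  have hn0 : 0 ≤ 4 * N / η := by positivity
  have hn1 : 4 * N / η ≤ 1 := by rwa [div_le_one hη0]
  have hq : N / (η / 4) = 4 * N / η := by field_simp
  have hΛ0 : 0 ≤ Λ := zero_le_one.trans hΛ.one_le
  exact
    { pair := hΛ
      eps_pos := hε
      eps_le := hε1
      one_le_R := hR
      ρ_le := hr
      B_nonneg := hB
      N_nonneg := hN
      N_le := hN1
      n_nonneg := hn0
      n_le := hn1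
      -- The derivative bound is n = 4N/η, so 4ε ≤ η says that ε times one Cauchy differentiation
      -- costs nothing. The same inequality gives `ddw_le`.
      eps_n_le := by
        rw [mul_div_assoc', div_le_iff₀ hη0]
        nlinarith
      η_pos := hη0
      F_an := h.F_an
      G_an := h.G_an
      w_an := h.w_an
      F_le := fun Z hZ => (h.F_le Z hZ).trans hb
      G_le := fun Z hZ => (h.G_le Z hZ).trans hg
      w_le := h.w_le
      dG_le := fun Z hZ => (h.fderiv_G_le hη4 Z hZ).trans (by
        rw [div_div_eq_mul_div]
        gcongr
        linarith)
      dw_le := fun Z hZ => (h.fderiv_w_le hη4 Z hZ).trans hq.le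
      ddw_le := fun Z hZ => by
        have h1 := h.fderiv_fderiv_w_le hη4 Z (ball_subset_ball (by linarith) hZ)
        rw [hq] at h1
        calc ε * ‖fderiv ℂ (fderiv ℂ S.w) Z‖ ≤ ε * (4 * N / η / (η / 4)) := by gcongr
          _ = (4 * N / η) * (4 * ε / η) := by field_simp
          _ ≤ (4 * N / η) * 1 := by
              gcongr
              rwa [div_le_one hη0]
          _ = 4 * N / η := mul_one _
      small_deriv := by
        calc 4 * Λ * R * (ε * (4 * N / η)) = (4 * Λ * R * ε) * (4 * N / η) := by ring
          _ ≤ (1 / 2) * 1 := by gcongr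
          _ = 1 / 2 := mul_one _
      small_disp := hdisp }

/-- One normal form step with its effect on the bounds. -/
theorem exists_next (h : S.Bounds r b g N) {ε Λ R B η θ K K₁ : ℝ} {k : ℕ}
    (hΛ : kgData.BoundedBy Λ) (hε : 0 < ε)
    (hε1 : ε ≤ 1) (hR : 1 ≤ R) (hr : r ≤ R) (hB : 0 ≤ B) (hb : b ≤ B) (hg : g ≤ 1) (hN : 0 ≤ N)
    (hN1 : N ≤ 1) (hn : 4 * N ≤ η) (hη : 4 * ε ≤ η) (hd : 4 * Λ * R * ε ≤ 1 / 2)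
    (hdisp : 2 * Λ * R * (ε * N) ≤ η / 8)
    (hθ : 16 * Λ * R ^ 2 * ε / η + 4 * Λ * R * ε + 20 * Λ * (R + B) * ε / η ≤ θ)
    (hrad : radius K K₁ ε k ≤ r - η) (hK₁ : 0 < K₁)
    (hsmall : 24 * Λ * R * (ε * N) ≤ K₁ * ε / 2) :
    ∃ (S' : ScaledSys Y1) (Θ : OpenPartialHomeomorph E E),
      S'.Bounds (r - η) (b + 23 * Λ * R * (R + B) * N) (g + 4 * N / η) (θ * N) ∧
      IsNormalFormStep K K₁ ε k (S.toSys ε k) (S'.toSys ε (k + 1)) Θ := by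
  have hs := h.stepHyp hΛ hε hε1 hR hr hB hb hg hN hN1 hn hη hd hdisp
  obtain ⟨S', Θ, hΘ, hF, hG, hw, hM⟩ := hs.exists_next hrad hK₁ hsmall
  refine ⟨S', Θ, ⟨hF, hG, hw, fun Z hZ => ?_, fun Z hZ => ?_, fun Z hZ => ?_⟩, hΘ⟩ <;>
    obtain ⟨M, hMmem, h1, h2, h3⟩ := hM Z hZ
  · rw [h1]
    exact hs.nextSys_F_le h.F_le hMmem
  · rw [h2]
    exact hs.nextSys_G_le h.G_le hMmem
  · rw [h3]
    refine (hs.nextSys_w_le hMmem).trans ?_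
    calc 16 * Λ * R ^ 2 * (ε * N) / η + 4 * Λ * R * (ε * N) + 5 * Λ * (R + B) * (ε * (4 * N / η))
        = (16 * Λ * R ^ 2 * ε / η + 4 * Λ * R * ε + 20 * Λ * (R + B) * ε / η) * N := by ring
      _ ≤ θ * N := by gcongr

/-- Two Cauchy estimates with unit loss of radius bound w, Dw and D²w all by N; each suffers a
factor 2 in passing to `cnorm`. -/
theorem c2BoundedBy (h : S.Bounds r b g N) (hN : 0 ≤ N) {Ω : Set E}
    (hΩ : Ω ⊆ ball 0 (r - 2)) {a : ℝ} (ha : 6 * N ≤ a) : C2BoundedBy S.w Ω a := by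
  have hN2 : 0 ≤ 2 * N := by positivity
  refine ⟨2 * N, 2 * N, 2 * N, hN2, hN2, hN2, by linarith, fun Z hZ => ⟨?_, fun U => ?_,
    fun U V => ?_⟩⟩
  · have h1 := h.w_le Z (ball_subset_ball (by linarith) (hΩ hZ))
    linarith [cnorm_le (S.w Z)]
  · have h1 := h.fderiv_w_le one_pos Z (ball_subset_ball (by linarith) (hΩ hZ))
    rw [div_one] at h1
    calc cnorm (fderiv ℂ S.w Z U) ≤ 2 * ‖fderiv ℂ S.w Z U‖ := cnorm_le _
      _ ≤ 2 * (N * znorm U) := by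
          gcongr
          exact ContinuousLinearMap.le_of_opNorm_le_of_le _ h1 (norm_le_znorm U)
      _ = 2 * N * znorm U := by ring
  · have h1 := h.fderiv_fderiv_w_le one_pos Z (ball_subset_ball (by linarith) (hΩ hZ))
    rw [div_one, div_one] at h1
    have h2 := ContinuousLinearMap.le_of_opNorm_le_of_le _ h1 (norm_le_znorm U)
    calc cnorm (fderiv ℂ (fderiv ℂ S.w) Z U V) ≤ 2 * ‖fderiv ℂ (fderiv ℂ S.w) Z U V‖ := cnorm_le _
      _ ≤ 2 * (N * znorm U * znorm V) := by
          gcongr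
          exact ContinuousLinearMap.le_of_opNorm_le_of_le _ h2 (norm_le_znorm V)
      _ = 2 * N * znorm U * znorm V := by ring

theorem opBoundedBy (h : S.Bounds r b g N) {Ω : Set E} (hΩ : Ω ⊆ ball 0 r) {a : ℝ}
    (ha : 2 * g ≤ a) : OpBoundedBy S.G Ω a := by
  intro Z hZ v
  calc cnorm (S.G Z v) ≤ 2 * ‖S.G Z v‖ := cnorm_le _
    _ ≤ 2 * (g * cnorm v) := by
        gcongr
        exact ContinuousLinearMap.le_of_opNorm_le_of_le _ (h.G_le Z (hΩ hZ)) (norm_le_cnorm v)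
    _ = 2 * g * cnorm v := by ring
    _ ≤ a * cnorm v := mul_le_mul_of_nonneg_right ha (cnorm_nonneg v)

end ScaledSys.Bounds

/-! ### Iteration of the step and choice of constants. -/

theorem exists_seq_of_step {α β : Type*} [Nonempty β] (P : ℕ → α → Prop)
    (Q : ℕ → α → α → β → Prop) (M : ℕ) {a₀ : α} (h₀ : P 0 a₀)
    (hstep : ∀ k < M, ∀ a, P k a → ∃ a' b, P (k + 1) a' ∧ Q k a a' b) :
    ∃ (s : ℕ → α) (t : ℕ → β), s 0 = a₀ ∧ (∀ k ≤ M, P k (s k)) ∧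
      ∀ k < M, Q k (s k) (s (k + 1)) (t k) := by
  have hex : ∀ k a, ∃ p : α × β, k < M → P k a → P (k + 1) p.1 ∧ Q k a p.1 p.2 := by
    intro k a
    by_cases h : k < M ∧ P k a
    · obtain ⟨a', b, h'⟩ := hstep k h.1 a h.2
      exact ⟨(a', b), fun _ _ => h'⟩
    · exact ⟨(a, Classical.arbitrary β), fun h1 h2 => absurd ⟨h1, h2⟩ h⟩
  choose p hp using hex
  set s : ℕ → α := fun n => Nat.rec a₀ (fun k a => (p k a).1) n with hs
  have hP : ∀ k ≤ M, P k (s k) := by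
    intro k
    induction k with
    | zero => exact fun _ => h₀
    | succ k ih => exact fun hk => (hp k (s k) hk (ih (by omega))).1
  exact ⟨s, fun k => (p k (s k)).2, rfl, hP, fun k hk => (hp k (s k) hk (hP k hk.le)).2⟩

theorem one_le_bigK (f : ℂ → ℂ) : 1 ≤ bigK f :=
  le_add_of_nonneg_left (Real.iSup_nonneg fun _ => norm_nonneg _)

/-- Rounding down costs at most one factor 2. Since log √2 = (log 2)/2, only half of the available
rate is used. -/
theorem inv_two_pow_floor_le {c ε : ℝ} (hc : 0 < c) (hε : 0 < ε) :
    1 / 2 ^ ⌊c / ε⌋₊ ≤ 2 * Real.exp (-(c * Real.log (√2)) / ε) := by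
  have h1 : c / ε < ⌊c / ε⌋₊ + 1 := Nat.lt_floor_add_one _
  have hl : 0 < Real.log 2 := Real.log_pos one_lt_two
  have h2 : (2 : ℝ) ^ ⌊c / ε⌋₊ = Real.exp (⌊c / ε⌋₊ * Real.log 2) := by
    rw [Real.exp_nat_mul, Real.exp_log two_pos]
  have h3 : 2 * Real.exp (-(c * Real.log (√2)) / ε) =
      Real.exp (Real.log 2 + -(c * Real.log (√2)) / ε) := by
    rw [Real.exp_add, Real.exp_log two_pos]
  rw [h3, h2, one_div, ← Real.exp_neg, Real.exp_le_exp, Real.log_sqrt zero_le_two]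
  have h4 : -(c * (Real.log 2 / 2)) / ε = -(c / ε * (Real.log 2 / 2)) := by ring
  have h5 : 0 < c / ε := by positivity
  rw [h4]
  nlinarith

theorem pow_le_half_pow {θ : ℝ} (h0 : 0 ≤ θ) (h : θ ≤ 1 / 2) (k : ℕ) : θ ^ k ≤ 1 / 2 ^ k := by
  rw [← one_div_pow]
  exact pow_le_pow_left₀ h0 h k

/-- The normal form steps as long as the total loss of radius is at most one, with geometrically
decreasing remainders. -/
theorem exists_normalFormSequence {Λ R B₀ C₀ θ K₂ K K₁ ε : ℝ} {M : ℕ} {S₀ : ScaledSys Y1}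
    (hΛ : kgData.BoundedBy Λ) (hK : 0 ≤ K) (hRK : R = 2 * K + 4) (hB₀ : 0 ≤ B₀) (hC₀ : 0 < C₀)
    (hθ0 : 0 < θ) (hθ : θ ≤ 1 / 2) (hK₁ : 0 < K₁) (hK₂ : 4 ≤ K₂) (hK₂C : 32 * C₀ ≤ K₂)
    (hK₂θ : (16 * Λ * R ^ 2 + 20 * Λ * (R + (B₀ + 1))) / K₂ ≤ θ / 2)
    (hε : 0 < ε) (hε1 : ε ≤ 1) (hεC : C₀ * ε ≤ 1) (hεR : 8 * Λ * R * ε ≤ θ)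
    (hεd : 16 * Λ * R * C₀ * ε ≤ 1) (hεK₁ : 48 * Λ * R * C₀ * ε ≤ K₁)
    (hεF : 46 * Λ * R * (R + (B₀ + 1)) * C₀ * ε ≤ 1) (hM : ((M : ℝ) + 1) * (K₂ * ε) ≤ 1)
    (hS₀ : S₀.Bounds R B₀ 0 (C₀ * ε)) :
    ∃ (s : ℕ → ScaledSys Y1) (t : ℕ → OpenPartialHomeomorph E E), s 0 = S₀ ∧
      (∀ k ≤ M, (s k).Bounds (R - k * (K₂ * ε)) (B₀ + (1 - 1 / 2 ^ k)) ((1 - 1 / 2 ^ k) / 4)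
        (C₀ * ε * θ ^ k)) ∧
      ∀ k < M, IsNormalFormStep K K₁ ε (k + 1) ((s k).toSys ε (k + 1))
        ((s (k + 1)).toSys ε (k + 1 + 1)) (t k) := by
  have hη0 : 0 < K₂ * ε := by positivity
  have hR1 : 1 ≤ R := by linarith
  have hΛ0 : 0 ≤ Λ := zero_le_one.trans hΛ.one_le
  have : Nonempty (OpenPartialHomeomorph E E) := ⟨OpenPartialHomeomorph.refl E⟩
  refine exists_seq_of_step (fun k (S : ScaledSys Y1) => S.Bounds (R - k * (K₂ * ε))
    (B₀ + (1 - 1 / 2 ^ k)) ((1 - 1 / 2 ^ k) / 4) (C₀ * ε * θ ^ k))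
    (fun k (S S' : ScaledSys Y1) Θ => IsNormalFormStep K K₁ ε (k + 1) (S.toSys ε (k + 1)) (S'.toSys ε (k + 1 + 1)) Θ) M (by simpa using hS₀) ?_
  intro k hk S hS
  have hk' : (k : ℝ) + 1 ≤ M := by exact_mod_cast hk
  have hp0 : (0 : ℝ) < 1 / 2 ^ k := by positivity
  have hp1 : (1 : ℝ) / 2 ^ k ≤ 1 := by
    rw [div_le_one (by positivity)]
    exact one_le_pow₀ one_le_two
  have hps : (1 : ℝ) / 2 ^ (k + 1) = 1 / 2 ^ k / 2 := by rw [pow_succ]; field_simp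
  have hθk := pow_le_half_pow hθ0.le hθ k
  have hθk0 : 0 < θ ^ k := by positivity
  have hCε : 0 < C₀ * ε := by positivity
  have hN : C₀ * ε * θ ^ k ≤ C₀ * ε := mul_le_of_le_one_right hCε.le (hθk.trans hp1)
  have hNp : C₀ * ε * θ ^ k ≤ C₀ * ε * (1 / 2 ^ k) := by gcongr
  have hΛR : 0 ≤ Λ * R := by positivity
  have hQ : 0 ≤ R + (B₀ + 1) := by linarith
  have hdisp : 2 * Λ * R * (ε * (C₀ * ε * θ ^ k)) ≤ K₂ * ε / 8 := by
    have h1 : 2 * Λ * R * (ε * (C₀ * ε * θ ^ k)) ≤ 2 * Λ * R * (ε * (C₀ * ε)) := by gcongr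
    have h2 : 16 * Λ * R * C₀ * ε * ε ≤ 1 * ε := by gcongr
    nlinarith
  -- The heart of the iteration: with η = K₂ε the factor ε cancels in the two Cauchy terms, which
  -- are at most θ/2 by the choice of K₂. The middle term is at most θ/2 for small ε.
  have hrate : 16 * Λ * R ^ 2 * ε / (K₂ * ε) + 4 * Λ * R * ε +
      20 * Λ * (R + (B₀ + 1)) * ε / (K₂ * ε) ≤ θ := by
    have h1 : 16 * Λ * R ^ 2 * ε / (K₂ * ε) + 20 * Λ * (R + (B₀ + 1)) * ε / (K₂ * ε) =
        (16 * Λ * R ^ 2 + 20 * Λ * (R + (B₀ + 1))) / K₂ := by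
      field_simp
    linarith
  have hrad : radius K K₁ ε (k + 1) ≤ R - k * (K₂ * ε) - K₂ * ε := by
    have h1 : ((k : ℝ) + 1) * (K₂ * ε) ≤ (M + 1) * (K₂ * ε) := by gcongr
    have h2 : 0 ≤ (k : ℝ) * K₁ * ε := by positivity
    rw [radius, Nat.cast_add_one, add_sub_cancel_right]
    linarith
  have hloss : 24 * Λ * R * (ε * (C₀ * ε * θ ^ k)) ≤ K₁ * ε / 2 := by
    have h1 : 24 * Λ * R * (ε * (C₀ * ε * θ ^ k)) ≤ 24 * Λ * R * (ε * (C₀ * ε)) := by gcongr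
    have h2 : 48 * Λ * R * C₀ * ε * ε ≤ K₁ * ε := by gcongr
    linarith
  obtain ⟨S', Θ, hS', hΘ⟩ := hS.exists_next (B := B₀ + 1) (η := K₂ * ε) (θ := θ) (K := K)
    (K₁ := K₁) (k := k + 1) hΛ hε hε1 hR1 (sub_le_self _ (by positivity)) (by linarith)
    (by linarith) (by linarith) (by positivity) (hN.trans hεC) (by nlinarith) (by nlinarith)
    (by linarith) hdisp hrate hrad hK₁ hloss
  have hradius : R - (k + 1 : ℕ) * (K₂ * ε) = R - k * (K₂ * ε) - K₂ * ε := by push_cast; ring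
  refine ⟨S', Θ, ⟨?_, ?_, ?_, fun Z hZ => ?_, fun Z hZ => ?_, fun Z hZ => ?_⟩, hΘ⟩
  · rw [hradius]; exact hS'.F_an
  · rw [hradius]; exact hS'.G_an
  · rw [hradius]; exact hS'.w_an
  · rw [hradius] at hZ
    refine (hS'.F_le Z hZ).trans ?_
    -- The increment of F is at most 2^(−k)/2, so F never exceeds B₀ + 1, the value used for B in
    -- every step.
    have h1 : 23 * Λ * R * (R + (B₀ + 1)) * (C₀ * ε * θ ^ k) ≤
        23 * Λ * R * (R + (B₀ + 1)) * (C₀ * ε * (1 / 2 ^ k)) := by gcongr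
    have h2 := mul_le_mul_of_nonneg_right hεF hp0.le
    rw [hps]
    linarith
  · rw [hradius] at hZ
    refine (hS'.G_le Z hZ).trans ?_
    -- The increment is at most 2^(−k)/8, exactly what takes (1 − 2^(−k))/4 to (1 − 2^(−k−1))/4.
    have h1 : 4 * (C₀ * ε * θ ^ k) / (K₂ * ε) ≤ 1 / 2 ^ k / 8 := by
      rw [div_le_iff₀ hη0]
      have h2 : 32 * C₀ * (ε * (1 / 2 ^ k)) ≤ K₂ * (ε * (1 / 2 ^ k)) := by gcongr
      linarith
    rw [hps]
    linarith
  · rw [hradius] at hZ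
    refine (hS'.w_le Z hZ).trans (le_of_eq ?_)
    ring

theorem ScaledSys.smul_toSys_G (S : ScaledSys Y1) {ε : ℝ} (hε : ε ≠ 0) (k : ℕ) :
    (fun Z => (ε : ℂ) • (S.toSys ε k).G Z) = S.G :=
  funext fun Z => smul_inv_smul₀ (Complex.ofReal_ne_zero.2 hε) (S.G Z)

theorem ScaledSys.smul_toSys_Gt (S : ScaledSys Y1) {ε : ℝ} (hε : ε ≠ 0) (k : ℕ) :
    (fun Z => (ε : ℂ) ^ k • (S.toSys ε k).Gt Z) = S.w :=
  funext fun Z => smul_inv_smul₀ (pow_ne_zero k (Complex.ofReal_ne_zero.2 hε)) (S.w Z)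

/-- The order of choice matters: θ depends on C₀, then K₂ on θ, then c on K₂ and K₁, and the bound
on ε comes last. The bounds on c limit the total loss of the working balls (through K₂) and keep the
radius of Ω_m above K (through K₁). -/
theorem exists_constants {Λ R B₀ C₀ K K₁ : ℝ} (hΛ : 0 ≤ Λ) (hR : 0 < R) (hB₀ : 0 ≤ B₀)
    (hC₀ : 0 < C₀) (hK : 0 < K) (hK₁ : 0 < K₁) :
    ∃ θ K₂ c ε₂ : ℝ, (0 < θ ∧ θ ≤ 1 / 2 ∧ 24 * C₀ * θ ≤ 1) ∧
      (4 ≤ K₂ ∧ 32 * C₀ ≤ K₂ ∧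
        (16 * Λ * R ^ 2 + 20 * Λ * (R + (B₀ + 1))) / K₂ ≤ θ / 2) ∧
      (0 < c ∧ c * (2 * K₂) ≤ 1 ∧ c * (2 * K₁) ≤ K) ∧ (0 < ε₂ ∧ ε₂ ≤ 1 / 2) ∧
      ∀ ε : ℝ, 0 < ε → ε < ε₂ → C₀ * ε ≤ 1 ∧ 8 * Λ * R * ε ≤ θ ∧ 16 * Λ * R * C₀ * ε ≤ 1 ∧
        48 * Λ * R * C₀ * ε ≤ K₁ ∧ 46 * Λ * R * (R + (B₀ + 1)) * C₀ * ε ≤ 1 ∧ 2 * ε ≤ c := by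
  obtain ⟨θ, hθdef⟩ : ∃ θ : ℝ, θ = 1 / (2 + 24 * C₀) := ⟨_, rfl⟩
  have hθ0 : 0 < θ := by rw [hθdef]; positivity
  have hθ : θ ≤ 1 / 2 := by
    rw [hθdef]
    exact one_div_le_one_div_of_le two_pos (by linarith)
  have hθC : 24 * C₀ * θ ≤ 1 := by
    rw [hθdef, mul_one_div, div_le_one (by positivity)]
    linarith
  have hQ : 0 < R + (B₀ + 1) := by linarith
  obtain ⟨K₂, hK₂def⟩ : ∃ K₂ : ℝ, K₂ = 4 + 32 * C₀ +
    2 * (16 * Λ * R ^ 2 + 20 * Λ * (R + (B₀ + 1))) / θ := ⟨_, rfl⟩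
  have hK₂pos : 0 ≤ 2 * (16 * Λ * R ^ 2 + 20 * Λ * (R + (B₀ + 1))) / θ := by positivity
  have hK₂ : 4 ≤ K₂ := by linarith
  have hK₂C : 32 * C₀ ≤ K₂ := by linarith
  have hK₂θ : (16 * Λ * R ^ 2 + 20 * Λ * (R + (B₀ + 1))) / K₂ ≤ θ / 2 := by
    have h1 : 2 * (16 * Λ * R ^ 2 + 20 * Λ * (R + (B₀ + 1))) / θ ≤ K₂ := by linarith
    rw [div_le_iff₀ hθ0] at h1
    rw [div_le_iff₀ (by linarith)]
    linarith
  obtain ⟨c, hcdef⟩ : ∃ c : ℝ, c = min (1 / (2 * K₂)) (K / (2 * K₁)) := ⟨_, rfl⟩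
  have hc0 : 0 < c := by
    rw [hcdef]
    have : 0 < K₂ := by linarith
    positivity
  have hcK₂ : c * (2 * K₂) ≤ 1 := by
    rw [← le_div_iff₀ (by linarith), hcdef]
    exact min_le_left _ _
  have hcK₁ : c * (2 * K₁) ≤ K := by
    rw [← le_div_iff₀ (by linarith), hcdef]
    exact min_le_right _ _
  obtain ⟨A, hA⟩ : ∃ A : ℝ, A = 2 + C₀ + 8 * Λ * R / θ + 16 * Λ * R * C₀ +
    48 * Λ * R * C₀ / K₁ + 46 * Λ * R * (R + (B₀ + 1)) * C₀ + 2 / c := ⟨_, rfl⟩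
  have ha1 : 0 ≤ 8 * Λ * R / θ := by positivity
  have ha2 : 0 ≤ 16 * Λ * R * C₀ := by positivity
  have ha3 : 0 ≤ 48 * Λ * R * C₀ / K₁ := by positivity
  have ha4 : 0 ≤ 46 * Λ * R * (R + (B₀ + 1)) * C₀ := by positivity
  have ha5 : 0 ≤ 2 / c := by positivity
  have hA0 : 0 < A := by linarith
  have hA2 : 1 / A ≤ 1 / 2 := one_div_le_one_div_of_le two_pos (by linarith)
  have hsmall : ∀ ε : ℝ, 0 < ε → ε < 1 / A → ∀ a : ℝ, a ≤ A → a * ε ≤ 1 := fun ε hε hεA a ha => by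
    rw [lt_div_iff₀ hA0] at hεA
    nlinarith
  refine ⟨θ, K₂, c, 1 / A, ⟨hθ0, hθ, hθC⟩, ⟨hK₂, hK₂C, hK₂θ⟩, ⟨hc0, hcK₂, hcK₁⟩,
    ⟨by positivity, hA2⟩, fun ε hε hεA => ⟨hsmall ε hε hεA _ (by linarith), ?_,
      hsmall ε hε hεA _ (by linarith), ?_, hsmall ε hε hεA _ (by linarith), ?_⟩⟩
  · have h1 := hsmall ε hε hεA (8 * Λ * R / θ) (by linarith)
    rwa [div_mul_eq_mul_div, div_le_one hθ0] at h1
  · have h1 := hsmall ε hε hεA (48 * Λ * R * C₀ / K₁) (by linarith)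
    rwa [div_mul_eq_mul_div, div_le_one hK₁] at h1
  · have h1 := hsmall ε hε hεA (2 / c) (by linarith)
    rwa [div_mul_eq_mul_div, div_le_one hc0] at h1

end

end KleinGordon


/-! ### Assembly of the lemma. -/

theorem lemma3p1 (f : ℂ → ℂ) (hf : KleinGordon.HypH f) (K₁ : ℝ) (hK₁ : 0 < K₁) :
    ∃ ε₀ c C : ℝ, 0 < ε₀ ∧ ε₀ < 1 ∧ 0 < c ∧ 0 < C ∧
      ∀ ε : ℝ, 0 < ε → ε < ε₀ →
        2 ≤ ⌊c / ε⌋₊ ∧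
        (∀ m : ℕ, m ≤ ⌊c / ε⌋₊ →
          KleinGordon.bigK f < KleinGordon.radius (KleinGordon.bigK f) K₁ ε m) ∧
        ∃ (S : ℕ → KleinGordon.Sys)
          (Θ : ℕ → OpenPartialHomeomorph KleinGordon.E KleinGordon.E),
          KleinGordon.IsKGSystem f ε (KleinGordon.Omega (KleinGordon.bigK f) K₁ ε 1) (S 1) ∧
          (∀ m : ℕ, 1 ≤ m → m ≤ ⌊c / ε⌋₊ →
            AnalyticOnNhd ℂ (S m).F (KleinGordon.Omega (KleinGordon.bigK f) K₁ ε m) ∧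
            AnalyticOnNhd ℂ (S m).G (KleinGordon.Omega (KleinGordon.bigK f) K₁ ε m) ∧
            AnalyticOnNhd ℂ (S m).Gt (KleinGordon.Omega (KleinGordon.bigK f) K₁ ε m)) ∧
          (∀ m : ℕ, 2 ≤ m → m ≤ ⌊c / ε⌋₊ →
            KleinGordon.IsNormalFormStep (KleinGordon.bigK f) K₁ ε (m - 1)
              (S (m - 1)) (S m) (Θ m) ∧
            KleinGordon.OpBoundedBy (fun Z => (ε : ℂ) • (S m).G Z)
              (KleinGordon.Omega (KleinGordon.bigK f) K₁ ε m) (1 - 1 / 2 ^ m) ∧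
            KleinGordon.C2BoundedBy (fun Z => (ε : ℂ) ^ m • (S m).Gt Z)
              (KleinGordon.Omega (KleinGordon.bigK f) K₁ ε m) (ε / 2 ^ m)) ∧
          KleinGordon.C2BoundedBy (fun Z => (ε : ℂ) ^ ⌊c / ε⌋₊ • (S ⌊c / ε⌋₊).Gt Z)
            (KleinGordon.zball (KleinGordon.bigK f))
            (C * ε * Real.exp (-(c * Real.log (√2)) / ε)) := by
  open KleinGordon Metric in
  obtain ⟨Λ, hΛ⟩ := exists_boundedBy kgData
  have hΛ0 : 0 ≤ Λ := zero_le_one.trans hΛ.one_le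
  have hK := one_le_bigK f
  set K := bigK f with hKdef
  -- Of the margin 4 beyond 2K, at most 1 is lost in all steps together and 2 serve the Cauchy
  -- estimates for the C² norm.
  obtain ⟨R, hRK⟩ : ∃ R : ℝ, R = 2 * K + 4 := ⟨_, rfl⟩
  have hR0 : 0 < R := by linarith
  obtain ⟨C₀, B₀, ε₁, hC₀, hB₀, hε₁, hinit⟩ := hf.exists_initial R hR0
  obtain ⟨θ, K₂, c, ε₂, ⟨hθ0, hθ, hθC⟩, ⟨hK₂, hK₂C, hK₂θ⟩, ⟨hc0, hcK₂, hcK₁⟩, ⟨hε₂, hε₂'⟩,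
    hsmall⟩ := exists_constants hΛ0 hR0 hB₀ hC₀ (zero_lt_one.trans_le hK) hK₁
  refine ⟨min ε₁ ε₂, c, 2, by positivity, (min_le_right _ _).trans_lt (by linarith), hc0,
    two_pos, fun ε hε hεlt => ?_⟩
  rw [lt_min_iff] at hεlt
  obtain ⟨hεC, hεR, hεd, hεK₁, hεF, hεc⟩ := hsmall ε hε hεlt.2
  have hM2 : 2 ≤ ⌊c / ε⌋₊ := by
    apply Nat.le_floor
    rw [Nat.cast_ofNat, le_div_iff₀ hε]
    exact hεc
  have hMc : (⌊c / ε⌋₊ : ℝ) * ε ≤ c := by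
    rw [← le_div_iff₀ hε]
    exact Nat.floor_le (by positivity)
  obtain ⟨M, hM⟩ : ∃ M : ℕ, M = ⌊c / ε⌋₊ := ⟨_, rfl⟩
  rw [← hM] at hM2 hMc ⊢
  have hrad : ∀ m : ℕ, m ≤ M → K < radius K K₁ ε m := by
    intro m hm
    have h1 : (m : ℝ) ≤ M := by exact_mod_cast hm
    have h2 : ((m : ℝ) - 1) * K₁ * ε ≤ M * K₁ * ε := by gcongr; linarith
    have h3 : M * ε * K₁ ≤ c * K₁ := by gcongr
    rw [radius]
    linarith
  obtain ⟨S₀, hG, hFan, hwan, hF, hw, hKG⟩ := hinit ε hε hεlt.1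
  have hS₀ : S₀.Bounds R B₀ 0 (C₀ * ε) :=
    ⟨hFan, fun Z _ => (analyticAt_const (v := (0 : Y1 →L[ℂ] Y1))).congr
      (Filter.Eventually.of_forall fun Z => (hG Z).symm), hwan, hF, fun Z _ => by simp [hG], hw⟩
  have hM1 : ((M : ℝ) + 1) * (K₂ * ε) ≤ 1 := by
    have h1 : (2 : ℝ) ≤ M := by exact_mod_cast hM2
    have h2 : M * ε * K₂ ≤ c * K₂ := by gcongr
    have h3 : (1 : ℝ) * (K₂ * ε) ≤ M * (K₂ * ε) := by gcongr; linarith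
    linarith
  obtain ⟨s, t, hs0, hsB, hst⟩ := exists_normalFormSequence (K := K) hΛ (by linarith) hRK hB₀ hC₀
    hθ0 hθ hK₁ hK₂ hK₂C hK₂θ hε (by linarith) hεC hεR hεd hεK₁ hεF hM1 hS₀
  have hΩ : ∀ k : ℕ, k + 1 ≤ M →
      Omega K K₁ ε (k + 1) ⊆ ball (0 : E) (R - k * (K₂ * ε) - 2) := by
    intro k hk
    refine (zball_subset_ball _).trans (ball_subset_ball ?_)
    have h3 : (k : ℝ) + 1 ≤ M := by exact_mod_cast hk
    have h4 : (k : ℝ) * (K₂ * ε) ≤ (M + 1) * (K₂ * ε) := by gcongr; linarith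
    have h5 : 0 ≤ (k : ℝ) * K₁ * ε := by positivity
    rw [radius, Nat.cast_add_one, add_sub_cancel_right]
    linarith
  have hC2 : ∀ k : ℕ, k + 2 ≤ M → C2BoundedBy (s (k + 1)).w (Omega K K₁ ε (k + 2))
      (ε / 2 ^ (k + 2)) := by
    intro k hk
    refine (hsB (k + 1) (by omega)).c2BoundedBy (by positivity) (hΩ (k + 1) hk) ?_
    have h2 := pow_le_half_pow hθ0.le hθ k
    -- One factor θ of θ^(k+1) is spent on absorbing the constants: 6 C₀ θ ≤ 1/4 turns 6 C₀ ε
    -- θ^(k+1) into ε/2^(k+2).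
    have h3 : 24 * C₀ * θ * (ε * θ ^ k) ≤ 1 * (ε * (1 / 2 ^ k)) := by gcongr
    have h4 : ε / 2 ^ (k + 2) = ε * (1 / 2 ^ k) / 4 := by rw [pow_add]; field_simp; norm_num
    rw [h4, pow_succ]
    linarith
  -- The sequence s starts at 0 and the stages at 1, while the first transformation is the one with
  -- m = 2. The values at smaller indices, produced by truncated subtraction, play no role.
  refine ⟨hM2, hrad, fun m => (s (m - 1)).toSys ε m, fun m => t (m - 2), ?_, fun m hm1 hm => ?_,
    fun m hm2 hm => ?_, ?_⟩
  · intro W hW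
    simp only [Nat.sub_self, hs0]
    refine hKG W (ball_subset_ball ?_ (hΩ 0 (by omega) hW))
    simp
  · obtain ⟨k, rfl⟩ : ∃ k, m = k + 1 := ⟨m - 1, by omega⟩
    have hB := hsB k (by omega)
    have hsub : Omega K K₁ ε (k + 1) ⊆ ball (0 : E) (R - k * (K₂ * ε)) :=
      (hΩ k hm).trans (ball_subset_ball (by linarith))
    beta_reduce
    rw [Nat.add_sub_cancel]
    exact ⟨fun Z hZ => hB.F_an Z (hsub hZ),
      fun Z hZ => (analyticAt_const (v := (ε : ℂ)⁻¹)).smul (hB.G_an Z (hsub hZ)),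
      fun Z hZ => (analyticAt_const (v := ((ε : ℂ) ^ (k + 1))⁻¹)).smul (hB.w_an Z (hsub hZ))⟩
  · obtain ⟨k, rfl⟩ : ∃ k, m = k + 2 := ⟨m - 2, by omega⟩
    beta_reduce
    rw [show k + 2 - 1 = k + 1 from rfl, Nat.add_sub_cancel,
      ScaledSys.smul_toSys_G _ hε.ne', ScaledSys.smul_toSys_Gt _ hε.ne']
    refine ⟨hst k (by omega), (hsB (k + 1) (by omega)).opBoundedBy
      ((hΩ (k + 1) hm).trans (ball_subset_ball (by linarith))) ?_, hC2 k hm⟩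
    have h2 : (0 : ℝ) < 1 / 2 ^ (k + 1) := by positivity
    have h3 : (1 : ℝ) / 2 ^ (k + 2) = 1 / 2 ^ (k + 1) / 2 := by rw [pow_succ _ (k + 1)]; field_simp
    have h4 : (1 : ℝ) / 2 ^ (k + 1) ≤ 1 := by
      rw [div_le_one (by positivity)]
      exact one_le_pow₀ one_le_two
    rw [h3]
    linarith
  · rw [ScaledSys.smul_toSys_Gt _ hε.ne']
    obtain ⟨k, rfl⟩ : ∃ k, M = k + 2 := ⟨M - 2, by omega⟩
    obtain ⟨b₀, b₁, b₂, hb₀, hb₁, hb₂, hsum, hb⟩ := hC2 k le_rfl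
    refine ⟨b₀, b₁, b₂, hb₀, hb₁, hb₂, hsum.trans ?_, fun Z hZ => hb Z ?_⟩
    · have h1 := inv_two_pow_floor_le hc0 hε
      rw [← hM] at h1
      calc ε / 2 ^ (k + 2) = ε * (1 / 2 ^ (k + 2)) := by ring
        _ ≤ ε * (2 * Real.exp (-(c * Real.log (√2)) / ε)) := by gcongr
        _ = _ := by ring
    · exact lt_trans hZ (hrad (k + 2) le_rfl)
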